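/- For $\nu\in\mathbb C$ let $P_\nu(x)={}_2F_1\big(-\nu,\nu+1;1;\tfrac{1-x}{2}\big)$, $-1<x\le 1$, be the Legendre function of the first kind. Write $(a)_k=a(a+1)\cdots(a+k-1)$, $\psi=\Gamma'/\Gamma$, and $${}_pF_{p-1}\left(\left.\begin{array}{c}a_1,\dots,a_p\\ b_1,\dots,b_{p-1}\end{array}\right|1\right)=\sum_{k=0}^\infty\frac{(a_1)_k\cdots(a_p)_k}{(b_1)_k\cdots(b_{p-1})_k}\frac1{k!}.$$ Suppose $\Re\nu>-1$. Then the integral $$\widetilde T_\nu=\int_{-1}^1 P_\nu(x)^2P_\nu(-x)(1-x^2)^{(\nu-1)/2}\,dx$$ converges absolutely, and the following hold. (a) $$\widetilde T_\nu=\frac1\pi\left(\frac{\cos\frac{\nu\pi}2}{2^\nu}\right)^3\left[\frac{\Gamma(\frac{1+\nu}2)}{\Gamma(\frac{2+\nu}2)}\right]^4 .$$ (b) $$\widetilde T_\nu=\frac{\sin(\nu\pi)\cos\frac{\nu\pi}2}{2^\nu\pi}\left[\frac{\Gamma(\frac{1+\nu}2)}{\Gamma(\frac{2+\nu}2)}\right]^2\sum_{k=0}^\infty\frac{\big(\frac{1+\nu}2\big)_k^2(-\nu)_k}{(k!)^3}\left[2\psi\Big(k+\frac{\nu+1}2\Big)+\psi(k-\nu)-3\psi(k+1)\right].$$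 If $\nu\notin\mathbb Z_{\ge0}$, the series converges absolutely and this is a plain equality. If $\nu=n\in\mathbb Z_{\ge0}$ (where $\sin(\nu\pi)=0$ and $\psi(k-\nu)$ has a pole for $k\le n$), the right-hand side is understood through limits: for each $k$, the product of the prefactor and the $k$-th term of the series has a limit as $\nu\to n$, $\nu\ne n$, and the series of these limits converges to $\widetilde T_n$; moreover the whole right-hand side tends to $\widetilde T_n$ as $\nu\to n$, $\nu\neq n$. (c) If in addition $\nu\notin\mathbb Z$, then $$\widetilde T_\nu=\frac1\pi\left(\frac{\cos\frac{\nu\pi}2}{2^\nu}\right)^3\left[\frac{\Gamma(\frac{1+\nu}2)}{\Gamma(\frac{2+\nu}2)}\right]^2\frac{2^{2\nu+1}(1-\nu)}{\nu(\nu+1)\cot\frac{\nu\pi}2}\;{}_5F_4\left(\left.\begin{array}{c}\frac{1-\nu}2,\ \frac{5-\nu}4,\ \frac{1-\nu}2,\ -\nu,\ \frac{1+\nu}2\\[2pt] \frac{1-\nu}4,\ 1,\ \frac{3+\nu}2,\ 1-\nu\end{array}\right|1\right),$$ where the well-poised ${}_5F_4$ series converges absolutely. -/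

import Mathlib

open Complex Filter Topology

noncomputable section

/-- The Legendre function of the first kind of arbitrary complex degree `ν` on the cut
`-1 < x ≤ 1`, given by `P_ν(x) = ₂F₁(-ν, ν + 1; 1; (1 - x) / 2)`. -/
def legendreP (ν : ℂ) (x : ℝ) : ℂ :=
  ₂F₁ (-ν) (ν + 1) (1 : ℂ) ((((1 - x) / 2 : ℝ)) : ℂ)

/-- The integrand `P_ν(x)² P_ν(-x) (1 - x²)^((ν - 1) / 2)`. -/
def tildeTIntegrand (ν : ℂ) (x : ℝ) : ℂ :=
  legendreP ν x ^ 2 * legendreP ν (-x) * (((1 - x ^ 2 : ℝ)) : ℂ) ^ ((ν - 1) / 2)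

/-- The integral `T̃_ν = ∫_{-1}^1 P_ν(x)² P_ν(-x) (1 - x²)^((ν - 1) / 2) dx`. -/
def tildeT (ν : ℂ) : ℂ :=
  ∫ x in (-1 : ℝ)..1, tildeTIntegrand ν x

/-- The rising factorial `(a)_k = a (a + 1) ⋯ (a + k - 1)`. -/
def risingFactorial (a : ℂ) (k : ℕ) : ℂ :=
  (ascPochhammer ℂ k).eval a

/-- The `k`-th term of the generalized hypergeometric series with upper parameters `as` and lower
parameters `bs` at the argument `z`. -/
def pFqTerm (as bs : List ℂ) (z : ℂ) (k : ℕ) : ℂ :=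
  (as.map fun a => risingFactorial a k).prod / (bs.map fun b => risingFactorial b k).prod *
    (z ^ k / (k.factorial : ℂ))

/-- The generalized hypergeometric series. -/
def pFq (as bs : List ℂ) (z : ℂ) : ℂ :=
  ∑' k : ℕ, pFqTerm as bs z k

/-- The prefactor `sin(νπ) cos(νπ/2) / (2^ν π) · [Γ((1+ν)/2) / Γ((2+ν)/2)]²`. -/
def digammaSeriesPrefactor (ν : ℂ) : ℂ :=
  sin (ν * Real.pi) * cos (ν * Real.pi / 2) / ((2 : ℂ) ^ ν * Real.pi) *
    (Gamma ((1 + ν) / 2) / Gamma ((2 + ν) / 2)) ^ 2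

/-- The summand
`((1+ν)/2)_k² (-ν)_k / (k!)³ · [2 ψ(k + (ν+1)/2) + ψ(k - ν) - 3 ψ(k + 1)]`. -/
def digammaSeriesTerm (ν : ℂ) (k : ℕ) : ℂ :=
  risingFactorial ((1 + ν) / 2) k ^ 2 * risingFactorial (-ν) k / (k.factorial : ℂ) ^ 3 *
    (2 * digamma (k + (ν + 1) / 2) + digamma (k - ν) - 3 * digamma (k + 1))

/-- Upper parameters of the well-poised `₅F₄`. -/
def wellPoisedUpper (ν : ℂ) : List ℂ :=
  [(1 - ν) / 2, (5 - ν) / 4, (1 - ν) / 2, -ν, (1 + ν) / 2]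

/-- Lower parameters of the well-poised `₅F₄`. -/
def wellPoisedLower (ν : ℂ) : List ℂ :=
  [(1 - ν) / 4, 1, (3 + ν) / 2, 1 - ν]

end

/-! Put `y = (1 - x) / 2` and `a = (1 + ν) / 2`; the weight becomes a constant times `(y (1 - y))^(a
- 1)`. Write `P_ν(1 - 2 y) = ∑ c_j y^j`. A product `c_p c_q` is a finite combination of the `c_j`
with coefficients free of `ν` (`legendreCoeff_mul`). Summing these relations gives Bailey's
factorization: `P_ν(1 - 2 X) P_ν(1 - 2 Y)` is the sum of `c_j` times the central coefficient of the
`j`-th power of a quadratic depending on `X, Y`. On `X + Y = 1` this formally reads `P_ν(x) P_ν(-x)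
= ∑ c_j B_j(y)`, with `B_j` a polynomial in `y (1 - y)`.

The factorization is proved only near the origin, so the line `X + Y = 1` is reached through Abel
means: along a path from `(0, 0)` to `(y, 1 - y)` the series becomes `∑ c_j B_j(y) r^j`. The
identity theorem carries the equality to all `0 < r < 1`, and the product side supplies a bound
uniform in `r`.

The remaining factor `P_ν(x)` is integrated against the `B_j`. Its moments for the weights `(y (1 -
y))^(s - 1)` obey a first-order recurrence in `s`, explicitly solvable from `s = a` because `ν + 1 =
2 a`. Chu–Vandermonde turns the result into a Cauchy product, and two uses of Gauss's theorem sum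
the resulting double series (`tsum_doubleTerm`). Abel's theorem and dominated convergence give
`integral_tripleProduct`; duplication and reflection for `Γ` then give (a).

For (b) and (c) the two series are evaluated on their own and compared with the closed form. The
digamma series is the derivative at `d = 0` of the non-terminating Saalschütz theorem
(`hasSum_digamma_saal`), and at integers the limiting terms form a terminating Saalschütz sum. The
series in (c) is a case of Dougall's theorem.

The theorems of Gauss, Saalschütz and Dougall share one proof: a telescoping certificate yields a
relation shifting a parameter by one, and iterating it to infinity leaves a degenerate series times
a limit of rising factorials, which is a quotient of Gamma values. -/

/-! ### Rising factorials and the Gamma function. -/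

theorem risingFactorial_zero (a : ℂ) : risingFactorial a 0 = 1 := by simp [risingFactorial]

theorem risingFactorial_succ (a : ℂ) (k : ℕ) :
    risingFactorial a (k + 1) = risingFactorial a k * (a + k) := by
  simp [risingFactorial, ascPochhammer_succ_eval]

theorem risingFactorial_succ_left (a : ℂ) (k : ℕ) :
    risingFactorial a (k + 1) = a * risingFactorial (a + 1) k := by
  induction k with
  | zero => simp [risingFactorial_succ, risingFactorial_zero]
  | succ k ih =>
    rw [risingFactorial_succ, ih, risingFactorial_succ]
    push_cast
    ring

theorem risingFactorial_shift (a : ℂ) (k : ℕ) :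
    a * risingFactorial (a + 1) k = risingFactorial a k * (a + k) := by
  rw [← risingFactorial_succ_left, risingFactorial_succ]

theorem risingFactorial_add (a : ℂ) (m n : ℕ) :
    risingFactorial a (m + n) = risingFactorial a m * risingFactorial (a + m) n := by
  induction n with
  | zero => simp [risingFactorial_zero]
  | succ n ih =>
    rw [← add_assoc, risingFactorial_succ, ih, risingFactorial_succ]
    push_cast
    ring

theorem risingFactorial_one (k : ℕ) : risingFactorial 1 k = k.factorial := by
  induction k with
  | zero => simp [risingFactorial_zero]
  | succ k ih =>
    rw [risingFactorial_succ, ih, Nat.factorial_succ]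
    push_cast
    ring

theorem risingFactorial_ne_zero {a : ℂ} (ha : ∀ i : ℕ, a + i ≠ 0) (k : ℕ) :
    risingFactorial a k ≠ 0 := by
  induction k with
  | zero => simp [risingFactorial_zero]
  | succ k ih =>
    rw [risingFactorial_succ]
    exact mul_ne_zero ih (ha k)

theorem risingFactorial_neg_nat_eq_zero {n k : ℕ} (h : n < k) :
    risingFactorial (-n) k = 0 := by
  obtain ⟨j, rfl⟩ := Nat.exists_eq_add_of_lt h
  rw [show n + j + 1 = n + 1 + j by ring, risingFactorial_add, risingFactorial_succ]
  simp

theorem risingFactorial_eq_prod (a : ℂ) (k : ℕ) :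
    risingFactorial a k = ∏ j ∈ Finset.range k, (a + j) := by
  induction k with
  | zero => simp [risingFactorial_zero]
  | succ k ih => rw [risingFactorial_succ, ih, Finset.prod_range_succ]

theorem Gamma_add_nat {a : ℂ} (ha : ∀ i : ℕ, a + i ≠ 0) (k : ℕ) :
    Gamma (a + k) = risingFactorial a k * Gamma a := by
  induction k with
  | zero => simp [risingFactorial_zero]
  | succ k ih =>
    rw [risingFactorial_succ, Nat.cast_succ, ← add_assoc, Gamma_add_one _ (ha k), ih]
    ring

theorem Gamma_ne_zero_of_add_nat {a : ℂ} (ha : ∀ i : ℕ, a + i ≠ 0) : Gamma a ≠ 0 :=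
  Gamma_ne_zero fun m h => ha m (by rw [h]; ring)

/-- This holds at the poles of `Γ` as well, where both sides vanish. -/
theorem risingFactorial_div_Gamma_add_nat (a : ℂ) (k : ℕ) :
    risingFactorial a k / Gamma (a + k) = 1 / Gamma a := by
  by_cases ha : ∀ i : ℕ, a + i ≠ 0
  · have h1 := Gamma_ne_zero_of_add_nat ha
    have h2 := risingFactorial_ne_zero ha k
    rw [Gamma_add_nat ha]
    field_simp
  · push Not at ha
    obtain ⟨m, hm⟩ := ha
    obtain rfl : a = -m := eq_neg_of_add_eq_zero_left hm
    rw [Gamma_neg_nat_eq_zero]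
    rcases lt_or_ge m k with h | h
    · simp [risingFactorial_neg_nat_eq_zero h]
    · obtain ⟨j, rfl⟩ := Nat.exists_eq_add_of_le h
      have : (-((k + j : ℕ) : ℂ) + k) = -j := by push_cast; ring
      rw [this, Gamma_neg_nat_eq_zero]
      simp

/-! ### Growth of quotients of rising factorials. -/

theorem exists_pos_le_norm_add_nat {y : ℂ} (hy : ∀ i : ℕ, y + i ≠ 0) :
    ∃ δ > 0, ∀ i : ℕ, δ ≤ ‖y + i‖ := by
  obtain ⟨n, hn⟩ := exists_nat_ge (‖y‖ + 1)
  have hne : (Finset.range (n + 1)).Nonempty := ⟨0, by simp⟩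
  obtain ⟨j, -, hj⟩ := Finset.exists_min_image (Finset.range (n + 1)) (fun i : ℕ => ‖y + i‖) hne
  refine ⟨min 1 ‖y + j‖, lt_min one_pos (norm_pos_iff.2 (hy j)), fun i => ?_⟩
  rcases lt_or_ge i (n + 1) with h | h
  · exact (min_le_right _ _).trans (hj i (by simpa using h))
  · refine (min_le_left _ _).trans ?_
    have h1 : (n : ℝ) ≤ i := by exact_mod_cast (by omega : n ≤ i)
    have h2 : ‖(i : ℂ)‖ ≤ ‖y + i‖ + ‖y‖ := by
      calc ‖(i : ℂ)‖ = ‖(y + i) - y‖ := by ring_nf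
        _ ≤ _ := norm_sub_le _ _
    rw [norm_natCast] at h2
    linarith

/-- Since `|1 + u|² = 1 + 2 Re u + |u|²`, this is `1 + t ≤ exp t`. Keeping `Re u` rather than `|u|`
in first order is what later gives the sharp exponent `Re (x - y)`. -/
theorem norm_one_add_le_exp (u : ℂ) : ‖1 + u‖ ≤ Real.exp (u.re + ‖u‖ ^ 2 / 2) := by
  have h1 : ‖1 + u‖ ^ 2 ≤ Real.exp (u.re + ‖u‖ ^ 2 / 2) ^ 2 := by
    rw [← Real.exp_nat_mul]
    refine le_trans (le_of_eq ?_) (Real.add_one_le_exp _)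
    rw [← normSq_eq_norm_sq, ← normSq_eq_norm_sq, normSq_apply, normSq_apply]
    simp
    ring
  exact (pow_le_pow_iff_left₀ (norm_nonneg _) (Real.exp_pos _).le two_ne_zero).1 h1

theorem exp_mul_harmonic_le (e : ℝ) (k : ℕ) :
    Real.exp (e * harmonic k) ≤ Real.exp |e| * ((k : ℝ) + 1) ^ e := by
  have h1 : Real.log (k + 1) ≤ harmonic k := by exact_mod_cast log_add_one_le_harmonic k
  have h2 : (harmonic k : ℝ) ≤ 1 + Real.log (k + 1) := by
    rcases Nat.eq_zero_or_pos k with rfl | hk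
    · simp
    · refine (harmonic_le_one_add_log k).trans ?_
      gcongr
      linarith
  have hk : (0 : ℝ) < (k : ℝ) + 1 := by positivity
  rw [Real.rpow_def_of_pos hk, ← Real.exp_add]
  gcongr
  rcases le_total 0 e with he | he
  · rw [abs_of_nonneg he]; nlinarith
  · rw [abs_of_nonpos he]; nlinarith

/-- Polynomial growth of a ratio of rising factorials, uniformly in the parameters. -/
theorem exists_norm_risingFactorial_div_le_of_norm_le (R δ : ℝ) (hδ : 0 < δ) :
    ∃ C > 0, ∀ x y : ℂ, ‖x‖ ≤ R → ‖y‖ ≤ R → (∀ i : ℕ, δ ≤ ‖y + i‖) → ∀ k : ℕ,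
      ‖risingFactorial x k / risingFactorial y k‖ ≤ C * ((k : ℝ) + 1) ^ (x.re - y.re) := by
  rcases lt_or_ge R 0 with hR | hR
  · exact ⟨1, one_pos, fun x y hx => absurd ((norm_nonneg x).trans hx) (by linarith)⟩
  -- Chosen so that `|y + i| ≥ c (i + 1)`: if `i + 1 ≥ 2 (R + 1)` then `|y + i| ≥ i - R ≥ (i + 1) /
  -- 2`, and otherwise the lower bound `δ` suffices.
  set c : ℝ := min (1 / 2) (δ / (2 * (R + 1))) with hc
  have hc0 : 0 < c := by positivity
  -- Collects the two errors of order `(i + 1)⁻²`: replacing `y + i` by `i + 1` in `u = (x - y) / (y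
  -- + i)`, and the term `|u|² / 2`.
  set K : ℝ := 2 * R * (R + 1) / c + (2 * R / c) ^ 2 / 2 with hK
  have hK0 : 0 ≤ K := by positivity
  refine ⟨Real.exp (2 * R + 2 * K), Real.exp_pos _, fun x y hx hy hyi k => ?_⟩
  have hlow : ∀ i : ℕ, c * ((i : ℝ) + 1) ≤ ‖y + i‖ := by
    intro i
    rcases le_total (2 * (R + 1)) ((i : ℝ) + 1) with h | h
    · have h2 : ‖(i : ℂ)‖ ≤ ‖y + i‖ + ‖y‖ := by
        calc ‖(i : ℂ)‖ = ‖(y + i) - y‖ := by ring_nf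
          _ ≤ _ := norm_sub_le _ _
      rw [norm_natCast] at h2
      have : c * ((i : ℝ) + 1) ≤ 1 / 2 * ((i : ℝ) + 1) := by gcongr; exact min_le_left _ _
      linarith
    · calc c * ((i : ℝ) + 1) ≤ δ / (2 * (R + 1)) * (2 * (R + 1)) := by
            gcongr; exact min_le_right _ _
        _ = δ := by field_simp
        _ ≤ _ := hyi i
  have hstep : ∀ i : ℕ, ‖(x + i) / (y + i)‖ ≤
      Real.exp ((x.re - y.re) / ((i : ℝ) + 1) + K / ((i : ℝ) + 1) ^ 2) := by
    intro i
    have hpos : 0 < ‖y + i‖ := hδ.trans_le (hyi i)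
    have hne : y + i ≠ 0 := norm_pos_iff.1 hpos
    have hi : (0 : ℝ) < (i : ℝ) + 1 := by positivity
    have hiC : (i : ℂ) + 1 ≠ 0 := by exact_mod_cast hi.ne'
    have hxy : ‖x - y‖ ≤ 2 * R := (norm_sub_le _ _).trans (by linarith)
    have hy1 : ‖1 - y‖ ≤ R + 1 := (norm_sub_le _ _).trans (by simp; linarith)
    set u : ℂ := (x - y) / (y + i) with hu
    have e1 : (x + i) / (y + i) = 1 + u := by rw [hu]; field_simp; ring
    have hunorm : ‖u‖ ≤ 2 * R / c / ((i : ℝ) + 1) := by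
      rw [hu, norm_div, div_div]
      gcongr
      exact hlow i
    have e2 : u = (((x.re - y.re) / ((i : ℝ) + 1) : ℝ) : ℂ) +
        (((x.im - y.im) / ((i : ℝ) + 1) : ℝ) : ℂ) * I +
        (x - y) * (1 - y) / (((i : ℂ) + 1) * (y + i)) := by
      have : (((x.re - y.re) / ((i : ℝ) + 1) : ℝ) : ℂ) +
        (((x.im - y.im) / ((i : ℝ) + 1) : ℝ) : ℂ) * I = (x - y) / ((i : ℂ) + 1) := by
        conv_rhs => rw [← re_add_im x, ← re_add_im y]
        push_cast
        field_simp
        ring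
      rw [this, hu]
      field_simp
      ring
    have hrem : ‖(x - y) * (1 - y) / (((i : ℂ) + 1) * (y + i))‖ ≤
        2 * R * (R + 1) / c / ((i : ℝ) + 1) ^ 2 := by
      rw [norm_div, norm_mul, norm_mul, div_div]
      have : ‖(i : ℂ) + 1‖ = (i : ℝ) + 1 := by
        rw [show (i : ℂ) + 1 = (((i : ℝ) + 1 : ℝ) : ℂ) by push_cast; rfl, norm_real,
          Real.norm_of_nonneg hi.le]
      rw [this, show c * ((i : ℝ) + 1) ^ 2 = ((i : ℝ) + 1) * (c * ((i : ℝ) + 1)) by ring]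
      gcongr
      exact hlow i
    have hre : u.re ≤ (x.re - y.re) / ((i : ℝ) + 1) +
        2 * R * (R + 1) / c / ((i : ℝ) + 1) ^ 2 := by
      have h3 := (re_le_norm ((x - y) * (1 - y) / (((i : ℂ) + 1) * (y + i)))).trans hrem
      rw [e2, add_re, add_re, ofReal_re, re_ofReal_mul, I_re, mul_zero]
      linarith
    rw [e1]
    refine (norm_one_add_le_exp u).trans (Real.exp_le_exp.2 ?_)
    have h4 : ‖u‖ ^ 2 ≤ (2 * R / c) ^ 2 / ((i : ℝ) + 1) ^ 2 := by
      rw [← div_pow]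
      gcongr
    rw [hK, add_div]
    have : (2 * R / c) ^ 2 / 2 / ((i : ℝ) + 1) ^ 2 = (2 * R / c) ^ 2 / ((i : ℝ) + 1) ^ 2 / 2 := by
      ring
    linarith
  -- The bracket `2 - 1 / (k + 1/2)` is zero at `k = 0` and increases by at least `1 / (k + 1)²` at
  -- each step, so it serves as a bounded induction-friendly majorant of `∑ 1 / (i + 1)²`.
  have hprod : ∀ k : ℕ, ‖risingFactorial x k / risingFactorial y k‖ ≤
      Real.exp ((x.re - y.re) * harmonic k + K * (2 - 1 / ((k : ℝ) + 1 / 2))) := by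
    intro k
    induction k with
    | zero => simp [risingFactorial_zero]
    | succ k ih =>
      rw [risingFactorial_succ, risingFactorial_succ, mul_div_mul_comm, norm_mul]
      refine (mul_le_mul ih (hstep k) (norm_nonneg _) (Real.exp_pos _).le).trans ?_
      rw [← Real.exp_add, harmonic_succ]
      refine Real.exp_le_exp.2 ?_
      push_cast
      have h5 : 1 / ((k : ℝ) + 1) ^ 2 ≤ 1 / ((k : ℝ) + 1 / 2) - 1 / ((k : ℝ) + 1 + 1 / 2) := by
        have : 1 / ((k : ℝ) + 1 / 2) - 1 / ((k : ℝ) + 1 + 1 / 2)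
          = 1 / (((k : ℝ) + 1 / 2) * ((k : ℝ) + 1 + 1 / 2)) := by field_simp; ring
        rw [this]
        apply one_div_le_one_div_of_le (by positivity)
        nlinarith
      have h6 := mul_le_mul_of_nonneg_left h5 hK0
      rw [mul_one_div] at h6
      rw [div_eq_mul_inv (x.re - y.re)]
      linarith
  refine (hprod k).trans ?_
  have he : |x.re - y.re| ≤ 2 * R := by
    rw [← sub_re]
    exact (abs_re_le_norm _).trans ((norm_sub_le _ _).trans (by linarith))
  have h7 : K * (2 - 1 / ((k : ℝ) + 1 / 2)) ≤ 2 * K := by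
    have : 0 ≤ 1 / ((k : ℝ) + 1 / 2) := by positivity
    nlinarith
  calc Real.exp ((x.re - y.re) * harmonic k + K * (2 - 1 / ((k : ℝ) + 1 / 2)))
      ≤ Real.exp ((x.re - y.re) * harmonic k) * Real.exp (2 * K) := by
        rw [← Real.exp_add]; gcongr
    _ ≤ Real.exp |x.re - y.re| * ((k : ℝ) + 1) ^ (x.re - y.re) * Real.exp (2 * K) := by
        gcongr
        exact exp_mul_harmonic_le _ _
    _ ≤ Real.exp (2 * R) * ((k : ℝ) + 1) ^ (x.re - y.re) * Real.exp (2 * K) := by gcongr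
    _ = Real.exp (2 * R + 2 * K) * ((k : ℝ) + 1) ^ (x.re - y.re) := by
        rw [Real.exp_add]; ring

theorem exists_norm_risingFactorial_div_le (x : ℂ) {y : ℂ} (hy : ∀ i : ℕ, y + i ≠ 0) :
    ∃ C > 0, ∀ k : ℕ,
      ‖risingFactorial x k / risingFactorial y k‖ ≤ C * ((k : ℝ) + 1) ^ (x.re - y.re) := by
  obtain ⟨δ, hδ, h⟩ := exists_pos_le_norm_add_nat hy
  obtain ⟨C, hC, hb⟩ := exists_norm_risingFactorial_div_le_of_norm_le (max ‖x‖ ‖y‖) δ hδ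
  exact ⟨C, hC, hb x y (le_max_left _ _) (le_max_right _ _) h⟩

theorem one_add_nat_ne_zero (i : ℕ) : (1 : ℂ) + i ≠ 0 := by
  rw [add_comm]; exact Nat.cast_add_one_ne_zero i

theorem exists_norm_risingFactorial_div_factorial_le (x : ℂ) :
    ∃ C > 0, ∀ k : ℕ,
      ‖risingFactorial x k / k.factorial‖ ≤ C * ((k : ℝ) + 1) ^ (x.re - 1) := by
  simpa [risingFactorial_one] using exists_norm_risingFactorial_div_le x one_add_nat_ne_zero

theorem add_nat_ne_zero_of_re_pos {y : ℂ} (hy : 0 < y.re) (i : ℕ) : y + i ≠ 0 := by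
  intro h
  have := congrArg re h
  simp at this
  have : (0 : ℝ) ≤ i := i.cast_nonneg
  linarith

/-! ### Limits of rising factorials and tools for series. -/

/-- `(x)_{n+1} / (n^x n!)` tends to `1 / Γ(x)`, including at the poles of `Γ`. -/
theorem tendsto_inv_GammaSeq (x : ℂ) :
    Tendsto (fun n : ℕ => risingFactorial x (n + 1) / ((n : ℂ) ^ x * n.factorial)) atTop
      (𝓝 (Gamma x)⁻¹) := by
  by_cases hx : ∀ i : ℕ, x + i ≠ 0
  · have h := (GammaSeq_tendsto_Gamma x).inv₀ (Gamma_ne_zero_of_add_nat hx)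
    refine h.congr fun n => ?_
    rw [GammaSeq, risingFactorial_eq_prod, inv_div]
  · push Not at hx
    obtain ⟨m, hm⟩ := hx
    obtain rfl : x = -m := eq_neg_of_add_eq_zero_left hm
    rw [Gamma_neg_nat_eq_zero, inv_zero]
    refine tendsto_const_nhds.congr' ?_
    filter_upwards [eventually_ge_atTop m] with n hn
    rw [risingFactorial_neg_nat_eq_zero (by omega)]
    simp

/-- Each rising factorial behaves like `n^x n! / Γ(x)`; equality of the parameter sums makes the
powers of `n` cancel. This evaluates the infinite products produced by iterated contiguous
relations. -/
theorem tendsto_risingFactorial_two_div_two {x₁ x₂ y₁ y₂ : ℂ} (h : x₁ + x₂ = y₁ + y₂)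
    (h₁ : ∀ i : ℕ, y₁ + i ≠ 0) (h₂ : ∀ i : ℕ, y₂ + i ≠ 0) :
    Tendsto (fun n : ℕ => risingFactorial x₁ n * risingFactorial x₂ n /
      (risingFactorial y₁ n * risingFactorial y₂ n)) atTop
      (𝓝 (Gamma y₁ * Gamma y₂ / (Gamma x₁ * Gamma x₂))) := by
  rw [← tendsto_add_atTop_iff_nat 1]
  have hl := ((tendsto_inv_GammaSeq x₁).mul (tendsto_inv_GammaSeq x₂)).div
    ((tendsto_inv_GammaSeq y₁).mul (tendsto_inv_GammaSeq y₂))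
    (mul_ne_zero (inv_ne_zero (Gamma_ne_zero_of_add_nat h₁))
      (inv_ne_zero (Gamma_ne_zero_of_add_nat h₂)))
  have e : (Gamma x₁)⁻¹ * (Gamma x₂)⁻¹ / ((Gamma y₁)⁻¹ * (Gamma y₂)⁻¹) =
      Gamma y₁ * Gamma y₂ / (Gamma x₁ * Gamma x₂) := by
    simp only [div_eq_mul_inv, mul_inv_rev, inv_inv]; ring
  rw [e] at hl
  refine hl.congr' ?_
  filter_upwards [eventually_gt_atTop 0] with n hn
  have hn0 : (n : ℂ) ≠ 0 := by exact_mod_cast hn.ne'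
  have hf : (n.factorial : ℂ) ≠ 0 := by exact_mod_cast n.factorial_ne_zero
  have hy1 := risingFactorial_ne_zero h₁ (n + 1)
  have hy2 := risingFactorial_ne_zero h₂ (n + 1)
  have e2 : (n : ℂ) ^ x₁ * (n : ℂ) ^ x₂ = (n : ℂ) ^ y₁ * (n : ℂ) ^ y₂ := by
    rw [← cpow_add _ _ hn0, ← cpow_add _ _ hn0, h]
  have c1 : (n : ℂ) ^ x₁ ≠ 0 := by simp [hn0]
  have c2 : (n : ℂ) ^ x₂ ≠ 0 := by simp [hn0]
  have c3 : (n : ℂ) ^ y₁ ≠ 0 := by simp [hn0]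
  have c4 : (n : ℂ) ^ y₂ ≠ 0 := by simp [hn0]
  simp only [Pi.div_apply]
  rw [div_mul_div_comm, div_mul_div_comm, div_div_div_eq]
  rw [div_eq_div_iff (by positivity) (by positivity)]
  linear_combination (-(risingFactorial x₁ (n+1) * risingFactorial x₂ (n+1) *
    risingFactorial y₁ (n+1) * risingFactorial y₂ (n+1) * (n.factorial : ℂ) ^ 2)) * e2

theorem tendsto_risingFactorial_div_mul_cpow (x : ℂ) {y : ℂ} (hy : ∀ i : ℕ, y + i ≠ 0) :
    Tendsto (fun n : ℕ => risingFactorial x (n + 1) / risingFactorial y (n + 1) *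
      (n : ℂ) ^ (y - x)) atTop (𝓝 (Gamma y / Gamma x)) := by
  have hl := (tendsto_inv_GammaSeq x).div (tendsto_inv_GammaSeq y)
    (inv_ne_zero (Gamma_ne_zero_of_add_nat hy))
  have e : (Gamma x)⁻¹ / (Gamma y)⁻¹ = Gamma y / Gamma x := by
    simp only [div_eq_mul_inv, inv_inv]; ring
  rw [e] at hl
  refine hl.congr' ?_
  filter_upwards [eventually_gt_atTop 0] with n hn
  have hn0 : (n : ℂ) ≠ 0 := by exact_mod_cast hn.ne'
  have hf : (n.factorial : ℂ) ≠ 0 := by exact_mod_cast n.factorial_ne_zero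
  have hy1 := risingFactorial_ne_zero hy (n + 1)
  have c1 : (n : ℂ) ^ x ≠ 0 := by simp [hn0]
  have c2 : (n : ℂ) ^ y ≠ 0 := by simp [hn0]
  simp only [Pi.div_apply]
  rw [cpow_sub _ _ hn0]
  field_simp

theorem summable_rpow_nat_add_one {p : ℝ} (hp : p < -1) :
    Summable fun k : ℕ => ((k : ℝ) + 1) ^ p := by
  have h := (summable_nat_add_iff 1).2 (Real.summable_nat_rpow.2 hp)
  simpa using h

theorem summable_norm_of_le_rpow {f : ℕ → ℂ} {C p : ℝ} (hp : p < -1)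
    (h : ∀ k, ‖f k‖ ≤ C * ((k : ℝ) + 1) ^ p) : Summable fun k => ‖f k‖ :=
  Summable.of_nonneg_of_le (fun _ => norm_nonneg _) h ((summable_rpow_nat_add_one hp).mul_left C)

theorem tendsto_zero_of_norm_le_rpow {f : ℕ → ℂ} {C p : ℝ} (hp : p < 0)
    (h : ∀ k, ‖f k‖ ≤ C * ((k : ℝ) + 1) ^ p) : Tendsto f atTop (𝓝 0) := by
  refine squeeze_zero_norm h ?_
  rw [← mul_zero C]
  refine Tendsto.const_mul C ?_
  have h1 : Tendsto (fun k : ℕ => (k : ℝ) + 1) atTop atTop :=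
    tendsto_atTop_add_const_right _ _ tendsto_natCast_atTop_atTop
  have h2 := (tendsto_rpow_neg_atTop (neg_pos.2 hp)).comp h1
  rw [neg_neg] at h2
  exact h2

theorem tsum_eq_of_telescoping {f R : ℕ → ℂ} {L : ℂ} (hf : Summable f)
    (h : ∀ k, f k = R (k + 1) - R k) (hR : Tendsto R atTop (𝓝 L)) : ∑' k, f k = L - R 0 := by
  refine tendsto_nhds_unique hf.hasSum.tendsto_sum_nat ?_
  refine (hR.sub_const (R 0)).congr fun n => ?_
  rw [← Finset.sum_range_sub]
  exact Finset.sum_congr rfl fun k _ => (h k).symm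

theorem norm_risingFactorial_le_of_le_re {Y : ℝ} (hY : 0 < Y) {y : ℂ} (hy : Y ≤ y.re) (k : ℕ) :
    ‖risingFactorial Y k‖ ≤ ‖risingFactorial y k‖ := by
  simp only [risingFactorial_eq_prod, norm_prod]
  refine Finset.prod_le_prod (fun _ _ => norm_nonneg _) fun j _ => ?_
  refine le_trans ?_ (re_le_norm _)
  rw [show (Y : ℂ) + j = ((Y + j : ℝ) : ℂ) by push_cast; rfl, norm_real,
    Real.norm_of_nonneg (by positivity)]
  simp [hy]

theorem tendsto_inv_add_nat (c : ℂ) : Tendsto (fun N : ℕ => (c + N)⁻¹) atTop (𝓝 0) := by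
  refine tendsto_inv₀_cobounded.comp ?_
  rw [← tendsto_norm_atTop_iff_cobounded]
  refine tendsto_atTop_mono (f := fun N : ℕ => (N : ℝ) - ‖c‖) (fun N => ?_)
    (tendsto_atTop_add_const_right _ _ tendsto_natCast_atTop_atTop)
  have : ‖(N : ℂ)‖ ≤ ‖c + N‖ + ‖c‖ := by
    calc ‖(N : ℂ)‖ = ‖(c + N) - c‖ := by ring_nf
      _ ≤ _ := norm_sub_le _ _
  rw [norm_natCast] at this
  linarith

theorem tendsto_inv_risingFactorial_add_nat (c : ℂ) (k : ℕ) :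
    Tendsto (fun N : ℕ => (risingFactorial (c + N) (k + 1))⁻¹) atTop (𝓝 0) := by
  induction k with
  | zero => simpa [risingFactorial_succ, risingFactorial_zero] using tendsto_inv_add_nat c
  | succ k ih =>
    have h := ih.mul (tendsto_inv_add_nat (c + (k + 1 : ℕ)))
    rw [mul_zero] at h
    refine h.congr fun N => ?_
    rw [risingFactorial_succ _ (k + 1), mul_inv]
    congr 2
    ring

theorem add_nat_add_nat_ne_zero {y : ℂ} (hy : ∀ i : ℕ, y + i ≠ 0) (N i : ℕ) :
    y + N + i ≠ 0 := by
  have := hy (N + i)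
  push_cast at this
  rwa [add_assoc]

theorem tendsto_risingFactorial_add_nat_div (x : ℂ) {y : ℂ} (hy : ∀ i : ℕ, y + i ≠ 0) (k : ℕ) :
    Tendsto (fun N : ℕ => risingFactorial (x + N) k / risingFactorial (y + N) k) atTop
      (𝓝 1) := by
  induction k with
  | zero => simp [risingFactorial_zero]
  | succ k ih =>
    have h1 : Tendsto (fun N : ℕ => 1 + (x - y) * (y + k + N)⁻¹) atTop (𝓝 1) := by
      simpa using ((tendsto_inv_add_nat (y + k)).const_mul (x - y)).const_add 1
    have h := ih.mul h1
    rw [mul_one] at h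
    refine h.congr fun N => ?_
    have := add_nat_add_nat_ne_zero hy N k
    have h2 : y + k + N ≠ 0 := by rwa [add_right_comm]
    rw [risingFactorial_succ, risingFactorial_succ, mul_div_mul_comm]
    congr 1
    field_simp
    ring

/-- A bound for `(x + N)_k / (y + N)_k` that is uniform in `N`. -/
theorem exists_norm_risingFactorial_add_nat_div_le {x y : ℂ} (hx : ∀ i : ℕ, x + i ≠ 0)
    (hy : ∀ i : ℕ, y + i ≠ 0) :
    ∃ C > 0, ∀ N k : ℕ, ‖risingFactorial (x + N) k / risingFactorial (y + N) k‖ ≤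
      C * ((k : ℝ) + 1) ^ (max 0 (x.re - y.re)) := by
  obtain ⟨C₁, h₁, hb₁⟩ := exists_norm_risingFactorial_div_le x hy
  obtain ⟨C₂, h₂, hb₂⟩ := exists_norm_risingFactorial_div_le y hx
  refine ⟨C₁ * C₂, mul_pos h₁ h₂, fun N k => ?_⟩
  have e : risingFactorial (x + N) k / risingFactorial (y + N) k =
      risingFactorial x (N + k) / risingFactorial y (N + k) *
        (risingFactorial y N / risingFactorial x N) := by
    rw [risingFactorial_add, risingFactorial_add]
    have a1 := risingFactorial_ne_zero hx N
    have a2 := risingFactorial_ne_zero hy N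
    have a3 := risingFactorial_ne_zero (add_nat_add_nat_ne_zero hy N) k
    field_simp
  rw [e, norm_mul]
  refine (mul_le_mul (hb₁ _) (hb₂ _) (norm_nonneg _) (by positivity)).trans ?_
  have hN : (0 : ℝ) < (N : ℝ) + 1 := by positivity
  have hk : (0 : ℝ) ≤ (k : ℝ) := by positivity
  set e := x.re - y.re with he
  have e2 : y.re - x.re = -e := by ring
  have hNk : (0 : ℝ) ≤ (N : ℝ) * k := by positivity
  -- The quotient `(N + k + 1) / (N + 1)` lies between `1` and `k + 1`, so a negative exponent only
  -- helps; hence the `max 0 e`.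
  have key : (((N + k : ℕ) : ℝ) + 1) ^ e * ((N : ℝ) + 1) ^ (-e) ≤ ((k : ℝ) + 1) ^ (max 0 e) := by
    rw [Real.rpow_neg hN.le, ← div_eq_mul_inv, ← Real.div_rpow (by positivity) hN.le]
    have hb1 : 1 ≤ (((N + k : ℕ) : ℝ) + 1) / ((N : ℝ) + 1) := by
      rw [one_le_div hN]; push_cast; linarith
    have hb2 : (((N + k : ℕ) : ℝ) + 1) / ((N : ℝ) + 1) ≤ (k : ℝ) + 1 := by
      rw [div_le_iff₀ hN]; push_cast; nlinarith
    calc _ ≤ ((((N + k : ℕ) : ℝ) + 1) / ((N : ℝ) + 1)) ^ (max 0 e) :=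
          Real.rpow_le_rpow_of_exponent_le hb1 (le_max_right _ _)
      _ ≤ _ := Real.rpow_le_rpow (by positivity) hb2 (le_max_left _ _)
  rw [e2]
  calc _ = C₁ * C₂ * ((((N + k : ℕ) : ℝ) + 1) ^ e * ((N : ℝ) + 1) ^ (-e)) := by ring
    _ ≤ _ := by gcongr

/-! ### Gauss's summation theorem. -/

/-- The `k`-th term of `₂F₁(a, b; c; 1)`. -/
noncomputable def gaussTerm (a b c : ℂ) (k : ℕ) : ℂ :=
  risingFactorial a k * risingFactorial b k / (k.factorial * risingFactorial c k)

theorem exists_norm_gaussTerm_le (a b : ℂ) {c : ℂ} (hc : ∀ i : ℕ, c + i ≠ 0) :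
    ∃ C > 0, ∀ k : ℕ, ‖gaussTerm a b c k‖ ≤ C * ((k : ℝ) + 1) ^ (a.re + b.re - c.re - 1) := by
  obtain ⟨C₁, h₁, hb₁⟩ := exists_norm_risingFactorial_div_factorial_le a
  obtain ⟨C₂, h₂, hb₂⟩ := exists_norm_risingFactorial_div_le b hc
  refine ⟨C₁ * C₂, mul_pos h₁ h₂, fun k => ?_⟩
  rw [gaussTerm, mul_div_mul_comm, norm_mul]
  refine (mul_le_mul (hb₁ _) (hb₂ _) (norm_nonneg _) (by positivity)).trans (le_of_eq ?_)
  rw [show a.re + b.re - c.re - 1 = (a.re - 1) + (b.re - c.re) by ring,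
    Real.rpow_add (by positivity)]
  ring

theorem summable_norm_gaussTerm {a b c : ℂ} (hc : ∀ i : ℕ, c + i ≠ 0)
    (h : 0 < (c - a - b).re) : Summable fun k => ‖gaussTerm a b c k‖ := by
  obtain ⟨C, -, hb⟩ := exists_norm_gaussTerm_le a b hc
  refine summable_norm_of_le_rpow ?_ hb
  simp only [sub_re] at h
  linarith

theorem summable_gaussTerm {a b c : ℂ} (hc : ∀ i : ℕ, c + i ≠ 0)
    (h : 0 < (c - a - b).re) : Summable (gaussTerm a b c) :=
  (summable_norm_gaussTerm hc h).of_norm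

/-- The difference of the two summands telescopes with certificate `R k = -c k t_k`, where `t_k` is
the Gauss term. `R` vanishes at `0` and, because `Re (c - a - b) > 0`, also at infinity. -/
theorem tsum_gaussTerm_contiguous {a b c : ℂ} (hc : ∀ i : ℕ, c + i ≠ 0)
    (h : 0 < (c - a - b).re) :
    c * (c - a - b) * ∑' k, gaussTerm a b c k =
      (c - a) * (c - b) * ∑' k, gaussTerm a b (c + 1) k := by
  have hc1 : ∀ i : ℕ, c + 1 + i ≠ 0 := by simpa using add_nat_add_nat_ne_zero hc 1
  have h1 : 0 < (c + 1 - a - b).re := by simp only [sub_re, add_re, one_re] at h ⊢; linarith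
  have s1 := summable_gaussTerm hc h
  have s2 := summable_gaussTerm hc1 h1
  rw [← tsum_mul_left, ← tsum_mul_left, ← sub_eq_zero,
    ← (s1.mul_left _).tsum_sub (s2.mul_left _)]
  have hR : Tendsto (fun k : ℕ => -c * k * gaussTerm a b c k) atTop (𝓝 0) := by
    obtain ⟨C, hC, hb⟩ := exists_norm_gaussTerm_le a b hc
    refine tendsto_zero_of_norm_le_rpow (C := ‖c‖ * C) (p := a.re + b.re - c.re) ?_ fun k => ?_
    · simp only [sub_re] at h; linarith
    · rw [norm_mul, norm_mul, norm_neg, norm_natCast]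
      have hk : (0 : ℝ) < (k : ℝ) + 1 := by positivity
      calc ‖c‖ * k * ‖gaussTerm a b c k‖
          ≤ ‖c‖ * ((k : ℝ) + 1) * (C * ((k : ℝ) + 1) ^ (a.re + b.re - c.re - 1)) := by
            gcongr
            · linarith
            · exact hb k
        _ = _ := by rw [Real.rpow_sub_one hk.ne']; field_simp
  rw [tsum_eq_of_telescoping ((s1.mul_left _).sub (s2.mul_left _)) (fun k => ?_) hR]
  · simp
  have a1 := risingFactorial_ne_zero hc k
  have a2 := hc k
  have a3 : (k.factorial : ℂ) ≠ 0 := by exact_mod_cast k.factorial_ne_zero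
  have a4 : (k : ℂ) + 1 ≠ 0 := Nat.cast_add_one_ne_zero k
  have c0 : c ≠ 0 := by simpa using hc 0
  have e : risingFactorial (c + 1) k = risingFactorial c k * (c + k) / c := by
    rw [eq_div_iff c0, ← risingFactorial_shift]; ring
  simp only [gaussTerm, e, risingFactorial_succ, Nat.factorial_succ]
  push_cast
  field_simp
  ring

/-- Every term with `k ≥ 1` tends to zero. Once `Re (c + N) ≥ n`, the series with the real lower
parameter `n` dominates. -/
theorem tendsto_tsum_gaussTerm_add_nat (a b c : ℂ) :
    Tendsto (fun N : ℕ => ∑' k, gaussTerm a b (c + N) k) atTop (𝓝 1) := by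
  obtain ⟨n, hn⟩ := exists_nat_gt (|a.re| + |b.re| + 1)
  have hn0 : (0 : ℝ) < n := by have := abs_nonneg a.re; have := abs_nonneg b.re; linarith
  have hY : ∀ i : ℕ, ((n : ℝ) : ℂ) + i ≠ 0 := add_nat_ne_zero_of_re_pos (by simpa using hn0)
  have hs : Summable fun k => ‖gaussTerm a b (n : ℝ) k‖ := by
    refine summable_norm_gaussTerm hY ?_
    simp only [sub_re, ofReal_re]
    have := le_abs_self a.re; have := le_abs_self b.re; linarith
  have h1 : (1 : ℂ) = ∑' k : ℕ, if k = 0 then 1 else 0 := by simp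
  rw [h1]
  refine tendsto_tsum_of_dominated_convergence hs (fun k => ?_) ?_
  · rcases k with _ | k
    · simp [gaussTerm, risingFactorial_zero]
    · have := (tendsto_inv_risingFactorial_add_nat c k).const_mul
        (risingFactorial a (k + 1) * risingFactorial b (k + 1) / (k + 1).factorial)
      rw [mul_zero] at this
      simp only [Nat.add_eq_zero_iff, one_ne_zero, and_false, if_false]
      refine this.congr fun N => ?_
      rw [gaussTerm, ← div_eq_mul_inv, div_div]
  · obtain ⟨N₀, hN₀⟩ := exists_nat_ge (n - c.re)
    filter_upwards [eventually_ge_atTop N₀] with N hN k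
    have hle : (n : ℝ) ≤ (c + N).re := by
      have : (N₀ : ℝ) ≤ N := by exact_mod_cast hN
      simp; linarith
    rw [gaussTerm, gaussTerm, norm_div, norm_div, norm_mul (k.factorial : ℂ),
      norm_mul (k.factorial : ℂ)]
    have h3 : 0 < ‖risingFactorial ((n : ℝ) : ℂ) k‖ :=
      norm_pos_iff.2 (risingFactorial_ne_zero hY k)
    have : (0 : ℝ) < ‖(k.factorial : ℂ)‖ := by
      rw [norm_natCast]; exact_mod_cast k.factorial_pos
    gcongr
    exact norm_risingFactorial_le_of_le_re hn0 hle k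

/-- **Gauss's summation theorem**; at the poles of the denominator both sides vanish. -/
theorem tsum_gaussTerm {a b c : ℂ} (hc : ∀ i : ℕ, c + i ≠ 0) (h : 0 < (c - a - b).re) :
    ∑' k, gaussTerm a b c k = Gamma c * Gamma (c - a - b) / (Gamma (c - a) * Gamma (c - b)) := by
  have hd : ∀ i : ℕ, c - a - b + i ≠ 0 := add_nat_ne_zero_of_re_pos h
  have iter : ∀ N : ℕ, ∑' k, gaussTerm a b c k =
      risingFactorial (c - a) N * risingFactorial (c - b) N /
        (risingFactorial c N * risingFactorial (c - a - b) N) *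
          ∑' k, gaussTerm a b (c + N) k := by
    intro N
    induction N with
    | zero => simp [risingFactorial_zero]
    | succ N ih =>
      have h' : 0 < (c + N - a - b).re := by
        simp only [sub_re, add_re, natCast_re] at h ⊢
        have : (0 : ℝ) ≤ N := N.cast_nonneg
        linarith
      have hst := tsum_gaussTerm_contiguous (add_nat_add_nat_ne_zero hc N) h'
      have a1 := risingFactorial_ne_zero hc N
      have a2 := risingFactorial_ne_zero hd N
      have a3 := hc N
      have a4 := hd N
      have a5 : c + N - a - b ≠ 0 := by convert a4 using 1; ring
      rw [ih]
      have e : ∑' k, gaussTerm a b (c + N) k = (c + N - a) * (c + N - b) /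
          ((c + N) * (c + N - a - b)) * ∑' k, gaussTerm a b (c + N + 1) k := by
        rw [div_mul_eq_mul_div, eq_div_iff (mul_ne_zero a3 a5), ← hst]; ring
      rw [e]
      simp only [risingFactorial_succ]
      push_cast
      rw [show c + (N : ℂ) + 1 = c + (N + 1) by ring,
        show c + N - a - b = c - a - b + N by ring] at *
      field_simp
      ring
  have hconst : Tendsto (fun _ : ℕ => ∑' k, gaussTerm a b c k) atTop (𝓝 _) := tendsto_const_nhds
  refine tendsto_nhds_unique hconst ?_
  have hl := (tendsto_risingFactorial_two_div_two (x₁ := c - a) (x₂ := c - b) (by ring) hc hd).mul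
    (tendsto_tsum_gaussTerm_add_nat a b c)
  rw [mul_one] at hl
  exact hl.congr fun N => (iter N).symm

/-! ### Saalschütz's theorem, terminating and non-terminating. -/

/-- The `k`-th term of the Saalschützian series `₃F₂(α, β, γ; 1 - d, α + β + γ + d; 1)`. -/
noncomputable def saalTerm (α β γ d : ℂ) (k : ℕ) : ℂ :=
  gaussTerm β γ (1 - d) k * (risingFactorial α k / risingFactorial (α + β + γ + d) k)

theorem exists_norm_saalTerm_le {α β γ d : ℂ} (hd : ∀ i : ℕ, 1 - d + i ≠ 0)
    (hf : ∀ i : ℕ, α + β + γ + d + i ≠ 0) :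
    ∃ C > 0, ∀ k : ℕ, ‖saalTerm α β γ d k‖ ≤ C * ((k : ℝ) + 1) ^ (-2 : ℝ) := by
  obtain ⟨C₁, h₁, hb₁⟩ := exists_norm_gaussTerm_le β γ hd
  obtain ⟨C₂, h₂, hb₂⟩ := exists_norm_risingFactorial_div_le α hf
  refine ⟨C₁ * C₂, mul_pos h₁ h₂, fun k => ?_⟩
  rw [saalTerm, norm_mul]
  refine (mul_le_mul (hb₁ _) (hb₂ _) (norm_nonneg _) (by positivity)).trans (le_of_eq ?_)
  rw [show (-2 : ℝ) = (β.re + γ.re - (1 - d).re - 1) + (α.re - (α + β + γ + d).re) by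
    simp; ring, Real.rpow_add (by positivity)]
  ring

theorem summable_saalTerm {α β γ d : ℂ} (hd : ∀ i : ℕ, 1 - d + i ≠ 0)
    (hf : ∀ i : ℕ, α + β + γ + d + i ≠ 0) : Summable (saalTerm α β γ d) := by
  obtain ⟨C, -, hb⟩ := exists_norm_saalTerm_le hd hf
  exact (summable_norm_of_le_rpow (by norm_num) hb).of_norm

/-- The lower parameters exceed the upper ones by exactly one, so the terms decay like `k⁻²` and a
quadratic multiple has a finite limit. The multiplier `k (k - d)` is that of the telescoping
certificate below, and the limit is its boundary value at infinity. -/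
theorem tendsto_sq_mul_saalTerm {α β γ d : ℂ} (hd : ∀ i : ℕ, 1 - d + i ≠ 0)
    (hf : ∀ i : ℕ, α + β + γ + d + i ≠ 0) :
    Tendsto (fun k : ℕ => (k : ℂ) * (k - d) * saalTerm α β γ d k) atTop
      (𝓝 (Gamma (1 - d) * Gamma (α + β + γ + d) / (Gamma α * Gamma β * Gamma γ))) := by
  rw [← tendsto_add_atTop_iff_nat 1]
  have h1 := tendsto_risingFactorial_div_mul_cpow β one_add_nat_ne_zero
  have h2 := tendsto_risingFactorial_div_mul_cpow γ hd
  have h3 := tendsto_risingFactorial_div_mul_cpow α hf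
  have h4 : Tendsto (fun n : ℕ => ((1 : ℂ) + (0 + n : ℂ)⁻¹) * (1 + (1 - d) * (0 + n : ℂ)⁻¹)) atTop
      (𝓝 1) := by
    have e := tendsto_inv_add_nat 0
    simpa using (e.const_add 1).mul ((e.const_mul (1 - d)).const_add 1)
  have hl := ((h1.mul h2).mul h3).mul h4
  have e : Gamma 1 / Gamma β * (Gamma (1 - d) / Gamma γ) *
      (Gamma (α + β + γ + d) / Gamma α) * 1 =
      Gamma (1 - d) * Gamma (α + β + γ + d) / (Gamma α * Gamma β * Gamma γ) := by
    rw [Gamma_one]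
    simp only [div_eq_mul_inv, mul_inv_rev]
    ring
  rw [e] at hl
  refine hl.congr' ?_
  filter_upwards [eventually_gt_atTop 0] with n hn
  have hn0 : (n : ℂ) ≠ 0 := by exact_mod_cast hn.ne'
  have e2 : (n : ℂ) ^ (1 - β) * (n : ℂ) ^ (1 - d - γ) * (n : ℂ) ^ (α + β + γ + d - α) =
      (n : ℂ) ^ 2 := by
    rw [← cpow_add _ _ hn0, ← cpow_add _ _ hn0, ← cpow_two]
    congr 1
    ring
  have a1 := risingFactorial_ne_zero one_add_nat_ne_zero (n + 1)
  have a2 := risingFactorial_ne_zero hd (n + 1)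
  have a3 := risingFactorial_ne_zero hf (n + 1)
  rw [saalTerm, gaussTerm, ← risingFactorial_one]
  calc _ = risingFactorial β (n + 1) / risingFactorial 1 (n + 1) *
        (risingFactorial γ (n + 1) / risingFactorial (1 - d) (n + 1)) *
        (risingFactorial α (n + 1) / risingFactorial (α + β + γ + d) (n + 1)) *
        ((n : ℂ) ^ (1 - β) * (n : ℂ) ^ (1 - d - γ) * (n : ℂ) ^ (α + β + γ + d - α)) *
        ((1 + (0 + n : ℂ)⁻¹) * (1 + (1 - d) * (0 + n : ℂ)⁻¹)) := by ring
    _ = _ := by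
      rw [e2, zero_add]
      push_cast
      field_simp
      ring

/-- The certificate is `-(F / α) k (k - d)` times the term, with `F = α + β + γ + d`. Unlike in
Gauss's case it does not vanish at infinity, which produces the inhomogeneous right-hand side. -/
theorem tsum_saalTerm_contiguous {α β γ d : ℂ} (hα : α ≠ 0) (hd : ∀ i : ℕ, 1 - d + i ≠ 0)
    (hf : ∀ i : ℕ, α + β + γ + d + i ≠ 0) :
    (α + β + γ + d) * (α + d) * ∑' k, saalTerm α β γ d k -
      (α + β + d) * (α + γ + d) * ∑' k, saalTerm (α + 1) β γ d k =
    -((α + β + γ + d) / α) *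
      (Gamma (1 - d) * Gamma (α + β + γ + d) / (Gamma α * Gamma β * Gamma γ)) := by
  have hf1 : ∀ i : ℕ, α + 1 + β + γ + d + i ≠ 0 := fun i => by
    have := hf (i + 1)
    push_cast at this
    convert this using 1
    ring
  have s1 := summable_saalTerm hd hf
  have s2 := summable_saalTerm hd hf1
  rw [← tsum_mul_left, ← tsum_mul_left, ← (s1.mul_left _).tsum_sub (s2.mul_left _)]
  have hR := (tendsto_sq_mul_saalTerm hd hf).const_mul (-((α + β + γ + d) / α))
  rw [tsum_eq_of_telescoping ((s1.mul_left _).sub (s2.mul_left _)) (fun k => ?_) hR]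
  · simp
  have a1 := risingFactorial_ne_zero hf k
  have a2 := hf k
  have a5 := hd k
  have a6 := risingFactorial_ne_zero hd k
  have a3 : (k.factorial : ℂ) ≠ 0 := by exact_mod_cast k.factorial_ne_zero
  have a4 : (k : ℂ) + 1 ≠ 0 := Nat.cast_add_one_ne_zero k
  have f0 : α + β + γ + d ≠ 0 := by simpa using hf 0
  have e : risingFactorial (α + 1 + β + γ + d) k =
      risingFactorial (α + β + γ + d) k * (α + β + γ + d + k) / (α + β + γ + d) := by
    rw [eq_div_iff f0, ← risingFactorial_shift, mul_comm]
    congr 2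
    ring
  have e' : risingFactorial (α + 1) k = risingFactorial α k * (α + k) / α := by
    rw [eq_div_iff hα, ← risingFactorial_shift, mul_comm]
  simp only [saalTerm, gaussTerm, e, e', risingFactorial_succ, Nat.factorial_succ]
  generalize hF : α + β + γ + d = F at *
  obtain rfl : γ = F - α - β - d := by rw [← hF]; ring
  generalize risingFactorial F k = X1 at *
  generalize risingFactorial (1 - d) k = X2 at *
  push_cast
  field_simp
  ring

/-- As `α` goes to infinity the factors with `α + N` and `α + β + γ + d + N` cancel in the limit,
and the `₃F₂` degenerates to a Gauss series. The hypothesis on `β + γ + d` makes that series, and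
the common majorant, converge. -/
theorem tendsto_tsum_saalTerm_add_nat {α β γ d : ℂ} (hα : ∀ i : ℕ, α + i ≠ 0)
    (hd : ∀ i : ℕ, 1 - d + i ≠ 0) (hf : ∀ i : ℕ, α + β + γ + d + i ≠ 0)
    (h : (β + γ + d).re < 1) :
    Tendsto (fun N : ℕ => ∑' k, saalTerm (α + N) β γ d k) atTop
      (𝓝 (∑' k, gaussTerm β γ (1 - d) k)) := by
  obtain ⟨C₁, h₁, hb₁⟩ := exists_norm_gaussTerm_le β γ hd
  obtain ⟨C₂, h₂, hb₂⟩ := exists_norm_risingFactorial_add_nat_div_le hα hf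
  have hs : Summable fun k : ℕ => C₁ * C₂ * (((k : ℝ) + 1) ^
      ((β.re + γ.re - (1 - d).re - 1) + max 0 (α.re - (α + β + γ + d).re))) := by
    refine (summable_rpow_nat_add_one ?_).mul_left _
    simp only [add_re, sub_re, one_re] at h ⊢
    rcases max_cases 0 (α.re - (α.re + β.re + γ.re + d.re)) with ⟨h', _⟩ | ⟨h', _⟩ <;>
      rw [h'] <;> linarith
  have e : ∀ (N k : ℕ), saalTerm (α + N) β γ d k = gaussTerm β γ (1 - d) k *
      (risingFactorial (α + N) k / risingFactorial (α + β + γ + d + N) k) := fun N k => by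
    rw [saalTerm]; congr 3; ring
  simp only [e]
  refine tendsto_tsum_of_dominated_convergence hs (fun k => ?_) (Eventually.of_forall ?_)
  · simpa using (tendsto_risingFactorial_add_nat_div α hf k).const_mul (gaussTerm β γ (1 - d) k)
  · intro N k
    rw [norm_mul]
    refine (mul_le_mul (hb₁ _) (hb₂ _ _) (norm_nonneg _) (by positivity)).trans (le_of_eq ?_)
    rw [Real.rpow_add (by positivity)]
    ring

/-- **Pfaff–Saalschütz** for a terminating series with a lower parameter equal to one. -/
theorem tsum_saalTerm_neg_nat {α β : ℂ} (n : ℕ) (hα : ∀ i : ℕ, α + i ≠ 0)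
    (hf : ∀ i : ℕ, α + β - n + i ≠ 0) (h : (β - n).re < 1) :
    ∑' k, saalTerm α β (-n) 0 k =
      Gamma (α + β - n) * Gamma α / (Gamma (α + β) * Gamma (α - n)) *
        (Gamma (1 - β + n) / (Gamma (1 - β) * n.factorial)) := by
  have hd : ∀ i : ℕ, (1 : ℂ) - 0 + i ≠ 0 := by simpa using one_add_nat_ne_zero
  have hf' : ∀ i : ℕ, α + β + -n + 0 + i ≠ 0 := by simpa [← sub_eq_add_neg] using hf
  have iter : ∀ N : ℕ, ∑' k, saalTerm α β (-n) 0 k =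
      risingFactorial (α + β) N * risingFactorial (α - n) N /
        (risingFactorial (α + β - n) N * risingFactorial α N) *
          ∑' k, saalTerm (α + N) β (-n) 0 k := by
    intro N
    induction N with
    | zero => simp [risingFactorial_zero]
    | succ N ih =>
      have hst := tsum_saalTerm_contiguous (γ := -n) (hα N) hd (fun i => by
        have := add_nat_add_nat_ne_zero hf N i
        convert this using 1
        ring : ∀ i : ℕ, α + N + β + -n + 0 + i ≠ 0)
      -- The boundary term carries `1 / Γ(-n)`, which is zero. Here this comes out of the
      -- conventions `Γ(-n) = 0` and division by zero, so the relation becomes homogeneous.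
      rw [Gamma_neg_nat_eq_zero] at hst
      simp only [mul_zero, div_zero, add_zero] at hst
      have a1 := risingFactorial_ne_zero hf N
      have a2 := risingFactorial_ne_zero hα N
      have a3 := hf N
      have a4 := hα N
      rw [show α + N + β + -(n : ℂ) = α + β - n + N by ring] at hst
      rw [ih, eq_comm]
      simp only [risingFactorial_succ]
      push_cast
      rw [← add_assoc α]
      rw [sub_eq_zero] at hst
      rw [div_mul_eq_mul_div, div_mul_eq_mul_div, div_eq_div_iff (by positivity) (by positivity)]
      linear_combination -(risingFactorial (α + β) N * risingFactorial (α - n) N *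
        risingFactorial (α + β - n) N * risingFactorial α N) * hst
  have hconst : Tendsto (fun _ : ℕ => ∑' k, saalTerm α β (-n) 0 k) atTop (𝓝 _) :=
    tendsto_const_nhds
  refine tendsto_nhds_unique hconst ?_
  have hl := (tendsto_risingFactorial_two_div_two (x₁ := α + β) (x₂ := α - n) (by ring) hf hα).mul
    (tendsto_tsum_saalTerm_add_nat hα hd hf' (by simpa [← sub_eq_add_neg] using h))
  rw [tsum_gaussTerm hd (by simp at h ⊢; linarith)] at hl
  have e : Gamma (1 - 0) * Gamma (1 - 0 - β - -n) / (Gamma (1 - 0 - β) * Gamma (1 - 0 - -n)) =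
      Gamma (1 - β + n) / (Gamma (1 - β) * n.factorial) := by
    simp [Gamma_one, add_comm (1 : ℂ) n, Gamma_nat_eq_factorial]
  rw [e] at hl
  exact hl.congr fun N => (iter N).symm

/-- The Saalschützian series with its natural Gamma factor. -/
noncomputable def saalSum (α β γ d : ℂ) : ℂ :=
  Gamma α * Gamma β * Gamma γ / (Gamma (1 - d) * Gamma (α + β + γ + d)) *
    ∑' k, saalTerm α β γ d k

/-- The Gamma factor is chosen to normalize the inhomogeneity to `-1`. The coefficients are also
unchanged under `(α, β, γ, d) ↦ (α + d, β + d, γ + d, -d)`, so the difference of the two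
corresponding sums satisfies a homogeneous relation. -/
theorem saalSum_contiguous {α β γ d : ℂ} (hα : ∀ i : ℕ, α + i ≠ 0) (hβ : ∀ i : ℕ, β + i ≠ 0)
    (hγ : ∀ i : ℕ, γ + i ≠ 0) (hd : ∀ i : ℕ, 1 - d + i ≠ 0)
    (hf : ∀ i : ℕ, α + β + γ + d + i ≠ 0) :
    α * (α + d) * saalSum α β γ d - (α + β + d) * (α + γ + d) * saalSum (α + 1) β γ d = -1 := by
  have hα0 : α ≠ 0 := by simpa using hα 0
  have f0 : α + β + γ + d ≠ 0 := by simpa using hf 0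
  have h := tsum_saalTerm_contiguous hα0 hd hf
  have g1 := Gamma_ne_zero_of_add_nat hα
  have g2 := Gamma_ne_zero_of_add_nat hβ
  have g3 := Gamma_ne_zero_of_add_nat hγ
  have g4 := Gamma_ne_zero_of_add_nat hd
  have g5 := Gamma_ne_zero_of_add_nat hf
  have e : Gamma (α + 1 + β + γ + d) = (α + β + γ + d) * Gamma (α + β + γ + d) := by
    rw [← Gamma_add_one _ f0]; congr 1; ring
  rw [saalSum, saalSum, e, Gamma_add_one _ hα0]
  generalize α + β + γ + d = F at *
  generalize ∑' k, saalTerm α β γ d k = S at *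
  generalize ∑' k, saalTerm (α + 1) β γ d k = S' at *
  field_simp at h ⊢
  linear_combination h

theorem inv_Gamma_one_sub {z : ℂ} (hz : ∀ i : ℕ, z + i ≠ 0) :
    (Gamma (1 - z))⁻¹ = Gamma z * sin (Real.pi * z) / Real.pi := by
  have h := Gamma_mul_Gamma_one_sub z
  have g := Gamma_ne_zero_of_add_nat hz
  have hp : (Real.pi : ℂ) ≠ 0 := ofReal_ne_zero.2 Real.pi_ne_zero
  have e : Gamma (1 - z) = Real.pi / sin (Real.pi * z) / Gamma z := by
    rw [← h]; field_simp
  rw [e, inv_div, div_div_eq_mul_div]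

/-- Merges the two Gauss values in the non-terminating theorem into a single product, after
reflection has turned their Gamma factors into sines. -/
theorem sin_mul_sin_sub_sin_mul_sin (x y t : ℂ) :
    sin (x + t) * sin (y + t) - sin x * sin y = sin t * sin (x + y + t) := by
  simp only [sin_add, cos_add]
  linear_combination (sin x * sin y) * sin_sq_add_cos_sq t

/-- **Non-terminating Saalschütz theorem** (equivalent to Barnes's second lemma). -/
theorem saalSum_sub_saalSum {α β γ d : ℂ} (hα : ∀ i : ℕ, α + i ≠ 0) (hβ : ∀ i : ℕ, β + i ≠ 0)
    (hγ : ∀ i : ℕ, γ + i ≠ 0) (hα' : ∀ i : ℕ, α + d + i ≠ 0) (hβ' : ∀ i : ℕ, β + d + i ≠ 0)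
    (hγ' : ∀ i : ℕ, γ + d + i ≠ 0) (hd : ∀ i : ℕ, 1 - d + i ≠ 0) (hd' : ∀ i : ℕ, 1 + d + i ≠ 0)
    (hf : ∀ i : ℕ, α + β + γ + d + i ≠ 0) (hf' : ∀ i : ℕ, α + β + γ + d + d + i ≠ 0)
    (h : (β + γ + d).re < 1) :
    saalSum α β γ d - saalSum (α + d) (β + d) (γ + d) (-d) =
      sin (Real.pi * d) / Real.pi *
        (Gamma α * Gamma (α + d) * Gamma β * Gamma (β + d) * Gamma γ * Gamma (γ + d) /
          (Gamma (α + β + d) * Gamma (α + γ + d) * Gamma (β + γ + d))) := by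
  have hd'' : ∀ i : ℕ, 1 - -d + i ≠ 0 := by simpa using hd'
  have hf'' : ∀ i : ℕ, (α + d) + (β + d) + (γ + d) + -d + i ≠ 0 := fun i => by
    convert hf' i using 1; ring
  have ga := Gamma_ne_zero_of_add_nat hα
  have ga' := Gamma_ne_zero_of_add_nat hα'
  have gf := Gamma_ne_zero_of_add_nat hf
  have gf' := Gamma_ne_zero_of_add_nat hf'
  -- The inhomogeneous terms `-1` cancel in this difference, so `D` can be iterated in `α` by a pure
  -- product.
  set D : ℂ → ℂ := fun α => saalSum α β γ d - saalSum (α + d) (β + d) (γ + d) (-d) with hD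
  have iter : ∀ N : ℕ, D α = risingFactorial (α + β + d) N * risingFactorial (α + γ + d) N /
      (risingFactorial α N * risingFactorial (α + d) N) * D (α + N) := by
    intro N
    induction N with
    | zero => simp [risingFactorial_zero]
    | succ N ih =>
      have h1 := saalSum_contiguous (add_nat_add_nat_ne_zero hα N) hβ hγ hd (fun i => by
        convert add_nat_add_nat_ne_zero hf N i using 1; ring)
      have h2 := saalSum_contiguous (α := α + N + d) (d := -d) (fun i => by
        convert add_nat_add_nat_ne_zero hα' N i using 1; ring) hβ' hγ' hd'' (fun i => by
        convert add_nat_add_nat_ne_zero hf' N i using 1; ring)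
      have a1 := risingFactorial_ne_zero hα N
      have a2 := risingFactorial_ne_zero hα' N
      have a3 := hα N
      have a4 := hα' N
      rw [ih]
      simp only [hD, risingFactorial_succ]
      push_cast
      rw [← add_assoc α, div_mul_eq_mul_div, div_mul_eq_mul_div,
        div_eq_div_iff (by positivity) (by positivity)]
      rw [show α + N + d + 1 = α + N + 1 + d by ring] at h2
      linear_combination (risingFactorial (α + β + d) N * risingFactorial (α + γ + d) N *
        risingFactorial α N * risingFactorial (α + d) N) * (h1 - h2)
  -- The Gamma quotient strips off the part of the normalizing factor that depends on `N`; both sums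
  -- then tend to multiples of Gauss series, and the product from `iter` absorbs the quotient.
  have lim1 : Tendsto (fun N : ℕ => saalSum (α + N) β γ d *
      (Gamma (α + β + γ + d + N) / Gamma (α + N))) atTop
      (𝓝 (Gamma β * Gamma γ / Gamma (1 - d) * ∑' k, gaussTerm β γ (1 - d) k)) := by
    refine ((tendsto_tsum_saalTerm_add_nat hα hd hf h).const_mul _).congr fun N => ?_
    have g1 := Gamma_ne_zero_of_add_nat (add_nat_add_nat_ne_zero hα N)
    have g2 := Gamma_ne_zero_of_add_nat (add_nat_add_nat_ne_zero hf N)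
    rw [saalSum, show α + N + β + γ + d = α + β + γ + d + N by ring]
    field_simp
  have lim2 : Tendsto (fun N : ℕ => saalSum (α + N + d) (β + d) (γ + d) (-d) *
      (Gamma (α + β + γ + d + N) / Gamma (α + N))) atTop
      (𝓝 (Gamma (β + d) * Gamma (γ + d) / Gamma (1 + d) *
        ∑' k, gaussTerm (β + d) (γ + d) (1 + d) k)) := by
    have hr := (tendsto_risingFactorial_two_div_two (x₁ := α + d) (x₂ := α + β + γ + d)
      (by ring) hf' hα).mul_const (Gamma (α + d) * Gamma (α + β + γ + d) /
        (Gamma (α + β + γ + d + d) * Gamma α))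
    rw [show Gamma (α + β + γ + d + d) * Gamma α / (Gamma (α + d) * Gamma (α + β + γ + d)) *
      (Gamma (α + d) * Gamma (α + β + γ + d) / (Gamma (α + β + γ + d + d) * Gamma α)) = 1 by
      field_simp] at hr
    have hs := tendsto_tsum_saalTerm_add_nat hα' hd'' hf'' (by simp at h ⊢; linarith)
    have hl := (hr.mul hs).const_mul (Gamma (β + d) * Gamma (γ + d) / Gamma (1 + d))
    rw [one_mul, sub_neg_eq_add] at hl
    refine hl.congr fun N => ?_
    have g1 := Gamma_ne_zero_of_add_nat (add_nat_add_nat_ne_zero hα N)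
    have g2 := Gamma_ne_zero_of_add_nat (add_nat_add_nat_ne_zero hf' N)
    have r1 := risingFactorial_ne_zero hα N
    have r2 := risingFactorial_ne_zero hf' N
    rw [saalSum, show α + N + d + (β + d) + (γ + d) + -d = α + β + γ + d + d + N by ring,
      show α + (N : ℂ) + d = α + d + N by ring, Gamma_add_nat hα, Gamma_add_nat hα',
      Gamma_add_nat hf, Gamma_add_nat hf', sub_neg_eq_add]
    field_simp
  have hp := (tendsto_risingFactorial_two_div_two (x₁ := α + β + d) (x₂ := α + γ + d)
      (y₁ := α + β + γ + d) (y₂ := α + d) (by ring) hf hα').const_mul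
        (Gamma α / Gamma (α + β + γ + d))
  have hconst : Tendsto (fun _ : ℕ => D α) atTop (𝓝 _) := tendsto_const_nhds
  have hl := hp.mul (lim1.sub lim2)
  have hval := tendsto_nhds_unique hconst (hl.congr fun N => ?_)
  · rw [tsum_gaussTerm hd (by simp at h ⊢; linarith), tsum_gaussTerm hd' (by
      simp at h ⊢; linarith)] at hval
    change D α = _
    rw [hval]
    have g1 := Gamma_ne_zero_of_add_nat hd
    have g2 := Gamma_ne_zero_of_add_nat hd'
    have w : ∀ i : ℕ, 1 - d - β - γ + i ≠ 0 := add_nat_ne_zero_of_re_pos (by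
      simp at h ⊢; linarith)
    have i1 := inv_Gamma_one_sub hβ
    have i2 := inv_Gamma_one_sub hγ
    have i3 := inv_Gamma_one_sub hβ'
    have i4 := inv_Gamma_one_sub hγ'
    have i5 := inv_Gamma_one_sub w
    rw [show 1 - (β + d) = 1 - d - β by ring] at i3
    rw [show 1 - (γ + d) = 1 - d - γ by ring] at i4
    rw [show 1 - (1 - d - β - γ) = β + γ + d by ring,
      show (Real.pi : ℂ) * (1 - d - β - γ) = Real.pi - (Real.pi * β + Real.pi * γ + Real.pi * d) by
        ring, sin_pi_sub] at i5
    have key := sin_mul_sin_sub_sin_mul_sin (Real.pi * β) (Real.pi * γ) (Real.pi * d)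
    have e1 : 1 + d - (β + d) - (γ + d) = 1 - d - β - γ := by ring
    have e2 : 1 + d - (β + d) = 1 - β := by ring
    have e3 : 1 + d - (γ + d) = 1 - γ := by ring
    rw [e1, e2, e3]
    have hpi : (Real.pi : ℂ) ≠ 0 := ofReal_ne_zero.2 Real.pi_ne_zero
    rw [mul_add] at i3 i4
    simp only [div_eq_mul_inv, mul_inv] at i1 i2 i3 i4 i5 ⊢
    rw [i1, i2, i3, i4, i5]
    have e4 : ∀ {y : ℂ}, y ≠ 0 → ∀ x z u : ℂ, x * y⁻¹ * (y * z * u) = x * z * u :=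
      fun hy x z u => by field_simp
    rw [e4 gf, e4 g1, e4 g2]
    linear_combination (Gamma α * Gamma (α + d) * (Gamma (α + β + d))⁻¹ * (Gamma (α + γ + d))⁻¹ *
      Gamma β * Gamma γ * Gamma (β + d) * Gamma (γ + d) * Gamma (1 - d - β - γ) *
      (Real.pi : ℂ)⁻¹ ^ 2) * key
  · rw [iter N]
    have g1 := Gamma_ne_zero_of_add_nat (add_nat_add_nat_ne_zero hα N)
    have g2 := Gamma_ne_zero_of_add_nat (add_nat_add_nat_ne_zero hf N)
    have r1 := risingFactorial_ne_zero hα N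
    have r2 := risingFactorial_ne_zero hf N
    have r3 := risingFactorial_ne_zero hα' N
    simp only [hD, Gamma_add_nat hα, Gamma_add_nat hf]
    field_simp

/-! ### The confluent case: a digamma series. -/

theorem hasDerivAt_Gamma_digamma {z : ℂ} (hz : ∀ i : ℕ, z + i ≠ 0) :
    HasDerivAt Gamma (Gamma z * digamma z) z := by
  have h := (differentiableAt_Gamma z fun m e => hz m (by rw [e]; ring)).hasDerivAt
  rwa [digamma_def, logDeriv_apply, mul_div_cancel₀ _ (Gamma_ne_zero_of_add_nat hz)]

theorem half_le_norm_add_add_nat {x w : ℂ} {δ : ℝ} (hx : ∀ i : ℕ, δ ≤ ‖x + i‖)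
    (hw : ‖w‖ ≤ δ / 2) (i : ℕ) : δ / 2 ≤ ‖x + w + i‖ := by
  have h : ‖x + i‖ ≤ ‖x + w + i‖ + ‖w‖ := by
    calc ‖x + i‖ = ‖(x + w + i) - w‖ := by ring_nf
      _ ≤ _ := norm_sub_le _ _
  linarith [hx i]

theorem add_add_nat_ne_zero {x w : ℂ} {δ : ℝ} (hδ : 0 < δ) (hx : ∀ i : ℕ, δ ≤ ‖x + i‖)
    (hw : ‖w‖ ≤ δ / 2) (i : ℕ) : x + w + i ≠ 0 :=
  norm_pos_iff.1 ((half_pos hδ).trans_le (half_le_norm_add_add_nat hx hw i))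

/-- Summand of the Saalschützian series with its Gamma factors. -/
noncomputable def saalGamma (α β γ d : ℂ) (k : ℕ) : ℂ :=
  Gamma α * Gamma β * Gamma γ / (Gamma (1 - d) * Gamma (α + β + γ + d)) * saalTerm α β γ d k

theorem saalGamma_eq {α β γ d : ℂ} (hα : ∀ i : ℕ, α + i ≠ 0) (hβ : ∀ i : ℕ, β + i ≠ 0)
    (hγ : ∀ i : ℕ, γ + i ≠ 0) (hd : ∀ i : ℕ, 1 - d + i ≠ 0)
    (hf : ∀ i : ℕ, α + β + γ + d + i ≠ 0) (k : ℕ) :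
    saalGamma α β γ d k = Gamma (α + k) * Gamma (β + k) * Gamma (γ + k) *
      (k.factorial * (Gamma (1 - d + k) * Gamma (α + β + γ + d + k)))⁻¹ := by
  rw [saalGamma, saalTerm, gaussTerm, Gamma_add_nat hα, Gamma_add_nat hβ, Gamma_add_nat hγ,
    Gamma_add_nat hd, Gamma_add_nat hf]
  simp only [div_eq_mul_inv, mul_inv]
  ring

theorem hasSum_saalGamma {α β γ d : ℂ} (hd : ∀ i : ℕ, 1 - d + i ≠ 0)
    (hf : ∀ i : ℕ, α + β + γ + d + i ≠ 0) :
    HasSum (saalGamma α β γ d) (saalSum α β γ d) :=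
  (summable_saalTerm hd hf).hasSum.mul_left _

/-- The constant `C` depends only on `R` and `δ`, which gives a summable majorant uniform for `d`
near `0` and so allows termwise differentiation there. -/
theorem exists_norm_saalGamma_le {R δ : ℝ} (hδ : 0 < δ) : ∃ C > 0, ∀ α β γ d : ℂ,
    ‖α‖ ≤ R → ‖β‖ ≤ R → ‖γ‖ ≤ R → ‖1 - d‖ ≤ R → ‖α + β + γ + d‖ ≤ R → 1 ≤ R →
    (∀ i : ℕ, δ ≤ ‖1 + (i : ℂ)‖) → (∀ i : ℕ, δ ≤ ‖1 - d + i‖) →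
    (∀ i : ℕ, δ ≤ ‖α + β + γ + d + i‖) → ∀ k : ℕ,
    ‖saalGamma α β γ d k‖ ≤
      ‖Gamma α * Gamma β * Gamma γ / (Gamma (1 - d) * Gamma (α + β + γ + d))‖ *
        (C * ((k : ℝ) + 1) ^ (-2 : ℝ)) := by
  obtain ⟨C, hC, hb⟩ := exists_norm_risingFactorial_div_le_of_norm_le R δ hδ
  refine ⟨C * C * C, by positivity, fun α β γ d hα hβ hγ hd hf hR h1 hd' hf' k => ?_⟩
  rw [saalGamma, norm_mul]
  gcongr
  rw [saalTerm, gaussTerm, norm_mul, mul_div_mul_comm, norm_mul, ← risingFactorial_one]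
  have b1 := hb β 1 hβ (by simpa using hR) (by exact_mod_cast h1) k
  have b2 := hb γ (1 - d) hγ hd hd' k
  have b3 := hb α (α + β + γ + d) hα hf hf' k
  calc _ ≤ (C * ((k : ℝ) + 1) ^ (β.re - (1 : ℂ).re)) * (C * ((k : ℝ) + 1) ^ (γ.re - (1 - d).re)) *
        (C * ((k : ℝ) + 1) ^ (α.re - (α + β + γ + d).re)) := by gcongr
    _ = _ := by
      rw [show (-2 : ℝ) = (β.re - (1 : ℂ).re) + (γ.re - (1 - d).re) +
        (α.re - (α + β + γ + d).re) by simp; ring, Real.rpow_add (by positivity),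
        Real.rpow_add (by positivity)]
      ring

theorem continuousAt_Gamma_of_add_nat {z : ℂ} (hz : ∀ i : ℕ, z + i ≠ 0) :
    ContinuousAt Gamma z :=
  (hasDerivAt_Gamma_digamma hz).continuousAt

/-- The confluent case of the non-terminating Saalschütz theorem. -/
theorem hasSum_digamma_saal {α β γ : ℂ} (hα : ∀ i : ℕ, α + i ≠ 0) (hβ : ∀ i : ℕ, β + i ≠ 0)
    (hγ : ∀ i : ℕ, γ + i ≠ 0) (hf : ∀ i : ℕ, α + β + γ + i ≠ 0) (h : (β + γ).re < 1) :
    HasSum (fun k : ℕ => Gamma (α + k) * Gamma (β + k) * Gamma (γ + k) *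
        (k.factorial * (Gamma (1 + k) * Gamma (α + β + γ + k)))⁻¹ *
        (digamma (α + k) + digamma (β + k) + digamma (γ + k) - 2 * digamma (1 + k) -
          digamma (α + β + γ + k)))
      (-(Gamma α ^ 2 * Gamma β ^ 2 * Gamma γ ^ 2 /
        (Gamma (α + β) * Gamma (α + γ) * Gamma (β + γ)))) := by
  obtain ⟨δ₁, p₁, b₁⟩ := exists_pos_le_norm_add_nat hα
  obtain ⟨δ₂, p₂, b₂⟩ := exists_pos_le_norm_add_nat hβ
  obtain ⟨δ₃, p₃, b₃⟩ := exists_pos_le_norm_add_nat hγ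
  obtain ⟨δ₄, p₄, b₄⟩ := exists_pos_le_norm_add_nat hf
  obtain ⟨δ₅, p₅, b₅⟩ := exists_pos_le_norm_add_nat one_add_nat_ne_zero
  set δ := min (min (min δ₁ δ₂) (min δ₃ δ₄)) δ₅ with hδ
  have hδ0 : 0 < δ := by positivity
  replace b₁ : ∀ i : ℕ, δ ≤ ‖α + i‖ := fun i => by
    refine le_trans ?_ (b₁ i); simp [hδ]
  replace b₂ : ∀ i : ℕ, δ ≤ ‖β + i‖ := fun i => by
    refine le_trans ?_ (b₂ i); simp [hδ]
  replace b₃ : ∀ i : ℕ, δ ≤ ‖γ + i‖ := fun i => by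
    refine le_trans ?_ (b₃ i); simp [hδ]
  replace b₄ : ∀ i : ℕ, δ ≤ ‖α + β + γ + i‖ := fun i => by
    refine le_trans ?_ (b₄ i); simp [hδ]
  replace b₅ : ∀ i : ℕ, δ ≤ ‖1 + (i : ℂ)‖ := fun i => by
    refine le_trans ?_ (b₅ i); simp [hδ]
  set R := ‖α‖ + ‖β‖ + ‖γ‖ + 3 with hR
  obtain ⟨C, hC, hb⟩ := exists_norm_saalGamma_le (R := R) (half_pos hδ0)
  -- The denominators are written through `1 / Γ`, which is entire, so continuity at `d = 0` needs
  -- no condition on their arguments.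
  set P : ℂ → ℂ := fun d =>
    Gamma α * Gamma β * Gamma γ * ((Gamma (1 - d))⁻¹ * (Gamma (α + β + γ + d))⁻¹) with hP
  set Q : ℂ → ℂ := fun d => Gamma (α + d) * Gamma (β + d) * Gamma (γ + d) *
    ((Gamma (1 + d))⁻¹ * (Gamma (α + β + γ + d + d))⁻¹) with hQ
  have cinv : ∀ (l : ℂ → ℂ), Continuous l → ContinuousAt (fun d => (Gamma (l d))⁻¹) 0 :=
    fun l hl => (differentiable_one_div_Gamma.continuous.comp hl).continuousAt
  have cG : ∀ x : ℂ, (∀ i : ℕ, x + i ≠ 0) → ContinuousAt (fun d => Gamma (x + d)) 0 := by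
    intro x hx
    refine ContinuousAt.comp (g := Gamma) ?_ (by fun_prop)
    rw [add_zero]
    exact continuousAt_Gamma_of_add_nat hx
  have cP : ContinuousAt P 0 :=
    continuousAt_const.mul ((cinv _ (by fun_prop)).mul (cinv _ (by fun_prop)))
  have cQ : ContinuousAt Q 0 :=
    (((cG α hα).mul (cG β hβ)).mul (cG γ hγ)).mul
      ((cinv _ (by fun_prop)).mul (cinv _ (by fun_prop)))
  have ev : ∀ᶠ d : ℂ in 𝓝 0, ‖P d‖ < ‖P 0‖ + 1 ∧ ‖Q d‖ < ‖Q 0‖ + 1 ∧ ‖d‖ < δ / 4 ∧ ‖d‖ < 1 / 2 ∧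
      (β + γ + d).re < 1 := by
    have n0 : Tendsto (fun d : ℂ => ‖d‖) (𝓝 0) (𝓝 0) := by
      simpa using (continuous_norm (E := ℂ)).tendsto 0
    have r0 : Tendsto (fun d : ℂ => (β + γ + d).re) (𝓝 0) (𝓝 (β + γ).re) := by
      have : Continuous fun d : ℂ => (β + γ + d).re := by fun_prop
      simpa using this.tendsto 0
    refine (cP.norm.eventually_lt_const (lt_add_one _)).and
      ((cQ.norm.eventually_lt_const (lt_add_one _)).and
      ((n0.eventually_lt_const (by positivity)).and ((n0.eventually_lt_const (by positivity)).and
      (r0.eventually_lt_const h))))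
  obtain ⟨ρ, hρ, hU⟩ := Metric.eventually_nhds_iff_ball.1 ev
  set U := Metric.ball (0 : ℂ) ρ with hUdef
  have n1 : ∀ d ∈ U, ∀ i : ℕ, δ / 2 ≤ ‖1 - d + i‖ := fun d hd => by
    rw [sub_eq_add_neg]
    exact half_le_norm_add_add_nat b₅ (by rw [norm_neg]; linarith [(hU d hd).2.2.1])
  have n2 : ∀ d ∈ U, ∀ i : ℕ, δ / 2 ≤ ‖1 + d + i‖ := fun d hd =>
    half_le_norm_add_add_nat b₅ (by linarith [(hU d hd).2.2.1])
  have n3 : ∀ d ∈ U, ∀ i : ℕ, δ / 2 ≤ ‖α + β + γ + d + i‖ := fun d hd =>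
    half_le_norm_add_add_nat b₄ (by linarith [(hU d hd).2.2.1])
  have n4 : ∀ d ∈ U, ∀ i : ℕ, δ / 2 ≤ ‖α + β + γ + d + d + i‖ := fun d hd => by
    rw [add_assoc (α + β + γ)]
    exact half_le_norm_add_add_nat b₄ ((norm_add_le _ _).trans (by linarith [(hU d hd).2.2.1]))
  have n5 : ∀ d ∈ U, ∀ i : ℕ, α + d + i ≠ 0 := fun d hd =>
    add_add_nat_ne_zero hδ0 b₁ (by linarith [(hU d hd).2.2.1])
  have n6 : ∀ d ∈ U, ∀ i : ℕ, β + d + i ≠ 0 := fun d hd =>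
    add_add_nat_ne_zero hδ0 b₂ (by linarith [(hU d hd).2.2.1])
  have n7 : ∀ d ∈ U, ∀ i : ℕ, γ + d + i ≠ 0 := fun d hd =>
    add_add_nat_ne_zero hδ0 b₃ (by linarith [(hU d hd).2.2.1])
  have pos : ∀ {x : ℂ}, δ / 2 ≤ ‖x‖ → x ≠ 0 := fun hx => norm_pos_iff.1 ((half_pos hδ0).trans_le hx)
  set A : ℕ → ℂ → ℂ := fun k d => Gamma (α + k) * Gamma (β + k) * Gamma (γ + k) *
      (k.factorial * (Gamma (1 - d + k) * Gamma (α + β + γ + d + k)))⁻¹ with hA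
  set B : ℕ → ℂ → ℂ := fun k d => Gamma (α + d + k) * Gamma (β + d + k) * Gamma (γ + d + k) *
      (k.factorial * (Gamma (1 + d + k) * Gamma (α + β + γ + d + d + k)))⁻¹ with hB
  have hσ : ∀ d : ℂ, α + d + (β + d) + (γ + d) + -d = α + β + γ + d + d := fun d => by ring
  have eA : ∀ d ∈ U, ∀ k, A k d = saalGamma α β γ d k := fun d hd k =>
    (saalGamma_eq hα hβ hγ (fun i => pos (n1 d hd i)) (fun i => pos (n3 d hd i)) k).symm
  have eB : ∀ d ∈ U, ∀ k, B k d = saalGamma (α + d) (β + d) (γ + d) (-d) k := fun d hd k => by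
    rw [saalGamma_eq (n5 d hd) (n6 d hd) (n7 d hd) (by simpa using fun i => pos (n2 d hd i))
      (by rw [hσ]; exact fun i => pos (n4 d hd i)), hσ, sub_neg_eq_add]
  have bound : ∀ k, ∀ d ∈ U, ‖A k d - B k d‖ ≤
      ((‖P 0‖ + 1) * C + (‖Q 0‖ + 1) * C) * ((k : ℝ) + 1) ^ (-2 : ℝ) := by
    intro k d hd
    obtain ⟨u1, u2, u3, u4, u5⟩ := hU d hd
    have R0 := norm_nonneg α
    have R1 := norm_nonneg β
    have R2 := norm_nonneg γ
    have t1 : ‖α + β + γ‖ ≤ ‖α‖ + ‖β‖ + ‖γ‖ := norm_add₃_le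
    rw [eA d hd, eB d hd]
    refine (norm_sub_le _ _).trans ?_
    have hbA := hb α β γ d (by linarith) (by linarith) (by linarith)
      ((norm_sub_le _ _).trans (by simp; linarith)) ((norm_add_le _ _).trans (by linarith))
      (by linarith) (fun i => (half_le_self hδ0.le).trans (b₅ i)) (n1 d hd) (n3 d hd) k
    have hbB := hb (α + d) (β + d) (γ + d) (-d) ((norm_add_le _ _).trans (by linarith))
      ((norm_add_le _ _).trans (by linarith)) ((norm_add_le _ _).trans (by linarith))
      ((norm_sub_le _ _).trans (by simp; linarith))
      (by rw [hσ]; exact norm_add₃_le.trans (by linarith))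
      (by linarith) (fun i => (half_le_self hδ0.le).trans (b₅ i))
      (by simpa using n2 d hd) (by rw [hσ]; exact n4 d hd) k
    have pA : ‖Gamma α * Gamma β * Gamma γ / (Gamma (1 - d) * Gamma (α + β + γ + d))‖ ≤
        ‖P 0‖ + 1 := by
      refine le_trans (le_of_eq ?_) u1.le
      rw [hP, div_eq_mul_inv, mul_inv]
    have pB : ‖Gamma (α + d) * Gamma (β + d) * Gamma (γ + d) /
        (Gamma (1 - -d) * Gamma (α + d + (β + d) + (γ + d) + -d))‖ ≤ ‖Q 0‖ + 1 := by
      refine le_trans (le_of_eq ?_) u2.le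
      rw [hQ, div_eq_mul_inv, mul_inv, hσ, sub_neg_eq_add]
    have hC' : 0 ≤ C * ((k : ℝ) + 1) ^ (-2 : ℝ) := by positivity
    calc _ ≤ (‖P 0‖ + 1) * (C * ((k : ℝ) + 1) ^ (-2 : ℝ)) +
          (‖Q 0‖ + 1) * (C * ((k : ℝ) + 1) ^ (-2 : ℝ)) :=
          add_le_add (hbA.trans (by gcongr)) (hbB.trans (by gcongr))
      _ = _ := by ring
  have dG : ∀ (x : ℂ) (c e : ℂ) (k : ℕ), (∀ i : ℕ, x + c * e + i ≠ 0) →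
      HasDerivAt (fun d => Gamma (x + c * d + k))
        (c * (Gamma (x + c * e + k) * digamma (x + c * e + k))) e := by
    intro x c e k hx
    have hl : HasDerivAt (fun d : ℂ => x + c * d + k) c e := by
      simpa using (((hasDerivAt_id e).const_mul c).const_add x).add_const (k : ℂ)
    have := (hasDerivAt_Gamma_digamma (z := x + c * e + k)
      (add_nat_add_nat_ne_zero hx k)).comp e hl
    rwa [mul_comm] at this
  have gne : ∀ (x : ℂ) (k : ℕ), (∀ i : ℕ, x + i ≠ 0) → Gamma (x + k) ≠ 0 := fun x k hx =>
    Gamma_ne_zero_of_add_nat (add_nat_add_nat_ne_zero hx k)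
  have kne : ∀ k : ℕ, (k.factorial : ℂ) ≠ 0 := fun k => by exact_mod_cast k.factorial_ne_zero
  have dA : ∀ k, ∀ d ∈ U, HasDerivAt (A k)
      (A k d * (digamma (1 - d + k) - digamma (α + β + γ + d + k))) d := by
    intro k d hd
    have h1 := dG 1 (-1) d k (by simpa [← sub_eq_add_neg] using fun i => pos (n1 d hd i))
    have h2 := dG (α + β + γ) 1 d k (by simpa using fun i => pos (n3 d hd i))
    simp only [neg_mul, one_mul, ← sub_eq_add_neg] at h1 h2
    have g1 := gne _ k (fun i => pos (n1 d hd i))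
    have g2 := gne _ k (fun i => pos (n3 d hd i))
    have := (((h1.mul h2).const_mul (k.factorial : ℂ)).inv
      (mul_ne_zero (kne k) (mul_ne_zero g1 g2))).const_mul
        (Gamma (α + k) * Gamma (β + k) * Gamma (γ + k))
    refine this.congr_deriv ?_
    simp only [hA, Pi.mul_apply]
    have := kne k
    field_simp
    ring
  have dB : ∀ k, ∀ d ∈ U, HasDerivAt (B k)
      (B k d * (digamma (α + d + k) + digamma (β + d + k) + digamma (γ + d + k) -
        digamma (1 + d + k) - 2 * digamma (α + β + γ + d + d + k))) d := by
    intro k d hd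
    have h1 := dG 1 1 d k (by simpa using fun i => pos (n2 d hd i))
    have h2 := dG (α + β + γ) 2 d k (by
      simpa [two_mul, ← add_assoc] using fun i => pos (n4 d hd i))
    have h3 := dG α 1 d k (by simpa using n5 d hd)
    have h4 := dG β 1 d k (by simpa using n6 d hd)
    have h5 := dG γ 1 d k (by simpa using n7 d hd)
    simp only [one_mul] at h1 h3 h4 h5
    have e2 : ∀ d : ℂ, α + β + γ + 2 * d + k = α + β + γ + d + d + k := fun d => by ring
    simp only [e2] at h2
    have g1 := gne _ k (fun i => pos (n2 d hd i))
    have g2 := gne _ k (fun i => pos (n4 d hd i))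
    have := ((h3.mul h4).mul h5).mul (((h1.mul h2).const_mul (k.factorial : ℂ)).inv
      (mul_ne_zero (kne k) (mul_ne_zero g1 g2)))
    refine this.congr_deriv ?_
    simp only [hB, Pi.mul_apply]
    have := kne k
    simp only [Pi.inv_apply]
    field_simp
    ring
  have h0 : (0 : ℂ) ∈ U := Metric.mem_ball_self hρ
  -- Both families coincide at `d = 0`, so Saalschütz's identity is trivial there; its first
  -- derivative in `d` carries the content. A uniformly summable series of holomorphic functions may
  -- be differentiated term by term.
  have key := hasSum_deriv_of_summable_norm
    ((summable_rpow_nat_add_one (by norm_num : (-2 : ℝ) < -1)).mul_left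
      ((‖P 0‖ + 1) * C + (‖Q 0‖ + 1) * C))
    (F := fun k d => A k d - B k d)
    (fun k d hd => ((dA k d hd).sub (dB k d hd)).differentiableAt.differentiableWithinAt)
    Metric.isOpen_ball bound h0
  set E : ℂ → ℂ := fun d => Gamma α * Gamma (α + d) * Gamma β * Gamma (β + d) * Gamma γ *
    Gamma (γ + d) * ((Gamma (α + β + d))⁻¹ * (Gamma (α + γ + d))⁻¹ * (Gamma (β + γ + d))⁻¹) with hE
  have cE : ContinuousAt E 0 :=
    ((((((continuousAt_const.mul (cG α hα)).mul continuousAt_const).mul (cG β hβ)).mul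
      continuousAt_const).mul (cG γ hγ)).mul (((cinv _ (by fun_prop)).mul
        (cinv _ (by fun_prop))).mul (cinv _ (by fun_prop))))
  have hsum : ∀ d ∈ U, ∑' k, (A k d - B k d) = sin (Real.pi * d) / Real.pi * E d := by
    intro d hd
    simp only [eA d hd, eB d hd]
    have m1 : ∀ i : ℕ, 1 - d + i ≠ 0 := fun i => pos (n1 d hd i)
    have m2 : ∀ i : ℕ, α + β + γ + d + i ≠ 0 := fun i => pos (n3 d hd i)
    have m3 : ∀ i : ℕ, 1 - -d + i ≠ 0 := by simpa using fun i => pos (n2 d hd i)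
    have m4 : ∀ i : ℕ, α + d + (β + d) + (γ + d) + -d + i ≠ 0 := by
      rw [hσ]; exact fun i => pos (n4 d hd i)
    rw [((hasSum_saalGamma m1 m2).sub (hasSum_saalGamma m3 m4)).tsum_eq,
      saalSum_sub_saalSum hα hβ hγ (n5 d hd) (n6 d hd) (n7 d hd) m1 (by simpa using m3) m2
        (fun i => pos (n4 d hd i)) (hU d hd).2.2.2.2]
    simp only [hE, div_eq_mul_inv, mul_inv]
  have hpi : (Real.pi : ℂ) ≠ 0 := ofReal_ne_zero.2 Real.pi_ne_zero
  have dS : HasDerivAt (fun d => ∑' k, (A k d - B k d)) (E 0) 0 := by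
    -- Because the sine vanishes at `0`, the slope of the product is the slope of the sine factor
    -- times `E d`; continuity of `E` is enough.
    have e0 : HasDerivAt (fun d => sin (Real.pi * d) / Real.pi * E d) (E 0) 0 := by
      have s1 : HasDerivAt (fun d : ℂ => sin (Real.pi * d) / Real.pi) 1 0 := by
        have := ((hasDerivAt_id (0 : ℂ)).const_mul (Real.pi : ℂ)).csin.div_const (Real.pi : ℂ)
        simpa [hpi] using this
      rw [hasDerivAt_iff_tendsto_slope] at s1 ⊢
      have := s1.mul (cE.tendsto.mono_left nhdsWithin_le_nhds)
      rw [one_mul] at this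
      refine this.congr fun d => ?_
      simp [slope_def_field]
      ring
    refine e0.congr_of_eventuallyEq ?_
    filter_upwards [Metric.ball_mem_nhds (0 : ℂ) hρ] with d hd using hsum d hd
  rw [dS.deriv] at key
  have e1 : -(Gamma α ^ 2 * Gamma β ^ 2 * Gamma γ ^ 2 /
        (Gamma (α + β) * Gamma (α + γ) * Gamma (β + γ))) = -E 0 := by
    simp only [hE, add_zero, div_eq_mul_inv, mul_inv]
    ring
  rw [e1]
  refine (key.neg).congr_fun fun k => ?_
  have hd : HasDerivAt (fun d => A k d - B k d) _ 0 := (dA k 0 h0).sub (dB k 0 h0)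
  rw [hd.deriv]
  simp only [hA, hB, add_zero, sub_zero]
  ring

/-! ### Dougall's theorem for the well-poised series. -/

/-- The `k`-th term of the well-poised series without the factor `a + 2 k`. -/
noncomputable def wellPoisedTerm (a b c d : ℂ) (k : ℕ) : ℂ :=
  risingFactorial a k / risingFactorial (1 + a - b) k *
    (risingFactorial b k / risingFactorial (1 + a - c) k) *
    (risingFactorial c k / risingFactorial (1 + a - d) k) *
    (risingFactorial d k / k.factorial) / a

theorem exists_norm_wellPoisedTerm_le {a b c : ℂ} (d : ℂ) (hb : ∀ i : ℕ, 1 + a - b + i ≠ 0)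
    (hc : ∀ i : ℕ, 1 + a - c + i ≠ 0) (hd : ∀ i : ℕ, 1 + a - d + i ≠ 0) :
    ∃ C > 0, ∀ k : ℕ, ‖wellPoisedTerm a b c d k‖ ≤
      C * ((k : ℝ) + 1) ^ (-2 - 2 * (1 + a - b - c - d).re) := by
  obtain ⟨C₁, h₁, hb₁⟩ := exists_norm_risingFactorial_div_le a hb
  obtain ⟨C₂, h₂, hb₂⟩ := exists_norm_risingFactorial_div_le b hc
  obtain ⟨C₃, h₃, hb₃⟩ := exists_norm_risingFactorial_div_le c hd
  obtain ⟨C₄, h₄, hb₄⟩ := exists_norm_risingFactorial_div_factorial_le d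
  -- The summand `1` keeps the constant positive also for `a = 0`, where `‖a‖⁻¹` is zero by
  -- convention.
  refine ⟨C₁ * C₂ * C₃ * C₄ * (‖a‖⁻¹ + 1), by positivity, fun k => ?_⟩
  have hk : (0 : ℝ) < (k : ℝ) + 1 := by positivity
  rw [wellPoisedTerm, norm_div, norm_mul, norm_mul, norm_mul, div_eq_mul_inv]
  calc _ ≤ (C₁ * ((k : ℝ) + 1) ^ (a.re - (1 + a - b).re)) *
        (C₂ * ((k : ℝ) + 1) ^ (b.re - (1 + a - c).re)) *
        (C₃ * ((k : ℝ) + 1) ^ (c.re - (1 + a - d).re)) * (C₄ * ((k : ℝ) + 1) ^ (d.re - 1)) *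
        (‖a‖⁻¹ + 1) := by
        gcongr
        · exact hb₁ k
        · exact hb₂ k
        · exact hb₃ k
        · exact hb₄ k
        · linarith
    _ = _ := by
      rw [show -2 - 2 * (1 + a - b - c - d).re = (a.re - (1 + a - b).re) +
        (b.re - (1 + a - c).re) + (c.re - (1 + a - d).re) + (d.re - 1) by simp; ring,
        Real.rpow_add hk, Real.rpow_add hk, Real.rpow_add hk]
      ring

theorem norm_add_two_mul_nat_le (a : ℂ) (k : ℕ) :
    ‖a + 2 * k‖ ≤ (‖a‖ + 2) * ((k : ℝ) + 1) := by
  refine (norm_add_le _ _).trans ?_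
  rw [norm_mul, norm_natCast]
  have := norm_nonneg a
  have hk : (0 : ℝ) ≤ k := k.cast_nonneg
  simp
  nlinarith

theorem summable_wellPoisedTerm {a b c d : ℂ} (hb : ∀ i : ℕ, 1 + a - b + i ≠ 0)
    (hc : ∀ i : ℕ, 1 + a - c + i ≠ 0) (hd : ∀ i : ℕ, 1 + a - d + i ≠ 0)
    (hs : 0 < (1 + a - b - c - d).re) :
    Summable fun k : ℕ => (a + 2 * k) * wellPoisedTerm a b c d k := by
  obtain ⟨C, h, hC⟩ := exists_norm_wellPoisedTerm_le d hb hc hd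
  refine (summable_norm_of_le_rpow (C := (‖a‖ + 2) * C)
    (p := -1 - 2 * (1 + a - b - c - d).re) (by linarith) fun k => ?_).of_norm
  have hk : (0 : ℝ) < (k : ℝ) + 1 := by positivity
  rw [norm_mul]
  calc _ ≤ ((‖a‖ + 2) * ((k : ℝ) + 1)) *
        (C * ((k : ℝ) + 1) ^ (-2 - 2 * (1 + a - b - c - d).re)) :=
        mul_le_mul (norm_add_two_mul_nat_le a k) (hC k) (norm_nonneg _) (by positivity)
    _ = _ := by
      rw [show -1 - 2 * (1 + a - b - c - d).re = 1 + (-2 - 2 * (1 + a - b - c - d).re) by ring,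
        Real.rpow_add hk, Real.rpow_one]
      ring

/-- Again a telescoping certificate, quadratic in `k`: it is zero at `k = 0`, and decays like `k` to
the power `-2 Re (1 + a - b - c - d)`. -/
theorem tsum_wellPoisedTerm_contiguous {a b c d : ℂ} (ha : ∀ i : ℕ, a + i ≠ 0)
    (hb : ∀ i : ℕ, 1 + a - b + i ≠ 0) (hc : ∀ i : ℕ, 1 + a - c + i ≠ 0)
    (hd : ∀ i : ℕ, 1 + a - d + i ≠ 0) (hs : 0 < (1 + a - b - c - d).re) :
    (1 + a - b) * (1 + a - c) * (1 + a - d) * (1 + a - b - c - d) *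
      ∑' k : ℕ, (a + 2 * k) * wellPoisedTerm a b c d k =
    (1 + a) * (1 + a - b - c) * (1 + a - b - d) * (1 + a - c - d) *
      ∑' k : ℕ, (a + 1 + 2 * k) * wellPoisedTerm (a + 1) b c d k := by
  have shift : ∀ {x : ℂ}, (∀ i : ℕ, 1 + a - x + i ≠ 0) → ∀ i : ℕ, 1 + (a + 1) - x + i ≠ 0 :=
    fun {x} hx i => by
      have := hx (i + 1)
      push_cast at this
      convert this using 1
      ring
  have s1 := summable_wellPoisedTerm hb hc hd hs
  have s2 := summable_wellPoisedTerm (shift hb) (shift hc) (shift hd)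
    (by simp only [sub_re, add_re, one_re] at hs ⊢; linarith)
  rw [← tsum_mul_left, ← tsum_mul_left, ← sub_eq_zero,
    ← (s1.mul_left _).tsum_sub (s2.mul_left _)]
  set w := (1 + a - b) * (1 + a - c) * (1 + a - d) with hw
  have hR : Tendsto (fun k : ℕ => w * (k * (-(1 + 2 * a - b - c - d) - k)) *
      wellPoisedTerm a b c d k) atTop (𝓝 0) := by
    obtain ⟨C, h, hC⟩ := exists_norm_wellPoisedTerm_le d hb hc hd
    set M := ‖1 + 2 * a - b - c - d‖ + 1 with hM
    have hM0 : 0 < M := by positivity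
    refine tendsto_zero_of_norm_le_rpow (C := ‖w‖ * M * C)
      (p := -2 * (1 + a - b - c - d).re) (by linarith) fun k => ?_
    have hk : (0 : ℝ) < (k : ℝ) + 1 := by positivity
    have hk0 : (0 : ℝ) ≤ k := k.cast_nonneg
    have b1 : ‖-(1 + 2 * a - b - c - d) - (k : ℂ)‖ ≤ M * ((k : ℝ) + 1) := by
      refine (norm_sub_le _ _).trans ?_
      rw [norm_neg, norm_natCast]
      have := norm_nonneg (1 + 2 * a - b - c - d)
      nlinarith
    rw [norm_mul, norm_mul w, norm_mul (k : ℂ), norm_natCast]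
    calc _ ≤ ‖w‖ * (((k : ℝ) + 1) * (M * ((k : ℝ) + 1))) *
          (C * ((k : ℝ) + 1) ^ (-2 - 2 * (1 + a - b - c - d).re)) := by
          gcongr
          · linarith
          · exact hC k
      _ = _ := by
        rw [show -2 * (1 + a - b - c - d).re = 2 + (-2 - 2 * (1 + a - b - c - d).re) by ring,
          Real.rpow_add hk, Real.rpow_two]
        ring
  rw [tsum_eq_of_telescoping ((s1.mul_left _).sub (s2.mul_left _)) (fun k => ?_) hR]
  · simp
  have a0 : a ≠ 0 := by simpa using ha 0
  have a1 : a + 1 ≠ 0 := by simpa using ha 1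
  have fac : (k.factorial : ℂ) ≠ 0 := by exact_mod_cast k.factorial_ne_zero
  have k1 : (k : ℂ) + 1 ≠ 0 := Nat.cast_add_one_ne_zero k
  have e : ∀ {x : ℂ}, (∀ i : ℕ, 1 + a - x + i ≠ 0) → risingFactorial (1 + (a + 1) - x) k =
      risingFactorial (1 + a - x) k * (1 + a - x + k) / (1 + a - x) := fun {x} hx => by
    have : 1 + a - x ≠ 0 := by simpa using hx 0
    rw [eq_div_iff this, ← risingFactorial_shift, mul_comm]
    congr 2
    ring
  have e' : risingFactorial (a + 1) k = risingFactorial a k * (a + k) / a := by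
    rw [eq_div_iff a0, ← risingFactorial_shift, mul_comm]
  have b1 := hb k
  have c1 := hc k
  have d1 := hd k
  have b0 : 1 + a - b ≠ 0 := by simpa using hb 0
  have c0 : 1 + a - c ≠ 0 := by simpa using hc 0
  have d0 : 1 + a - d ≠ 0 := by simpa using hd 0
  have fb := risingFactorial_ne_zero hb k
  have fc := risingFactorial_ne_zero hc k
  have fd := risingFactorial_ne_zero hd k
  simp only [wellPoisedTerm, e hb, e hc, e hd, e', risingFactorial_succ, Nat.factorial_succ, hw]
  generalize risingFactorial (1 + a - b) k = X1 at *
  generalize risingFactorial (1 + a - c) k = X2 at *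
  generalize risingFactorial (1 + a - d) k = X3 at *
  generalize hB : 1 + a - b = B at *
  generalize hC : 1 + a - c = C at *
  generalize hD : 1 + a - d = D at *
  obtain rfl : b = 1 + a - B := by rw [← hB]; ring
  obtain rfl : c = 1 + a - C := by rw [← hC]; ring
  obtain rfl : d = 1 + a - D := by rw [← hD]; ring
  push_cast
  field_simp
  ring

/-- For `k ≥ 1` the two lower parameters `1 + a + N - c` and `1 + a + N - d` drive the term to zero,
while the quotient involving `a` and `1 + a - b` stays bounded uniformly in `N` by a power of `k +
1`. -/
theorem tendsto_tsum_wellPoisedTerm_add_nat {a b c d : ℂ} (ha : ∀ i : ℕ, a + i ≠ 0)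
    (hb : ∀ i : ℕ, 1 + a - b + i ≠ 0) :
    Tendsto (fun N : ℕ => ∑' k : ℕ, (a + N + 2 * k) * wellPoisedTerm (a + N) b c d k) atTop
      (𝓝 1) := by
  obtain ⟨C₁, h₁, hb₁⟩ := exists_norm_risingFactorial_add_nat_div_le ha hb
  obtain ⟨C₄, h₄, hb₄⟩ := exists_norm_risingFactorial_div_factorial_le d
  set m := max 0 (a.re - (1 + a - b).re) with hm
  -- This integer replaces the real parts of the two growing lower parameters in the majorant; it is
  -- large enough to bring the total exponent below `-1`.
  obtain ⟨n, hn⟩ := exists_nat_gt (m + |b.re| + |c.re| + |d.re| + 2)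
  have hm0 : 0 ≤ m := le_max_left _ _
  have ab := abs_nonneg b.re
  have ac := abs_nonneg c.re
  have ad := abs_nonneg d.re
  have hn0 : (0 : ℝ) < n := by linarith
  have hY : ∀ i : ℕ, ((n : ℝ) : ℂ) + i ≠ 0 := add_nat_ne_zero_of_re_pos (by simpa using hn0)
  obtain ⟨C₂, h₂, hb₂⟩ := exists_norm_risingFactorial_div_le b hY
  obtain ⟨C₃, h₃, hb₃⟩ := exists_norm_risingFactorial_div_le c hY
  have hs : Summable fun k : ℕ => 3 * (C₁ * C₂ * C₃ * C₄) * ((k : ℝ) + 1) ^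
      (1 + m + (b.re - n) + (c.re - n) + (d.re - 1)) := by
    refine (summable_rpow_nat_add_one ?_).mul_left _
    have := le_abs_self b.re
    have := le_abs_self c.re
    have := le_abs_self d.re
    linarith
  have h1 : (1 : ℂ) = ∑' k : ℕ, if k = 0 then 1 else 0 := by simp
  rw [h1]
  have evN : ∀ x : ℂ, ∀ᶠ N : ℕ in atTop, (n : ℝ) ≤ (1 + (a + N) - x).re := fun x => by
    obtain ⟨N₀, hN₀⟩ := exists_nat_ge (n - (1 + a - x).re)
    filter_upwards [eventually_ge_atTop N₀] with N hN
    have : (N₀ : ℝ) ≤ N := by exact_mod_cast hN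
    simp at hN₀ ⊢
    linarith
  have evA : ∀ᶠ N : ℕ in atTop, 1 ≤ ‖a + N‖ := by
    have := (tendsto_inv_add_nat a).norm.eventually_lt_const (u := 1) (by simp)
    filter_upwards [this] with N hN
    rw [norm_inv] at hN
    have p : 0 < ‖a + N‖ := norm_pos_iff.2 (ha N)
    exact ((inv_lt_one₀ p).1 hN).le
  have eq : ∀ N k : ℕ, (a + N + 2 * k) * wellPoisedTerm (a + N) b c d k =
      (1 + 2 * k * (a + N)⁻¹) * (risingFactorial (a + N) k / risingFactorial (1 + a - b + N) k) *
        (risingFactorial b k / risingFactorial (1 + (a + N) - c) k) *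
        (risingFactorial c k / risingFactorial (1 + (a + N) - d) k) *
        (risingFactorial d k / k.factorial) := fun N k => by
    have := ha N
    rw [wellPoisedTerm, show 1 + (a + N) - b = 1 + a - b + N by ring]
    field_simp
  simp only [eq]
  refine tendsto_tsum_of_dominated_convergence hs (fun k => ?_) ?_
  · rcases k with _ | k
    · simp [risingFactorial_zero]
    · simp only [Nat.add_eq_zero_iff, one_ne_zero, and_false, if_false]
      have t1 := ((tendsto_inv_add_nat a).const_mul (2 * ((k + 1 : ℕ) : ℂ))).const_add 1
      have t2 := tendsto_risingFactorial_add_nat_div a hb (k + 1)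
      have t3 := (tendsto_inv_risingFactorial_add_nat (1 + a - c) k).const_mul
        (risingFactorial b (k + 1))
      have t4 := (tendsto_inv_risingFactorial_add_nat (1 + a - d) k).const_mul
        (risingFactorial c (k + 1))
      have := (((t1.mul t2).mul t3).mul t4).mul_const
        (risingFactorial d (k + 1) / (k + 1).factorial)
      simp only [mul_zero, zero_mul] at this
      refine this.congr fun N => ?_
      rw [← div_eq_mul_inv (risingFactorial b (k + 1)),
        ← div_eq_mul_inv (risingFactorial c (k + 1)),
        show 1 + a - c + (N : ℂ) = 1 + (a + N) - c by ring,
        show 1 + a - d + (N : ℂ) = 1 + (a + N) - d by ring]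
  · filter_upwards [evN c, evN d, evA] with N h3 h4 h5 k
    have hk : (0 : ℝ) < (k : ℝ) + 1 := by positivity
    have den : ∀ {x y : ℂ}, (n : ℝ) ≤ y.re → ‖risingFactorial x k / risingFactorial y k‖ ≤
        ‖risingFactorial x k / risingFactorial ((n : ℝ) : ℂ) k‖ := fun {x y} hy => by
      have : 0 < ‖risingFactorial ((n : ℝ) : ℂ) k‖ :=
        norm_pos_iff.2 (risingFactorial_ne_zero hY k)
      rw [norm_div, norm_div]
      gcongr
      exact norm_risingFactorial_le_of_le_re hn0 hy k
    have lin : ‖1 + 2 * k * (a + N)⁻¹‖ ≤ 3 * ((k : ℝ) + 1) := by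
      refine (norm_add_le _ _).trans ?_
      rw [norm_mul, norm_mul, norm_inv, Complex.norm_natCast]
      have : ‖a + N‖⁻¹ ≤ 1 := inv_le_one_of_one_le₀ h5
      have hk0 : (0 : ℝ) ≤ k := k.cast_nonneg
      simp
      nlinarith
    simp only [norm_mul]
    calc _ ≤ (3 * ((k : ℝ) + 1)) * (C₁ * ((k : ℝ) + 1) ^ m) *
          (C₂ * ((k : ℝ) + 1) ^ (b.re - ((n : ℝ) : ℂ).re)) *
          (C₃ * ((k : ℝ) + 1) ^ (c.re - ((n : ℝ) : ℂ).re)) *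
          (C₄ * ((k : ℝ) + 1) ^ (d.re - 1)) := by
          gcongr
          · exact hb₁ N k
          · exact (den h3).trans (hb₂ k)
          · exact (den h4).trans (hb₃ k)
          · exact hb₄ k
      _ = _ := by
        rw [Real.rpow_add hk, Real.rpow_add hk, Real.rpow_add hk, Real.rpow_add hk, Real.rpow_one]
        simp only [ofReal_re]
        ring

/-- **Dougall's theorem** for the well-poised `₅F₄` series of unit argument. -/
theorem tsum_wellPoisedTerm {a b c d : ℂ} (ha : ∀ i : ℕ, a + i ≠ 0)
    (hb : ∀ i : ℕ, 1 + a - b + i ≠ 0) (hc : ∀ i : ℕ, 1 + a - c + i ≠ 0)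
    (hd : ∀ i : ℕ, 1 + a - d + i ≠ 0) (hs : 0 < (1 + a - b - c - d).re) :
    ∑' k : ℕ, (a + 2 * k) * wellPoisedTerm a b c d k =
      Gamma (1 + a - b) * Gamma (1 + a - c) / (Gamma (1 + a) * Gamma (1 + a - b - c)) *
        (Gamma (1 + a - d) * Gamma (1 + a - b - c - d) /
          (Gamma (1 + a - b - d) * Gamma (1 + a - c - d))) := by
  have hs' : ∀ i : ℕ, 1 + a - b - c - d + i ≠ 0 := add_nat_ne_zero_of_re_pos hs
  have iter : ∀ N : ℕ, ∑' k : ℕ, (a + 2 * k) * wellPoisedTerm a b c d k =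
      risingFactorial (1 + a) N * risingFactorial (1 + a - b - c) N /
        (risingFactorial (1 + a - b) N * risingFactorial (1 + a - c) N) *
      (risingFactorial (1 + a - b - d) N * risingFactorial (1 + a - c - d) N /
        (risingFactorial (1 + a - d) N * risingFactorial (1 + a - b - c - d) N)) *
      ∑' k : ℕ, (a + N + 2 * k) * wellPoisedTerm (a + N) b c d k := by
    intro N
    induction N with
    | zero => simp [risingFactorial_zero]
    | succ N ih =>
      have sh : ∀ {x : ℂ}, (∀ i : ℕ, 1 + a - x + i ≠ 0) →
          ∀ i : ℕ, 1 + (a + N) - x + i ≠ 0 := fun {x} hx i => by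
        convert add_nat_add_nat_ne_zero hx N i using 1
        ring
      have h := tsum_wellPoisedTerm_contiguous (add_nat_add_nat_ne_zero ha N) (sh hb) (sh hc)
        (sh hd) (by
          simp only [sub_re, add_re, one_re, natCast_re] at hs ⊢
          have : (0 : ℝ) ≤ N := N.cast_nonneg
          linarith)
      have f1 := risingFactorial_ne_zero hb N
      have f2 := risingFactorial_ne_zero hc N
      have f3 := risingFactorial_ne_zero hd N
      have f4 := risingFactorial_ne_zero hs' N
      have g1 := hb N
      have g2 := hc N
      have g3 := hd N
      have g4 := hs' N
      rw [ih]
      simp only [risingFactorial_succ]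
      push_cast
      rw [← add_assoc a]
      rw [div_mul_div_comm, div_mul_div_comm, div_mul_eq_mul_div, div_mul_eq_mul_div,
        div_eq_div_iff (by positivity) (by positivity)]
      generalize ∑' k : ℕ, (a + N + 2 * k) * wellPoisedTerm (a + N) b c d k = S at *
      generalize ∑' k : ℕ, (a + N + 1 + 2 * k) * wellPoisedTerm (a + N + 1) b c d k = S' at *
      generalize risingFactorial (1 + a - b - c) N = x1 at *
      generalize risingFactorial (1 + a - b - d) N = x2 at *
      generalize risingFactorial (1 + a - c - d) N = x3 at *
      generalize risingFactorial (1 + a - b - c - d) N = x4 at *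
      generalize risingFactorial (1 + a - b) N = x5 at *
      generalize risingFactorial (1 + a - c) N = x6 at *
      generalize risingFactorial (1 + a - d) N = x7 at *
      generalize risingFactorial (1 + a) N = x8 at *
      linear_combination (x1 * x2 * x3 * x4 * x5 * x6 * x7 * x8) * h
  have hconst : Tendsto (fun _ : ℕ => ∑' k : ℕ, (a + 2 * k) * wellPoisedTerm a b c d k) atTop
    (𝓝 _) := tendsto_const_nhds
  refine tendsto_nhds_unique hconst ?_
  have hl := ((tendsto_risingFactorial_two_div_two (x₁ := 1 + a) (x₂ := 1 + a - b - c) (by ring)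
    hb hc).mul (tendsto_risingFactorial_two_div_two (x₁ := 1 + a - b - d) (x₂ := 1 + a - c - d)
    (by ring) hd hs')).mul (tendsto_tsum_wellPoisedTerm_add_nat (c := c) (d := d) ha hb)
  rw [mul_one] at hl
  exact hl.congr fun N => (iter N).symm

/-! ### Linearization of products of Legendre coefficients. -/

/-- The coefficient of `y^j` in `P_ν(1 - 2 y)`. -/
noncomputable def legendreCoeff (ν : ℂ) (j : ℕ) : ℂ := gaussTerm (-ν) (ν + 1) 1 j

theorem legendreCoeff_zero (ν : ℂ) : legendreCoeff ν 0 = 1 := by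
  simp [legendreCoeff, gaussTerm, risingFactorial_zero]

theorem legendreCoeff_succ (ν : ℂ) (j : ℕ) :
    ((j : ℂ) + 1) ^ 2 * legendreCoeff ν (j + 1) = (j * (j + 1) - ν * (ν + 1)) * legendreCoeff ν j := by
  have fac : (j.factorial : ℂ) ≠ 0 := by exact_mod_cast j.factorial_ne_zero
  have k1 : (j : ℂ) + 1 ≠ 0 := Nat.cast_add_one_ne_zero j
  have k2 := one_add_nat_ne_zero j
  simp only [legendreCoeff, gaussTerm, risingFactorial_succ, risingFactorial_one,
    Nat.factorial_succ]
  push_cast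
  field_simp
  ring

/-- The linearization coefficients of products of Legendre coefficients. -/
def linCoeff (p q j : ℕ) : ℂ := (-1) ^ (p + q + j) * j.choose p * j.choose q * (p + q).choose j

/-- This is the recurrence forced by eliminating `ν (ν + 1)` between the recurrences of `c_p` and
`c_j`; it reduces to binomial identities in which `ν` no longer occurs. -/
theorem linCoeff_succ (p q j : ℕ) :
    ((p : ℂ) + 1) ^ 2 * linCoeff (p + 1) q (j + 1) = ((j : ℂ) + 1) ^ 2 * linCoeff p q j +
      (p * (p + 1) - (j + 1) * (j + 2)) * linCoeff p q (j + 1) := by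
  have h1 : ((j : ℂ) + 1) * j.choose p = (j + 1).choose (p + 1) * (p + 1) := by
    exact_mod_cast Nat.add_one_mul_choose_eq j p
  have h2 : ((j : ℂ) + 1) * (j.choose q) = (j + 1).choose q * (j + 1 - q) := by
    rcases le_or_gt q (j + 1) with h | h
    · have := Nat.choose_mul_succ_eq j q
      have h' : (((j + 1 - q : ℕ)) : ℂ) = j + 1 - q := by rw [Nat.cast_sub h]; push_cast; ring
      rw [← h', mul_comm]
      exact_mod_cast this
    · rw [Nat.choose_eq_zero_of_lt h, Nat.choose_eq_zero_of_lt (by omega : j < q)]; simp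
  have h3 : ((j + 1).choose (p + 1) : ℂ) * (p + 1) = (j + 1).choose p * (j + 1 - p) := by
    rcases le_or_gt p (j + 1) with h | h
    · have := Nat.choose_succ_right_eq (j + 1) p
      have h' : (((j + 1 - p : ℕ)) : ℂ) = j + 1 - p := by rw [Nat.cast_sub h]; push_cast; ring
      rw [← h']
      exact_mod_cast this
    · rw [Nat.choose_eq_zero_of_lt h, Nat.choose_eq_zero_of_lt (by omega : j + 1 < p + 1)]; simp
  have h4 : ((p + q + 1).choose (j + 1) : ℂ) = (p + q).choose j + (p + q).choose (j + 1) := by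
    exact_mod_cast Nat.choose_succ_succ' (p + q) j
  have h5 : ((p + q).choose (j + 1) : ℂ) * (j + 1) = (p + q).choose j * (p + q - j) := by
    rcases le_or_gt j (p + q) with h | h
    · have := Nat.choose_succ_right_eq (p + q) j
      have h' : (((p + q - j : ℕ)) : ℂ) = p + q - j := by rw [Nat.cast_sub h]; push_cast; ring
      rw [← h']
      exact_mod_cast this
    · rw [Nat.choose_eq_zero_of_lt h, Nat.choose_eq_zero_of_lt (by omega : p + q < j + 1)]; simp
  have s1 : (-1 : ℂ) ^ (p + 1 + q + (j + 1)) = (-1) ^ (p + q + j) := by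
    rw [show p + 1 + q + (j + 1) = p + q + j + 2 by ring, pow_add]; simp
  have s2 : (-1 : ℂ) ^ (p + q + (j + 1)) = -(-1) ^ (p + q + j) := by
    rw [← add_assoc, pow_succ]; ring
  simp only [linCoeff, s1, s2]
  rw [show p + 1 + q = p + q + 1 by ring, h4]
  generalize ((-1 : ℂ) ^ (p + q + j)) = s at *
  generalize (j.choose p : ℂ) = a at *
  generalize (j.choose q : ℂ) = b at *
  generalize ((j + 1).choose (p + 1) : ℂ) = x at *
  generalize ((j + 1).choose p : ℂ) = y at *
  generalize ((j + 1).choose q : ℂ) = z at *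
  generalize ((p + q).choose j : ℂ) = u at *
  generalize ((p + q).choose (j + 1) : ℂ) = v at *
  linear_combination (-s * u * (j + 1) * b) * h1 - s * u * x * (p + 1) * h2 +
    (s * z * (p + 1) * (u + v) - s * u * z * (j + 1 - q)) * h3 - s * z * y * (j + 1 - p) * h5

/-- Induction on `p`: multiplying `c_j` by `p (p + 1) - ν (ν + 1)` gives `(j + 1)² c_{j+1} + (p (p +
1) - j (j + 1)) c_j`, so linear combinations of the `c_j` are preserved. The bound `M` is left free
so that sums of different lengths can be compared. -/
theorem legendreCoeff_mul (ν : ℂ) (p q M : ℕ) (hM : p + q + 1 ≤ M) :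
    legendreCoeff ν p * legendreCoeff ν q =
      ∑ j ∈ Finset.range M, linCoeff p q j * legendreCoeff ν j := by
  induction p generalizing M with
  | zero =>
    rw [Finset.sum_eq_single q]
    · simp [linCoeff, legendreCoeff_zero, ← two_mul]
    · intro j _ hj
      rcases lt_or_gt_of_ne hj with h | h
      · simp [linCoeff, Nat.choose_eq_zero_of_lt h]
      · simp [linCoeff, Nat.choose_eq_zero_of_lt h]
    · intro h; simp at h; omega
  | succ p ih =>
    obtain ⟨M, rfl⟩ : ∃ M', M = M' + 1 := ⟨M - 1, by omega⟩
    have i1 := ih M (by omega)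
    have i2 := ih (M + 1) (by omega)
    have hp : ((p : ℂ) + 1) ^ 2 ≠ 0 := pow_ne_zero _ (Nat.cast_add_one_ne_zero p)
    refine mul_left_cancel₀ hp ?_
    rw [← mul_assoc, legendreCoeff_succ]
    have e1 : (p * (p + 1) - ν * (ν + 1)) * legendreCoeff ν p * legendreCoeff ν q =
        ∑ j ∈ Finset.range M, linCoeff p q j * (((j : ℂ) + 1) ^ 2 * legendreCoeff ν (j + 1)) +
        ∑ j ∈ Finset.range (M + 1),
          (p * (p + 1) - j * (j + 1)) * linCoeff p q j * legendreCoeff ν j := by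
      -- The induction hypothesis at `M` and at `M + 1` shows that the last term is zero.
      have : ∑ j ∈ Finset.range (M + 1), linCoeff p q j * legendreCoeff ν j =
          ∑ j ∈ Finset.range M, linCoeff p q j * legendreCoeff ν j := by rw [← i1, ← i2]
      rw [Finset.sum_range_succ, add_eq_left] at this
      rw [Finset.sum_range_succ, mul_assoc _ (linCoeff p q M), this, mul_zero, add_zero,
        ← Finset.sum_add_distrib, mul_assoc, i1, Finset.mul_sum]
      refine Finset.sum_congr rfl fun j _ => ?_
      rw [legendreCoeff_succ]
      ring
    rw [e1, Finset.sum_range_succ', Finset.sum_range_succ' _ M, ← add_assoc,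
      ← Finset.sum_add_distrib, mul_add (((p : ℂ) + 1) ^ 2), Finset.mul_sum]
    congr 1
    · refine Finset.sum_congr rfl fun j _ => ?_
      have := linCoeff_succ p q j
      push_cast
      linear_combination (-legendreCoeff ν (j + 1)) * this
    -- The terms at `j = 0`: the factor `p (p + 1)` is zero for `p = 0`, the binomial `(0 choose p)`
    -- for `p > 0`, and `(0 choose p + 1)` is zero always.
    · rcases p with _ | p <;> simp [linCoeff]

/-! ### Central coefficients of powers of a quadratic. -/

/-- The central coefficient of `(α T² + β T + γ)^j`, with `η = α γ`. -/
def centralCoeff {R : Type*} [CommSemiring R] (j : ℕ) (β η : R) : R :=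
  ∑ k ∈ Finset.range (j + 1), β ^ (j - k) * (j.choose k : R) *
    ∑ m ∈ Finset.range (k + 1), if 2 * m = k then (k.choose m : R) * η ^ m else 0

open Polynomial in
-- Taking `β T` from `j - k` factors leaves the coefficient of `T^k` in `(α T² + γ)^k`. It is
-- nonzero only for `k = 2 m`, and then `α` and `γ` are taken `m` times each, so only `α γ` matters.
theorem coeff_quadratic_pow {R : Type*} [CommSemiring R] (α β γ : R) (j : ℕ) :
    ((Polynomial.C α * X ^ 2 + Polynomial.C β * X + Polynomial.C γ) ^ j).coeff j =
      centralCoeff j β (α * γ) := by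
  rw [show Polynomial.C α * X ^ 2 + Polynomial.C β * X + Polynomial.C γ =
    (Polynomial.C α * X ^ 2 + Polynomial.C γ) + Polynomial.C β * X by ring, add_pow,
    finsetSum_coeff, centralCoeff]
  refine Finset.sum_congr rfl fun k hk => ?_
  have hk' : k ≤ j := by simpa [Nat.lt_succ_iff] using hk
  have e : (Polynomial.C α * X ^ 2 + Polynomial.C γ) ^ k * (Polynomial.C β * X) ^ (j - k) *
      (j.choose k : R[X]) = Polynomial.C (β ^ (j - k) * (j.choose k : R)) *
        ((Polynomial.C α * X ^ 2 + Polynomial.C γ) ^ k * X ^ (j - k)) := by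
    simp only [mul_pow, Polynomial.C_mul, Polynomial.C_pow, map_natCast]
    ring
  rw [e, coeff_C_mul]
  congr 1
  rw [coeff_mul_X_pow', if_pos (by omega), show j - (j - k) = k by omega, add_pow,
    finsetSum_coeff]
  refine Finset.sum_congr rfl fun m hm => ?_
  have e2 : (Polynomial.C α * X ^ 2) ^ m * Polynomial.C γ ^ (k - m) * (k.choose m : R[X]) =
      Polynomial.C (α ^ m * γ ^ (k - m) * (k.choose m : R)) * X ^ (2 * m) := by
    simp only [mul_pow, Polynomial.C_mul, Polynomial.C_pow, map_natCast, ← pow_mul]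
    ring
  rw [e2, coeff_C_mul, coeff_X_pow]
  by_cases h : 2 * m = k
  · rw [if_pos h, if_pos h.symm, show k - m = m by omega, mul_pow]
    ring
  · rw [if_neg h, if_neg (Ne.symm h), mul_zero]

/-- Homogeneity with `β` of weight one and `η` of weight two. It extracts the factor `r^j` of the
Abel means. -/
theorem centralCoeff_smul {R : Type*} [CommSemiring R] (j : ℕ) (r β η : R) :
    centralCoeff j (r * β) (r ^ 2 * η) = r ^ j * centralCoeff j β η := by
  rw [centralCoeff, centralCoeff, Finset.mul_sum]
  refine Finset.sum_congr rfl fun k hk => ?_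
  have hk' : k ≤ j := by simpa [Nat.lt_succ_iff] using hk
  rw [Finset.mul_sum, Finset.mul_sum, Finset.mul_sum]
  refine Finset.sum_congr rfl fun m _ => ?_
  by_cases h : 2 * m = k
  · rw [if_pos h, if_pos h, mul_pow, mul_pow, ← pow_mul, h]
    rw [show r ^ j = r ^ (j - k) * r ^ k by rw [← pow_add]; congr 1; omega]
    ring
  · simp [if_neg h]

/-- A central coefficient of `e T² + b T + e` with nonnegative coefficients is at most the value of
the power at `T = 1`. -/
theorem norm_centralCoeff_le (j : ℕ) {β η : ℂ} {b e : ℝ} (hβ : ‖β‖ ≤ b) (he : 0 ≤ e)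
    (hη : ‖η‖ ≤ e ^ 2) : ‖centralCoeff j β η‖ ≤ (b + 2 * e) ^ j := by
  have hb : 0 ≤ b := (norm_nonneg _).trans hβ
  rw [add_comm, add_pow, centralCoeff]
  refine (norm_sum_le _ _).trans (Finset.sum_le_sum fun k _ => ?_)
  rw [norm_mul, norm_mul, norm_pow, norm_natCast]
  have key : ‖∑ m ∈ Finset.range (k + 1), if 2 * m = k then (k.choose m : ℂ) * η ^ m else 0‖ ≤
      (2 * e) ^ k := by
    rcases Nat.even_or_odd' k with ⟨m, h | h⟩
    · rw [Finset.sum_eq_single m]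
      · rw [if_pos h.symm, norm_mul, norm_pow, norm_natCast, mul_pow]
        have h1 : (k.choose m : ℝ) ≤ 2 ^ k := by exact_mod_cast Nat.choose_le_two_pow k m
        have h2 : ‖η‖ ^ m ≤ e ^ k := by
          calc ‖η‖ ^ m ≤ (e ^ 2) ^ m := by gcongr
            _ = e ^ k := by rw [← pow_mul, h]
        gcongr
      · intro m' _ hm'
        rw [if_neg (by omega)]
      · intro hm; simp at hm; omega
    · rw [Finset.sum_eq_zero fun m' _ => if_neg (by omega)]
      simp only [norm_zero]
      positivity
  calc _ ≤ b ^ (j - k) * (j.choose k) * (2 * e) ^ k := by gcongr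
    _ = _ := by ring

open Polynomial in
-- The factor `(p + q choose j)` is the coefficient of `T^j` in `(1 + T)^(p + q)`; the sums over `p`
-- and `q` are then binomial expansions, and the total is the central coefficient of `-(1 - X' (1 +
-- T)) (1 - Y' (1 + T))`.
theorem sum_linCoeff_mul_pow (X' Y' : ℂ) (j : ℕ) :
    ∑ p ∈ Finset.range (j + 1), ∑ q ∈ Finset.range (j + 1), linCoeff p q j * (X' ^ p * Y' ^ q) =
      centralCoeff j (X' + Y' - 2 * X' * Y') (X' * Y' * (1 - X') * (1 - Y')) := by
  have h1 := coeff_quadratic_pow (-(X' * Y')) (X' + Y' - 2 * X' * Y') (-((1 - X') * (1 - Y'))) j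
  rw [show -(X' * Y') * -((1 - X') * (1 - Y')) = X' * Y' * (1 - X') * (1 - Y') by ring] at h1
  rw [← h1]
  have e : Polynomial.C (-(X' * Y')) * X ^ 2 + Polynomial.C (X' + Y' - 2 * X' * Y') * X +
      Polynomial.C (-((1 - X') * (1 - Y'))) =
      Polynomial.C (-1) * ((Polynomial.C (-X') * (1 + X) + 1) * (Polynomial.C (-Y') * (1 + X) + 1)) := by
    simp only [map_neg, map_mul, map_sub, map_add, map_one, map_ofNat]
    ring
  rw [e, mul_pow, mul_pow, add_pow, add_pow, ← Polynomial.C_pow, coeff_C_mul, Finset.sum_mul_sum,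
    finsetSum_coeff, Finset.mul_sum]
  refine Finset.sum_congr rfl fun p _ => ?_
  rw [finsetSum_coeff, Finset.mul_sum]
  refine Finset.sum_congr rfl fun q _ => ?_
  have e2 : (Polynomial.C (-X') * (1 + X)) ^ p * 1 ^ (j - p) * (j.choose p : ℂ[X]) *
      ((Polynomial.C (-Y') * (1 + X)) ^ q * 1 ^ (j - q) * (j.choose q : ℂ[X])) =
      Polynomial.C ((-X') ^ p * (-Y') ^ q * (j.choose p : ℂ) * (j.choose q : ℂ)) *
        (1 + X) ^ (p + q) := by
    simp only [mul_pow, Polynomial.C_mul, Polynomial.C_pow, map_natCast, one_pow]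
    ring
  rw [e2, coeff_C_mul, coeff_one_add_X_pow, linCoeff, neg_pow X', neg_pow Y']
  ring

open Polynomial in
-- The quadratic equals `t (T - 1)² + T`, and the binomial theorem is applied to this splitting.
theorem centralCoeff_eq_sum_choose (t : ℂ) (j : ℕ) :
    centralCoeff j (1 - 2 * t) (t ^ 2) =
      ∑ i ∈ Finset.range (j + 1), (j.choose i : ℂ) * ((2 * i).choose i) * (-t) ^ i := by
  rw [sq, ← coeff_quadratic_pow]
  have e : Polynomial.C t * X ^ 2 + Polynomial.C (1 - 2 * t) * X + Polynomial.C t =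
      Polynomial.C t * (X - 1) ^ 2 + X := by
    simp only [map_mul, map_sub, map_one, map_ofNat]
    ring
  rw [e, add_pow, finsetSum_coeff]
  refine Finset.sum_congr rfl fun i hi => ?_
  have hi' : i ≤ j := by simpa [Nat.lt_succ_iff] using hi
  have e2 : (Polynomial.C t * (X - 1) ^ 2) ^ i * X ^ (j - i) * (j.choose i : ℂ[X]) =
      Polynomial.C (t ^ i * (j.choose i : ℂ)) * ((X + Polynomial.C (-1)) ^ (2 * i) * X ^ (j - i)) := by
    simp only [mul_pow, Polynomial.C_mul, Polynomial.C_pow, map_natCast, map_neg, map_one,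
      ← sub_eq_add_neg, ← pow_mul]
    ring
  rw [e2, coeff_C_mul, coeff_mul_X_pow', if_pos (by omega), show j - (j - i) = i by omega,
    coeff_X_add_C_pow, show 2 * i - i = i by omega, neg_pow t]
  ring

/-! ### The Legendre series and Bailey's factorization near the origin. -/

/-- The power series `∑ c_j y^j = P_ν(1 - 2 y)`. -/
noncomputable def legendreSeries (ν y : ℂ) : ℂ := ∑' j : ℕ, legendreCoeff ν j * y ^ j

theorem exists_norm_legendreCoeff_le (ν : ℂ) :
    ∃ C > 0, ∀ j : ℕ, ‖legendreCoeff ν j‖ ≤ C * ((j : ℝ) + 1)⁻¹ := by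
  obtain ⟨C, hC, h⟩ := exists_norm_gaussTerm_le (-ν) (ν + 1) one_add_nat_ne_zero
  refine ⟨C, hC, fun j => (h j).trans (le_of_eq ?_)⟩
  rw [show (-ν).re + (ν + 1).re - (1 : ℂ).re - 1 = -1 by simp, Real.rpow_neg_one]

theorem exists_norm_legendreCoeff_le_const (ν : ℂ) :
    ∃ C > 0, ∀ j : ℕ, ‖legendreCoeff ν j‖ ≤ C := by
  obtain ⟨C, hC, h⟩ := exists_norm_legendreCoeff_le ν
  refine ⟨C, hC, fun j => (h j).trans (mul_le_of_le_one_right hC.le (inv_le_one_of_one_le₀ ?_))⟩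
  have : (0 : ℝ) ≤ j := j.cast_nonneg
  linarith

theorem summable_norm_legendreCoeff_mul_pow (ν : ℂ) {ρ : ℝ} (h0 : 0 ≤ ρ) (h1 : ρ < 1) :
    Summable fun j => ‖legendreCoeff ν j‖ * ρ ^ j := by
  obtain ⟨C, hC, h⟩ := exists_norm_legendreCoeff_le_const ν
  refine Summable.of_nonneg_of_le (fun j => by positivity) (fun j => ?_)
    ((summable_geometric_of_lt_one h0 h1).mul_left C)
  gcongr
  exact h j

theorem summable_norm_legendreSeries (ν : ℂ) {y : ℂ} (hy : ‖y‖ < 1) :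
    Summable fun j => ‖legendreCoeff ν j * y ^ j‖ := by
  simpa using summable_norm_legendreCoeff_mul_pow ν (norm_nonneg y) hy

theorem differentiableOn_tsum_mul_pow {a : ℕ → ℂ} {C : ℝ} (ha : ∀ j, ‖a j‖ ≤ C) :
    DifferentiableOn ℂ (fun y : ℂ => ∑' j : ℕ, a j * y ^ j) (Metric.ball 0 1) := by
  intro y hy
  rw [mem_ball_zero_iff] at hy
  obtain ⟨ρ, h1, h2⟩ := exists_between hy
  have hρ := (norm_nonneg y).trans h1.le
  have hC : 0 ≤ C := (norm_nonneg _).trans (ha 0)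
  refine DifferentiableAt.differentiableWithinAt ?_
  refine DifferentiableOn.differentiableAt (s := Metric.ball 0 ρ) ?_
    (Metric.isOpen_ball.mem_nhds (by simpa using h1))
  refine differentiableOn_tsum_of_summable_norm (u := fun j => C * ρ ^ j)
    ((summable_geometric_of_lt_one hρ h2).mul_left C) (fun j => by fun_prop)
    Metric.isOpen_ball fun j w hw => ?_
  rw [mem_ball_zero_iff] at hw
  rw [norm_mul, norm_pow]
  gcongr
  exact ha j

theorem analyticOnNhd_legendreSeries (ν : ℂ) :
    AnalyticOnNhd ℂ (legendreSeries ν) (Metric.ball 0 1) := by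
  obtain ⟨C, -, h⟩ := exists_norm_legendreCoeff_le_const ν
  exact (differentiableOn_tsum_mul_pow h).analyticOnNhd Metric.isOpen_ball

theorem continuousOn_legendreSeries (ν : ℂ) :
    ContinuousOn (legendreSeries ν) (Metric.ball 0 1) :=
  (analyticOnNhd_legendreSeries ν).continuousOn

theorem linCoeff_eq_zero_of_notMem {p q j : ℕ}
    (h : (p, q) ∉ Finset.range (j + 1) ×ˢ Finset.range (j + 1)) : linCoeff p q j = 0 := by
  simp only [Finset.mem_product, Finset.mem_range, not_and_or, not_lt] at h
  rcases h with h | h <;> simp [linCoeff, Nat.choose_eq_zero_of_lt (Nat.lt_of_succ_le h)]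

/-- The radius `1 / 16` absorbs all three binomials: the total is at most `4^j 8^(-(p + q))`, and `p
+ q ≥ j` wherever the coefficient is nonzero. -/
theorem norm_linCoeff_mul_pow_le {X Y : ℂ} (hX : ‖X‖ ≤ 1 / 16) (hY : ‖Y‖ ≤ 1 / 16) (p q j : ℕ) :
    ‖linCoeff p q j * (X ^ p * Y ^ q)‖ ≤ (1 / 2) ^ j := by
  rcases lt_or_ge (p + q) j with h | h
  · simp [linCoeff, Nat.choose_eq_zero_of_lt h]
  · have b1 : (j.choose p : ℝ) ≤ 2 ^ j := by exact_mod_cast Nat.choose_le_two_pow j p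
    have b2 : (j.choose q : ℝ) ≤ 2 ^ j := by exact_mod_cast Nat.choose_le_two_pow j q
    have b3 : ((p + q).choose j : ℝ) ≤ 2 ^ (p + q) := by
      exact_mod_cast Nat.choose_le_two_pow (p + q) j
    rw [linCoeff]
    simp only [norm_mul, norm_pow, norm_natCast, norm_neg, norm_one, one_pow, one_mul]
    calc _ ≤ (2 : ℝ) ^ j * 2 ^ j * 2 ^ (p + q) * ((1 / 16) ^ p * (1 / 16) ^ q) := by gcongr
      _ = (2 : ℝ) ^ j * 2 ^ j * (1 / 8) ^ (p + q) := by
        rw [← pow_add (1 / 16 : ℝ), mul_assoc _ ((2 : ℝ) ^ (p + q)), ← mul_pow (2 : ℝ) (1 / 16)]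
        norm_num
      _ ≤ (2 : ℝ) ^ j * 2 ^ j * (1 / 8) ^ j := by
        gcongr ?_ * ?_
        exact pow_le_pow_of_le_one (by norm_num) (by norm_num) h
      _ = _ := by rw [← mul_pow, ← mul_pow]; norm_num

/-- Bailey's factorization of an Appell series near the origin. -/
theorem legendreSeries_mul_legendreSeries_of_norm_le (ν : ℂ) {X Y : ℂ} (hX : ‖X‖ ≤ 1 / 16)
    (hY : ‖Y‖ ≤ 1 / 16) :
    legendreSeries ν X * legendreSeries ν Y = ∑' j : ℕ, legendreCoeff ν j *
      centralCoeff j (X + Y - 2 * X * Y) (X * Y * (1 - X) * (1 - Y)) := by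
  obtain ⟨C, hC, hc⟩ := exists_norm_legendreCoeff_le_const ν
  set f : ℕ → ℕ × ℕ → ℂ := fun j pq =>
    legendreCoeff ν j * (linCoeff pq.1 pq.2 j * (X ^ pq.1 * Y ^ pq.2)) with hf
  have hz : ∀ j pq, pq ∉ Finset.range (j + 1) ×ˢ Finset.range (j + 1) → f j pq = 0 := by
    rintro j ⟨p, q⟩ h
    simp [hf, linCoeff_eq_zero_of_notMem h]
  have hb : ∀ j pq, ‖f j pq‖ ≤ C * (1 / 2) ^ j := fun j pq => by
    rw [hf, norm_mul]
    exact mul_le_mul (hc j) (norm_linCoeff_mul_pow_le hX hY _ _ _) (norm_nonneg _) hC.le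
  have hs : Summable (Function.uncurry f) := by
    refine Summable.of_norm ?_
    rw [summable_prod_of_nonneg (fun _ => norm_nonneg _)]
    refine ⟨fun j => summable_of_ne_finset_zero
      (s := Finset.range (j + 1) ×ˢ Finset.range (j + 1)) fun pq h => by
        simp [Function.uncurry, hz j pq h], ?_⟩
    have hg : Summable fun j : ℕ => C * (((j : ℝ) + 1) ^ 2 * (1 / 2) ^ j) := by
      have := (summable_nat_add_iff 1).2
        (summable_pow_mul_geometric_of_norm_lt_one 2 (r := (1 / 2 : ℝ)) (by norm_num))
      refine ((this.mul_left (2 * C))).congr fun j => ?_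
      push_cast
      rw [pow_succ (1 / 2 : ℝ)]
      ring
    refine Summable.of_nonneg_of_le (fun j => tsum_nonneg fun _ => norm_nonneg _) (fun j => ?_) hg
    rw [tsum_eq_sum (s := Finset.range (j + 1) ×ˢ Finset.range (j + 1)) fun pq h => by
      simp [Function.uncurry, hz j pq h]]
    refine (Finset.sum_le_card_nsmul _ _ _ fun pq _ => hb j pq).trans (le_of_eq ?_)
    simp
    ring
  -- Summing over `j` first linearizes back to `c_p c_q`; summing over `(p, q)` first gives the
  -- central coefficient.
  have hcomm := hs.tsum_comm
  have e1 : ∀ pq : ℕ × ℕ, ∑' j, f j pq =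
      (legendreCoeff ν pq.1 * X ^ pq.1) * (legendreCoeff ν pq.2 * Y ^ pq.2) := by
    rintro ⟨p, q⟩
    rw [tsum_eq_sum (s := Finset.range (p + q + 1)) fun j hj => ?_]
    · calc _ = (∑ j ∈ Finset.range (p + q + 1), linCoeff p q j * legendreCoeff ν j) *
            (X ^ p * Y ^ q) := by
            rw [Finset.sum_mul]
            exact Finset.sum_congr rfl fun j _ => by simp only [hf]; ring
        _ = _ := by
            rw [← legendreCoeff_mul ν p q _ le_rfl]
            ring
    · have : p + q < j := by simp at hj; omega
      simp [hf, linCoeff, Nat.choose_eq_zero_of_lt this]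
  have e2 : ∀ j : ℕ, ∑' pq, f j pq = legendreCoeff ν j *
      centralCoeff j (X + Y - 2 * X * Y) (X * Y * (1 - X) * (1 - Y)) := by
    intro j
    rw [tsum_eq_sum (hz j), Finset.sum_product, ← sum_linCoeff_mul_pow, Finset.mul_sum]
    refine Finset.sum_congr rfl fun p _ => ?_
    rw [Finset.mul_sum]
  have h16 : (1 / 16 : ℝ) < 1 := by norm_num
  simp only [e1, e2] at hcomm
  rw [← hcomm, legendreSeries, legendreSeries]
  exact tsum_mul_tsum_of_summable_norm (summable_norm_legendreSeries ν (hX.trans_lt h16))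
    (summable_norm_legendreSeries ν (hY.trans_lt h16))

/-! ### Continuation along a path, and Abel means. -/

/-- The path from `0` to `y` along which `X (1 - Y) = r y²` and `Y (1 - X) = r (1 - y)²`, where
`Y` is the path of `1 - y`. -/
noncomputable def baileyPath (y r : ℝ) : ℝ :=
  (1 + r * (2 * y - 1) - √((1 - r) * (1 - r * (2 * y - 1) ^ 2))) / 2

section path
variable {y r : ℝ}

theorem bailey_radicand_nonneg (hy : y ∈ Set.Icc 0 1) (hr : r ∈ Set.Icc 0 1) :
    (1 - r) ^ 2 ≤ (1 - r) * (1 - r * (2 * y - 1) ^ 2) := by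
  obtain ⟨y0, y1⟩ := hy
  obtain ⟨r0, r1⟩ := hr
  have : (2 * y - 1) ^ 2 ≤ 1 := by nlinarith
  rw [sq (1 - r)]
  exact mul_le_mul_of_nonneg_left (by nlinarith) (by linarith)

theorem baileyPath_nonneg (hy : y ∈ Set.Icc 0 1) (hr : r ∈ Set.Icc 0 1) : 0 ≤ baileyPath y r := by
  have h := bailey_radicand_nonneg hy hr
  obtain ⟨y0, y1⟩ := hy
  obtain ⟨r0, r1⟩ := hr
  have : √((1 - r) * (1 - r * (2 * y - 1) ^ 2)) ≤ 1 + r * (2 * y - 1) := by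
    rw [Real.sqrt_le_left (by nlinarith)]
    nlinarith [mul_nonneg r0 (sq_nonneg y)]
  rw [baileyPath]
  linarith

/-- Brings the path into the disc of radius `1 / 16` for small `r`, where the factorization is
already known. -/
theorem baileyPath_le_left (hy : y ∈ Set.Icc 0 1) (hr : r ∈ Set.Icc 0 1) :
    baileyPath y r ≤ r := by
  have h := Real.le_sqrt_of_sq_le (bailey_radicand_nonneg hy hr)
  rw [baileyPath]
  nlinarith [hy.1, hy.2, hr.1, hr.2]

/-- Gives bounds along the path that depend on `y` only and so survive `r → 1`. -/
theorem baileyPath_le (hy : y ∈ Set.Icc 0 1) (hr : r ∈ Set.Icc 0 1) : baileyPath y r ≤ y := by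
  obtain ⟨y0, y1⟩ := hy
  obtain ⟨r0, r1⟩ := hr
  have : -(2 * y - 1) * (1 - r) ≤ √((1 - r) * (1 - r * (2 * y - 1) ^ 2)) := by
    refine Real.le_sqrt_of_sq_le ?_
    have : (2 * y - 1) ^ 2 ≤ 1 := by nlinarith
    rw [mul_pow, neg_sq]
    nlinarith [mul_nonneg (sub_nonneg.2 r1) (sub_nonneg.2 this)]
  rw [baileyPath]
  linarith

theorem baileyPath_one (y : ℝ) : baileyPath y 1 = y := by
  simp [baileyPath]

theorem continuous_baileyPath (y : ℝ) : Continuous (baileyPath y) := by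
  unfold baileyPath
  fun_prop

theorem analyticAt_baileyPath (hy : y ∈ Set.Icc 0 1) (hr : r ∈ Set.Ioo 0 1) :
    AnalyticAt ℝ (baileyPath y) r := by
  have h := bailey_radicand_nonneg hy ⟨hr.1.le, hr.2.le⟩
  have h1 : 0 < (1 - r) ^ 2 := by have := hr.2; positivity
  have hs : AnalyticAt ℝ Real.sqrt ((1 - r) * (1 - r * (2 * y - 1) ^ 2)) :=
    (Real.contDiffAt_sqrt (h1.trans_le h).ne').analyticAt
  have hp : AnalyticAt ℝ (fun r : ℝ => (1 - r) * (1 - r * (2 * y - 1) ^ 2)) r := by fun_prop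
  have := AnalyticAt.fun_comp (f := fun r : ℝ => (1 - r) * (1 - r * (2 * y - 1) ^ 2)) hs hp
  unfold baileyPath
  exact ((by fun_prop : AnalyticAt ℝ (fun r : ℝ => 1 + r * (2 * y - 1)) r).sub this).div_const

theorem baileyPath_relations (hy : y ∈ Set.Icc 0 1) (hr : r ∈ Set.Icc 0 1) :
    baileyPath y r + baileyPath (1 - y) r - 2 * baileyPath y r * baileyPath (1 - y) r =
      r * (1 - 2 * (y * (1 - y))) ∧
    baileyPath y r * baileyPath (1 - y) r * (1 - baileyPath y r) * (1 - baileyPath (1 - y) r) =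
      r ^ 2 * (y * (1 - y)) ^ 2 := by
  have h := Real.sq_sqrt ((sq_nonneg _).trans (bailey_radicand_nonneg hy hr))
  have e : (2 * (1 - y) - 1) ^ 2 = (2 * y - 1) ^ 2 := by ring
  unfold baileyPath
  rw [e]
  generalize √((1 - r) * (1 - r * (2 * y - 1) ^ 2)) = s at *
  constructor
  · linear_combination (-1 / 2) * h
  · linear_combination (1 / 16 * (s ^ 2 + (1 - r) * (1 - r * (2 * y - 1) ^ 2) +
      2 * (1 - r ^ 2 * (2 * y - 1) ^ 2) - 4)) * h

end path

/-- The average of `(1 - 4 y (1 - y) sin² φ)^j`. -/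
noncomputable def baileyPoly (j : ℕ) (y : ℝ) : ℂ :=
  centralCoeff j (1 - 2 * ((y : ℂ) * (1 - y))) (((y : ℂ) * (1 - y)) ^ 2)

/-- With `e = y (1 - y)` and `b = 1 - 2 e ≥ 0`, the bound `(b + 2 e)^j` is exactly one. -/
theorem norm_baileyPoly_le_one (j : ℕ) {y : ℝ} (hy : y ∈ Set.Icc 0 1) : ‖baileyPoly j y‖ ≤ 1 := by
  have h0 : 0 ≤ y * (1 - y) := mul_nonneg hy.1 (by linarith [hy.2])
  have h1 : 0 ≤ 1 - 2 * (y * (1 - y)) := by nlinarith [sq_nonneg (2 * y - 1)]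
  have h := norm_centralCoeff_le j (β := 1 - 2 * ((y : ℂ) * (1 - y)))
    (η := ((y : ℂ) * (1 - y)) ^ 2) (b := 1 - 2 * (y * (1 - y))) (e := y * (1 - y)) ?_ h0 ?_
  · rwa [sub_add_cancel, one_pow] at h
  · rw [show 1 - 2 * ((y : ℂ) * (1 - y)) = ((1 - 2 * (y * (1 - y)) : ℝ) : ℂ) by push_cast; ring,
      norm_real, Real.norm_of_nonneg h1]
  · rw [show (y : ℂ) * (1 - y) = ((y * (1 - y) : ℝ) : ℂ) by push_cast; ring, norm_pow, norm_real,
      Real.norm_of_nonneg h0]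

/-- The Abel means of the expansion of `P_ν(x) P_ν(-x)`. -/
noncomputable def baileyMean (ν : ℂ) (r y : ℝ) : ℂ :=
  ∑' j : ℕ, legendreCoeff ν j * baileyPoly j y * (r : ℂ) ^ j

/-- Both sides are real-analytic in `r` on `(0, 1)`: the left because the path stays in `[0, y]` and
its radicand is positive, the right as a power series with bounded coefficients. They agree near `r
= 1 / 32`, where the path has values below `1 / 16`. -/
theorem legendreSeries_baileyPath (ν : ℂ) {y r : ℝ} (hy : y ∈ Set.Ioo 0 1)
    (hr : r ∈ Set.Ioo 0 1) :
    legendreSeries ν (baileyPath y r) * legendreSeries ν (baileyPath (1 - y) r) =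
      baileyMean ν r y := by
  have hyc : y ∈ Set.Icc 0 1 := ⟨hy.1.le, hy.2.le⟩
  have hyc' : 1 - y ∈ Set.Icc (0 : ℝ) 1 := ⟨by linarith [hy.2], by linarith [hy.1]⟩
  have an : ∀ {z : ℝ}, z ∈ Set.Ioo (0 : ℝ) 1 →
      AnalyticOnNhd ℝ (fun r : ℝ => legendreSeries ν (baileyPath z r)) (Set.Ioo 0 1) := by
    intro z hz r hr
    have hzc : z ∈ Set.Icc (0 : ℝ) 1 := ⟨hz.1.le, hz.2.le⟩
    have hrc : r ∈ Set.Icc (0 : ℝ) 1 := ⟨hr.1.le, hr.2.le⟩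
    have h1 : AnalyticAt ℂ (legendreSeries ν) (baileyPath z r) := by
      refine analyticOnNhd_legendreSeries ν _ ?_
      rw [mem_ball_zero_iff, norm_real, Real.norm_of_nonneg (baileyPath_nonneg hzc hrc)]
      exact (baileyPath_le hzc hrc).trans_lt hz.2
    have h2 : AnalyticAt ℝ (fun r : ℝ => (baileyPath z r : ℂ)) r :=
      (ofRealCLM.analyticAt _).comp (analyticAt_baileyPath hzc hr)
    exact AnalyticAt.fun_comp (f := fun r : ℝ => (baileyPath z r : ℂ))
      (h1.restrictScalars (𝕜 := ℝ)) h2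
  have hm : AnalyticOnNhd ℝ (fun r : ℝ => baileyMean ν r y) (Set.Ioo 0 1) := by
    intro r hr
    obtain ⟨C, hC, hc⟩ := exists_norm_legendreCoeff_le_const ν
    have hb : ∀ j, ‖legendreCoeff ν j * baileyPoly j y‖ ≤ C := fun j => by
      rw [norm_mul]
      exact (mul_le_mul (hc j) (norm_baileyPoly_le_one j hyc) (norm_nonneg _) hC.le).trans
        (by simp)
    have h1 := (differentiableOn_tsum_mul_pow hb).analyticOnNhd Metric.isOpen_ball (r : ℂ) (by
      rw [mem_ball_zero_iff, norm_real, Real.norm_of_nonneg hr.1.le]; exact hr.2)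
    exact AnalyticAt.fun_comp (f := fun r : ℝ => (r : ℂ)) (h1.restrictScalars (𝕜 := ℝ))
      (ofRealCLM.analyticAt _)
  refine AnalyticOnNhd.eqOn_of_preconnected_of_eventuallyEq ((an hy).mul (an (z := 1 - y)
    ⟨by linarith [hy.2], by linarith [hy.1]⟩)) hm isPreconnected_Ioo (z₀ := 1 / 32)
    (by norm_num) ?_ hr
  filter_upwards [Ioo_mem_nhds (a := (0 : ℝ)) (b := 1 / 16) (x := 1 / 32) (by norm_num)
    (by norm_num)] with r hr
  have hrc : r ∈ Set.Icc (0 : ℝ) 1 := ⟨hr.1.le, by linarith [hr.2]⟩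
  have small : ∀ {z : ℝ}, z ∈ Set.Icc (0 : ℝ) 1 → ‖(baileyPath z r : ℂ)‖ ≤ 1 / 16 := fun hz => by
    rw [norm_real, Real.norm_of_nonneg (baileyPath_nonneg hz hrc)]
    exact (baileyPath_le_left hz hrc).trans hr.2.le
  obtain ⟨r1, r2⟩ := baileyPath_relations hyc hrc
  have r1' := congrArg (fun x : ℝ => (x : ℂ)) r1
  have r2' := congrArg (fun x : ℝ => (x : ℂ)) r2
  push_cast at r1' r2'
  change legendreSeries ν (baileyPath y r) * legendreSeries ν (baileyPath (1 - y) r) = _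
  rw [legendreSeries_mul_legendreSeries_of_norm_le ν (small hyc) (small hyc'), r1', r2', baileyMean]
  refine tsum_congr fun j => ?_
  rw [centralCoeff_smul, baileyPoly]
  ring

/-- The majorant `∑ |c_j| y^j` of the Legendre series. -/
noncomputable def legendreMajorant (ν : ℂ) (y : ℝ) : ℝ := ∑' j : ℕ, ‖legendreCoeff ν j‖ * y ^ j

theorem norm_legendreSeries_le_majorant (ν : ℂ) {x y : ℝ} (hx : 0 ≤ x) (hxy : x ≤ y)
    (hy : y < 1) : ‖legendreSeries ν x‖ ≤ legendreMajorant ν y := by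
  have s1 : Summable fun j => ‖legendreCoeff ν j * (x : ℂ) ^ j‖ :=
    summable_norm_legendreSeries ν (by
      rw [norm_real, Real.norm_of_nonneg hx]; exact hxy.trans_lt hy)
  refine (norm_tsum_le_tsum_norm s1).trans ?_
  refine s1.tsum_le_tsum (fun j => ?_) (summable_norm_legendreCoeff_mul_pow ν (hx.trans hxy) hy)
  rw [norm_mul, norm_pow, norm_real, Real.norm_of_nonneg hx]
  gcongr

/-- The bound comes from the product form and not from the series, whose triangle-inequality
estimate may deteriorate as `r → 1`. -/
theorem norm_baileyMean_le (ν : ℂ) {y r : ℝ} (hy : y ∈ Set.Ioo 0 1) (hr : r ∈ Set.Ioo 0 1) :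
    ‖baileyMean ν r y‖ ≤ legendreMajorant ν y * legendreMajorant ν (1 - y) := by
  have hyc : y ∈ Set.Icc 0 1 := ⟨hy.1.le, hy.2.le⟩
  have hyc' : 1 - y ∈ Set.Icc (0 : ℝ) 1 := ⟨by linarith [hy.2], by linarith [hy.1]⟩
  have hrc : r ∈ Set.Icc (0 : ℝ) 1 := ⟨hr.1.le, hr.2.le⟩
  rw [← legendreSeries_baileyPath ν hy hr, norm_mul]
  have h1 := norm_legendreSeries_le_majorant ν (baileyPath_nonneg hyc hrc)
    (baileyPath_le hyc hrc) hy.2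
  have h2 := norm_legendreSeries_le_majorant ν (baileyPath_nonneg hyc' hrc)
    (baileyPath_le hyc' hrc) (by linarith [hy.1])
  exact mul_le_mul h1 h2 (norm_nonneg _) ((norm_nonneg _).trans h1)

theorem tendsto_baileyMean (ν : ℂ) {y : ℝ} (hy : y ∈ Set.Ioo 0 1) :
    Tendsto (fun r : ℝ => baileyMean ν r y) (𝓝[<] 1)
      (𝓝 (legendreSeries ν y * legendreSeries ν (1 - y : ℝ))) := by
  have lim : ∀ {z : ℝ}, z ∈ Set.Ioo (0 : ℝ) 1 →
      Tendsto (fun r : ℝ => legendreSeries ν (baileyPath z r)) (𝓝[<] 1)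
        (𝓝 (legendreSeries ν z)) := by
    intro z hz
    have h1 : ContinuousAt (legendreSeries ν) z :=
      (continuousOn_legendreSeries ν).continuousAt (Metric.isOpen_ball.mem_nhds (by
        rw [mem_ball_zero_iff, norm_real, Real.norm_of_nonneg hz.1.le]; exact hz.2))
    have h2 : Tendsto (fun r : ℝ => (baileyPath z r : ℂ)) (𝓝[<] 1) (𝓝 (z : ℂ)) := by
      have := (continuous_ofReal.comp (continuous_baileyPath z)).tendsto 1
      simp only [Function.comp_apply, baileyPath_one] at this
      exact this.mono_left nhdsWithin_le_nhds
    exact h1.tendsto.comp h2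
  refine ((lim hy).mul (lim (z := 1 - y) ⟨by linarith [hy.2], by linarith [hy.1]⟩)).congr' ?_
  filter_upwards [Ioo_mem_nhdsLT (a := (0 : ℝ)) (b := 1) one_pos] with r hr
  exact legendreSeries_baileyPath ν hy hr

/-- The coefficients are `O(1 / j)`, so the singularity at `y = 1` is at most logarithmic. -/
theorem exists_legendreMajorant_le (ν : ℂ) {ε : ℝ} (hε : 0 < ε) : ∃ C > 0, ∀ y : ℝ,
    0 ≤ y → y < 1 → legendreMajorant ν y ≤ C * (1 - y) ^ (-ε) := by
  obtain ⟨C, hC, hc⟩ := exists_norm_legendreCoeff_le ν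
  refine ⟨C * (1 + 1 / ε), by positivity, fun y h0 h1 => ?_⟩
  have hlog := Real.hasSum_pow_div_log_of_abs_lt_one (x := y) (by rwa [abs_of_nonneg h0])
  have hs : Summable fun j : ℕ => y ^ j * ((j : ℝ) + 1)⁻¹ :=
    Summable.of_nonneg_of_le (fun j => by positivity) (fun j =>
      mul_le_of_le_one_right (by positivity) (inv_le_one_of_one_le₀ (by
        have : (0 : ℝ) ≤ j := j.cast_nonneg
        linarith))) (summable_geometric_of_lt_one h0 h1)
  have hy : 0 < 1 - y := by linarith
  have b1 : legendreMajorant ν y ≤ C * ∑' j : ℕ, y ^ j * ((j : ℝ) + 1)⁻¹ := by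
    rw [← tsum_mul_left]
    refine (summable_norm_legendreCoeff_mul_pow ν h0 h1).tsum_le_tsum (fun j => ?_)
      (hs.mul_left C)
    calc _ ≤ C * ((j : ℝ) + 1)⁻¹ * y ^ j := by gcongr; exact hc j
      _ = _ := by ring
  have b2 : ∑' j : ℕ, y ^ j * ((j : ℝ) + 1)⁻¹ ≤ 1 + -Real.log (1 - y) := by
    rw [hs.tsum_eq_zero_add, ← hlog.tsum_eq]
    have hs' := (summable_nat_add_iff 1).2 hs
    gcongr ?_ + ?_
    · simp
    · refine hs'.tsum_le_tsum (fun j => ?_) hlog.summable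
      rw [div_eq_mul_inv]
      gcongr
      linarith
  have b3 : -Real.log (1 - y) ≤ (1 - y) ^ (-ε) / ε := by
    rw [← Real.log_inv, Real.rpow_neg hy.le, ← Real.inv_rpow hy.le]
    exact Real.log_le_rpow_div (inv_nonneg.2 hy.le) hε
  have b4 : 1 ≤ (1 - y) ^ (-ε) :=
    Real.one_le_rpow_of_pos_of_le_one_of_nonpos hy (by linarith) (by linarith)
  calc _ ≤ C * (1 + -Real.log (1 - y)) := b1.trans (by gcongr)
    _ ≤ C * ((1 - y) ^ (-ε) + (1 - y) ^ (-ε) / ε) := by gcongr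
    _ = _ := by ring

/-! ### Terminating sums of Chu–Vandermonde type. -/

/-- Chu–Vandermonde; Pascal's rule splits the sum for `n + 1` into sums for `n` at `(b, c)` and `(b
+ 1, c + 1)`, for which `c - b` is the same. -/
theorem sum_choose_mul_risingFactorial_div (n : ℕ) : ∀ (b : ℂ) {c : ℂ}, (∀ i : ℕ, c + i ≠ 0) →
    ∑ t ∈ Finset.range (n + 1),
      (-1) ^ t * n.choose t * (risingFactorial b t / risingFactorial c t) =
      risingFactorial (c - b) n / risingFactorial c n := by
  induction n with
  | zero => intro b c _; simp [risingFactorial_zero]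
  | succ n ih =>
    intro b c hc
    have hc' : ∀ i : ℕ, c + 1 + i ≠ 0 := fun i => by
      have := hc (i + 1); push_cast at this; rwa [add_assoc, add_comm (1 : ℂ)]
    have h0 : c ≠ 0 := by simpa using hc 0
    have key : ∑ t ∈ Finset.range (n + 1 + 1),
        (-1) ^ t * ((n + 1).choose t : ℂ) * (risingFactorial b t / risingFactorial c t) =
        ∑ t ∈ Finset.range (n + 1),
          (-1) ^ t * (n.choose t : ℂ) * (risingFactorial b t / risingFactorial c t) -
        b / c * ∑ t ∈ Finset.range (n + 1), (-1) ^ t * (n.choose t : ℂ) *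
          (risingFactorial (b + 1) t / risingFactorial (c + 1) t) := by
      have e : ∑ t ∈ Finset.range (n + 1),
          (-1) ^ t * (n.choose t : ℂ) * (risingFactorial b t / risingFactorial c t) =
          ∑ t ∈ Finset.range (n + 1 + 1),
          (-1) ^ t * (n.choose t : ℂ) * (risingFactorial b t / risingFactorial c t) := by
        rw [Finset.sum_range_succ _ (n + 1)]; simp
      rw [e, Finset.sum_range_succ', Finset.sum_range_succ' _ (n + 1), Finset.mul_sum,
        add_sub_right_comm, ← Finset.sum_sub_distrib, Nat.choose_zero_right, Nat.choose_zero_right]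
      congr 1
      refine Finset.sum_congr rfl fun t _ => ?_
      rw [Nat.choose_succ_succ, risingFactorial_succ_left, risingFactorial_succ_left]
      push_cast
      rw [mul_div_mul_comm]
      ring
    rw [key, ih b hc, ih (b + 1) hc', add_sub_add_right_eq_sub, risingFactorial_succ,
      risingFactorial_succ]
    have hs : c * risingFactorial (c + 1) n = risingFactorial c n * (c + n) := by
      rw [← risingFactorial_succ_left, risingFactorial_succ]
    have h1 := risingFactorial_ne_zero hc n
    have h2 := risingFactorial_ne_zero hc' n
    have h3 := hc n
    rw [div_mul_div_comm, hs]
    field_simp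
    ring

/-- The product of binomials is `(m + n choose m) (n choose i - m)`, so a shift of the index by `m`
reduces this to Chu–Vandermonde. -/
theorem sum_choose_mul_choose_mul_risingFactorial_div (m n : ℕ) (b : ℂ) {c : ℂ}
    (hc : ∀ i : ℕ, c + i ≠ 0) :
    ∑ i ∈ Finset.range (m + n + 1),
      (-1) ^ i * (m + n).choose i * i.choose m * (risingFactorial b i / risingFactorial c i) =
      (-1) ^ m * (m + n).choose m *
        (risingFactorial b m * risingFactorial (c - b) n / risingFactorial c (m + n)) := by
  rw [add_assoc, Finset.sum_range_add, Finset.sum_eq_zero, zero_add]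
  · have hv := sum_choose_mul_risingFactorial_div n (b + m) (add_nat_add_nat_ne_zero hc m)
    rw [add_sub_add_right_eq_sub] at hv
    rw [risingFactorial_add c, mul_div_mul_comm, ← hv, Finset.mul_sum, Finset.mul_sum]
    refine Finset.sum_congr rfl fun t ht => ?_
    have ht' : t ≤ n := Nat.lt_succ_iff.1 (Finset.mem_range.1 ht)
    have hch := Nat.choose_mul (n := m + n) (k := m + t) (s := m) (by omega)
    rw [show m + n - m = n by omega, show m + t - m = t by omega] at hch
    have hch' : ((m + n).choose (m + t) : ℂ) * (m + t).choose m =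
        (m + n).choose m * n.choose t := by exact_mod_cast hch
    rw [mul_assoc ((-1 : ℂ) ^ (m + t)), hch', risingFactorial_add, risingFactorial_add,
      mul_div_mul_comm, pow_add]
    ring
  · intro i hi
    rw [Nat.choose_eq_zero_of_lt (Finset.mem_range.1 hi)]
    simp

/-- A terminating `₃F₂` as a Cauchy product. -/
theorem sum_choose_mul_risingFactorial_sq {a : ℂ} (ha : ∀ i : ℕ, 2 * a + i ≠ 0) (j : ℕ) :
    risingFactorial (2 * a) j / j.factorial * ∑ i ∈ Finset.range (j + 1),
      (-1) ^ i * j.choose i *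
        (risingFactorial a i ^ 2 / (i.factorial * risingFactorial (2 * a) i)) =
    ∑ p ∈ Finset.HasAntidiagonal.antidiagonal j, gaussTerm (1 - a) a 1 p.1 *
      (risingFactorial a p.2 / p.2.factorial) := by
  -- One factor `(a)_i / i!` is expanded by Chu–Vandermonde with `b = 1 - a`, `c = 1`; after
  -- exchanging the sums, the inner sum over `i` is again summable in closed form.
  have e1 : ∀ i ∈ Finset.range (j + 1), (-1 : ℂ) ^ i * j.choose i *
        (risingFactorial a i ^ 2 / (i.factorial * risingFactorial (2 * a) i)) =
      ∑ m ∈ Finset.range (j + 1), (-1) ^ m * (risingFactorial (1 - a) m / m.factorial) *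
        ((-1) ^ i * j.choose i * i.choose m * (risingFactorial a i / risingFactorial (2 * a) i)) := by
    intro i hi
    have hv := sum_choose_mul_risingFactorial_div i (1 - a) one_add_nat_ne_zero
    rw [sub_sub_cancel, Finset.sum_subset (Finset.range_subset_range.2 (show i + 1 ≤ j + 1 by
      have := Finset.mem_range.1 hi; omega))] at hv
    · simp only [risingFactorial_one] at hv
      rw [sq, mul_div_mul_comm, ← hv, Finset.sum_mul, Finset.mul_sum]
      refine Finset.sum_congr rfl fun m _ => ?_
      ring
    · intro m _ hm
      rw [Nat.choose_eq_zero_of_lt (by simpa using hm)]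
      simp
  rw [Finset.sum_congr rfl e1, Finset.sum_comm, Finset.mul_sum,
    Finset.Nat.sum_antidiagonal_eq_sum_range_succ_mk]
  refine Finset.sum_congr rfl fun m hm => ?_
  obtain ⟨n, rfl⟩ := Nat.exists_eq_add_of_le (Nat.lt_succ_iff.1 (Finset.mem_range.1 hm))
  rw [← Finset.mul_sum, sum_choose_mul_choose_mul_risingFactorial_div m n a ha,
    Nat.cast_add_choose, gaussTerm, risingFactorial_one]
  have h1 := risingFactorial_ne_zero ha (m + n)
  have h2 : ((m + n).factorial : ℂ) ≠ 0 := by exact_mod_cast Nat.factorial_ne_zero _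
  have h3 : (m.factorial : ℂ) ≠ 0 := by exact_mod_cast Nat.factorial_ne_zero _
  have h4 : (n.factorial : ℂ) ≠ 0 := by exact_mod_cast Nat.factorial_ne_zero _
  have h5 : ((-1 : ℂ) ^ m) * (-1) ^ m = 1 := by rw [← mul_pow]; simp
  rw [show 2 * a - a = a by ring, show m + n - m = n by omega]
  field_simp
  linear_combination (risingFactorial (1 - a) m * risingFactorial a m * risingFactorial a n) * h5

/-! ### Beta integrals and moments of the Legendre function. -/

/-- The integrand of the beta integral. -/
noncomputable def betaWeight (u v : ℂ) (y : ℝ) : ℂ := (y : ℂ) ^ (u - 1) * (1 - (y : ℂ)) ^ (v - 1)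

theorem integrableOn_betaWeight {u v : ℂ} (hu : 0 < u.re) (hv : 0 < v.re) :
    MeasureTheory.IntegrableOn (betaWeight u v) (Set.Ioo 0 1) :=
  ((intervalIntegrable_iff_integrableOn_Ioo_of_le zero_le_one).1 (betaIntegral_convergent hu hv))

theorem integral_betaWeight (u v : ℂ) :
    ∫ y in Set.Ioo (0 : ℝ) 1, betaWeight u v y = betaIntegral u v := by
  rw [betaIntegral, intervalIntegral.integral_of_le zero_le_one,
    MeasureTheory.integral_Ioc_eq_integral_Ioo]
  rfl

theorem norm_betaWeight (u v : ℂ) {y : ℝ} (hy : y ∈ Set.Ioo 0 1) :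
    ‖betaWeight u v y‖ = y ^ (u.re - 1) * (1 - y) ^ (v.re - 1) := by
  rw [betaWeight, norm_mul, norm_cpow_eq_rpow_re_of_pos hy.1,
    show (1 : ℂ) - y = ((1 - y : ℝ) : ℂ) by push_cast; rfl,
    norm_cpow_eq_rpow_re_of_pos (by linarith [hy.2])]
  simp

theorem continuousOn_betaWeight (u v : ℂ) : ContinuousOn (betaWeight u v) (Set.Ioo 0 1) := by
  refine ContinuousOn.mul (fun y hy => ?_) fun y hy => ?_
  · refine ContinuousAt.continuousWithinAt ?_
    exact (continuousAt_cpow_const (ofReal_mem_slitPlane.2 hy.1)).comp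
      (f := fun y : ℝ => (y : ℂ)) continuous_ofReal.continuousAt
  · refine ContinuousAt.continuousWithinAt ?_
    refine ContinuousAt.comp (f := fun y : ℝ => 1 - (y : ℂ)) (continuousAt_cpow_const ?_)
      (by fun_prop)
    rw [show (1 : ℂ) - y = ((1 - y : ℝ) : ℂ) by push_cast; rfl]
    exact ofReal_mem_slitPlane.2 (by linarith [hy.2])

theorem integral_norm_betaWeight (u v : ℂ) :
    ((∫ y in Set.Ioo (0 : ℝ) 1, ‖betaWeight u v y‖ : ℝ) : ℂ) = betaIntegral u.re v.re := by
  rw [← integral_betaWeight, ← integral_complex_ofReal]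
  refine MeasureTheory.setIntegral_congr_fun measurableSet_Ioo fun y hy => ?_
  rw [norm_betaWeight _ _ hy, betaWeight, ofReal_mul, ofReal_cpow hy.1.le,
    ofReal_cpow (by linarith [hy.2])]
  push_cast
  rfl

theorem mul_betaWeight (u v : ℂ) (m n : ℕ) {y : ℝ} (hy : y ∈ Set.Ioo 0 1) :
    (y : ℂ) ^ m * (1 - y) ^ n * betaWeight u v y = betaWeight (u + m) (v + n) y := by
  have h0 : (y : ℂ) ≠ 0 := ofReal_ne_zero.2 hy.1.ne'
  have h1 : (1 : ℂ) - y ≠ 0 := by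
    rw [show (1 : ℂ) - y = ((1 - y : ℝ) : ℂ) by push_cast; rfl]
    exact ofReal_ne_zero.2 (by linarith [hy.2])
  rw [betaWeight, betaWeight, show u + m - 1 = m + (u - 1) by ring,
    show v + n - 1 = n + (v - 1) by ring, cpow_add _ _ h0, cpow_add _ _ h1, cpow_natCast,
    cpow_natCast]
  ring

theorem integrableOn_of_norm_le_betaWeight {f : ℝ → ℂ} (hf : ContinuousOn f (Set.Ioo 0 1)) {C : ℝ}
    {p q : ℝ} (hp : 0 < p) (hq : 0 < q)
    (h : ∀ y ∈ Set.Ioo (0 : ℝ) 1, ‖f y‖ ≤ C * (y ^ (p - 1) * (1 - y) ^ (q - 1))) :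
    MeasureTheory.IntegrableOn f (Set.Ioo 0 1) := by
  refine MeasureTheory.Integrable.mono'
    ((integrableOn_betaWeight (u := p) (v := q) (by simpa) (by simpa)).norm.const_mul C)
    (hf.aestronglyMeasurable measurableSet_Ioo) ?_
  filter_upwards [MeasureTheory.ae_restrict_mem measurableSet_Ioo] with y hy
  rw [norm_betaWeight _ _ hy]
  simpa using h y hy

theorem two_mul_add_nat_ne_zero {s : ℂ} (hs : 0 < s.re) (i : ℕ) : 2 * s + i ≠ 0 :=
  add_nat_ne_zero_of_re_pos (by simpa using hs) i

theorem betaIntegral_add_nat {s : ℂ} (hs : 0 < s.re) (k : ℕ) :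
    betaIntegral (s + k) s =
      Gamma s ^ 2 / Gamma (2 * s) * (risingFactorial s k / risingFactorial (2 * s) k) := by
  rw [betaIntegral_eq_Gamma_mul_div _ _ (by simp; positivity) hs,
    Gamma_add_nat (add_nat_ne_zero_of_re_pos hs),
    show s + k + s = 2 * s + k by ring, Gamma_add_nat (two_mul_add_nat_ne_zero hs)]
  have := risingFactorial_ne_zero (two_mul_add_nat_ne_zero hs) k
  have := Gamma_ne_zero_of_add_nat (two_mul_add_nat_ne_zero hs)
  field_simp

/-- The moments of the Legendre function. -/
noncomputable def legendreMoment (ν s : ℂ) : ℂ :=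
  ∫ y in Set.Ioo (0 : ℝ) 1, legendreSeries ν y * betaWeight s s y

/-- The terms of the series of a moment. -/
noncomputable def momentTerm (ν s : ℂ) (k : ℕ) : ℂ :=
  legendreCoeff ν k * (risingFactorial s k / risingFactorial (2 * s) k)

theorem exists_norm_momentTerm_le (ν : ℂ) {s : ℂ} (hs : 0 < s.re) :
    ∃ C > 0, ∀ k : ℕ, ‖momentTerm ν s k‖ ≤ C * ((k : ℝ) + 1) ^ (-1 - s.re) := by
  obtain ⟨C₁, h₁, hb₁⟩ := exists_norm_legendreCoeff_le ν
  obtain ⟨C₂, h₂, hb₂⟩ := exists_norm_risingFactorial_div_le s (two_mul_add_nat_ne_zero hs)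
  refine ⟨C₁ * C₂, mul_pos h₁ h₂, fun k => ?_⟩
  have hk : (0 : ℝ) < (k : ℝ) + 1 := by positivity
  rw [momentTerm, norm_mul]
  refine (mul_le_mul (hb₁ _) (hb₂ _) (norm_nonneg _) (by positivity)).trans (le_of_eq ?_)
  rw [show -1 - s.re = -1 + (s.re - (2 * s).re) by simp; ring, Real.rpow_add hk,
    Real.rpow_neg_one]
  ring

theorem summable_momentTerm (ν : ℂ) {s : ℂ} (hs : 0 < s.re) : Summable (momentTerm ν s) := by
  obtain ⟨C, -, h⟩ := exists_norm_momentTerm_le ν hs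
  exact (summable_norm_of_le_rpow (by linarith) h).of_norm

theorem legendreMoment_eq_tsum (ν : ℂ) {s : ℂ} (hs : 0 < s.re) :
    legendreMoment ν s = Gamma s ^ 2 / Gamma (2 * s) * ∑' k, momentTerm ν s k := by
  have hsr : 0 < (s.re : ℂ).re := by simpa
  have hk : ∀ k : ℕ, 0 < (s + k).re := fun k => by simp; positivity
  have hw : ∀ k : ℕ, ∀ y ∈ Set.Ioo (0 : ℝ) 1,
      legendreCoeff ν k * (y : ℂ) ^ k * betaWeight s s y =
        legendreCoeff ν k * betaWeight (s + k) s y := fun k y hy => by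
    have := mul_betaWeight s s k 0 hy
    simp only [pow_zero, mul_one, Nat.cast_zero, add_zero] at this
    rw [mul_assoc, this]
  have hi : ∀ k : ℕ, MeasureTheory.Integrable
      (fun y : ℝ => legendreCoeff ν k * (y : ℂ) ^ k * betaWeight s s y)
      (MeasureTheory.volume.restrict (Set.Ioo 0 1)) := fun k => by
    refine MeasureTheory.IntegrableOn.congr_fun
      ((integrableOn_betaWeight (hk k) hs).const_mul (legendreCoeff ν k)) (fun y hy => ?_)
      measurableSet_Ioo
    exact (hw k y hy).symm
  -- The integrals of the norms are the norms of the same terms at the real parameter `Re s`, so the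
  -- bound on `momentTerm` also justifies the interchange.
  have hn : ∀ k : ℕ, ∫ y in Set.Ioo (0 : ℝ) 1,
      ‖legendreCoeff ν k * (y : ℂ) ^ k * betaWeight s s y‖ =
      ‖Gamma (s.re : ℂ) ^ 2 / Gamma (2 * (s.re : ℂ)) * (legendreCoeff ν k *
        (risingFactorial s.re k / risingFactorial (2 * (s.re : ℂ)) k))‖ := fun k => by
    have e : ∫ y in Set.Ioo (0 : ℝ) 1, ‖legendreCoeff ν k * (y : ℂ) ^ k * betaWeight s s y‖ =
        ‖legendreCoeff ν k‖ * ∫ y in Set.Ioo (0 : ℝ) 1, ‖betaWeight (s + k) s y‖ := by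
      rw [← MeasureTheory.integral_const_mul]
      refine MeasureTheory.setIntegral_congr_fun measurableSet_Ioo fun y hy => ?_
      rw [hw k y hy, norm_mul]
    have e2 := integral_norm_betaWeight (s + k) s
    rw [show (((s + k).re : ℝ) : ℂ) = (s.re : ℂ) + k by simp, betaIntegral_add_nat hsr] at e2
    rw [e, ← Real.norm_of_nonneg (MeasureTheory.integral_nonneg (f := fun y => ‖betaWeight (s + k) s y‖)
      fun y => norm_nonneg _), ← norm_real, e2, ← norm_mul]
    congr 1
    ring
  have hS := MeasureTheory.hasSum_integral_of_summable_integral_norm hi (by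
    obtain ⟨C, -, h⟩ := exists_norm_momentTerm_le ν hsr
    have := (summable_norm_of_le_rpow (by simpa using hs) h).mul_left
      ‖Gamma (s.re : ℂ) ^ 2 / Gamma (2 * (s.re : ℂ))‖
    exact this.congr fun k => by rw [← norm_mul]; exact (hn k).symm)
  rw [legendreMoment]
  have e3 : ∀ y : ℝ, ∑' k : ℕ, legendreCoeff ν k * (y : ℂ) ^ k * betaWeight s s y =
      legendreSeries ν y * betaWeight s s y := fun y => by rw [tsum_mul_right]; rfl
  simp only [e3] at hS
  rw [← hS.tsum_eq, ← tsum_mul_left]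
  refine tsum_congr fun k => ?_
  rw [MeasureTheory.setIntegral_congr_fun measurableSet_Ioo (hw k),
    MeasureTheory.integral_const_mul, integral_betaWeight, betaIntegral_add_nat hs, momentTerm]
  ring

theorem tsum_momentTerm_contiguous (ν : ℂ) {s : ℂ} (hs : 0 < s.re) :
    2 * s * (2 * s + 1) * ∑' k, momentTerm ν s k =
      (2 * s - ν) * (2 * s + ν + 1) * ∑' k, momentTerm ν (s + 1) k := by
  have hs1 : 0 < (s + 1).re := by simp; linarith
  -- The telescoping certificate; the factor `k²` matches `(j + 1)²` in the recurrence of the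
  -- Legendre coefficients and makes `R 0 = 0`.
  set R : ℕ → ℂ := fun k => -2 * (2 * s + 1) * k ^ 2 / (2 * s + k) * momentTerm ν s k with hR
  have hstep : ∀ k, 2 * s * (2 * s + 1) * momentTerm ν s k -
      (2 * s - ν) * (2 * s + ν + 1) * momentTerm ν (s + 1) k = R (k + 1) - R k := by
    intro k
    have hc := legendreCoeff_succ ν k
    have s0 : s ≠ 0 := by simpa using add_nat_ne_zero_of_re_pos hs 0
    have h0 := two_mul_add_nat_ne_zero hs k
    have h1 := two_mul_add_nat_ne_zero hs (k + 1)
    have h1' := two_mul_add_nat_ne_zero hs 1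
    push_cast at h1 h1'
    have hf := risingFactorial_ne_zero (two_mul_add_nat_ne_zero hs) k
    have hk : (k : ℂ) + 1 ≠ 0 := Nat.cast_add_one_ne_zero k
    have m1 : momentTerm ν (s + 1) k = momentTerm ν s k *
        (2 * (2 * s + 1) * (s + k) / ((2 * s + k) * (2 * s + k + 1))) := by
      have e1 : risingFactorial (s + 1) k = risingFactorial s k * (s + k) / s := by
        rw [eq_div_iff s0, mul_comm, ← risingFactorial_succ_left, risingFactorial_succ]
      have e2 : risingFactorial (2 * (s + 1)) k = risingFactorial (2 * s) k * (2 * s + k) *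
          (2 * s + k + 1) / (2 * s * (2 * s + 1)) := by
        rw [eq_div_iff (by simp [s0, h1']), show 2 * (s + 1) = 2 * s + 1 + 1 by ring]
        have a1 := risingFactorial_succ_left (2 * s) (k + 1)
        rw [risingFactorial_succ_left (2 * s + 1), risingFactorial_succ (2 * s),
          risingFactorial_succ (2 * s)] at a1
        push_cast at a1
        linear_combination -a1
      rw [momentTerm, momentTerm, e1, e2]
      have := add_nat_ne_zero_of_re_pos hs k
      have h1'' : 2 * s + k + 1 ≠ 0 := by rwa [add_assoc]
      field_simp
    have m2 : R (k + 1) = -2 * (2 * s + 1) * ((k * (k + 1) - ν * (ν + 1)) * (s + k)) /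
        ((2 * s + k) * (2 * s + k + 1)) * momentTerm ν s k := by
      have h1'' : 2 * s + k + 1 ≠ 0 := by rwa [add_assoc]
      have e : legendreCoeff ν (k + 1) =
          (k * (k + 1) - ν * (ν + 1)) * legendreCoeff ν k / ((k : ℂ) + 1) ^ 2 := by
        rw [eq_div_iff (by positivity), mul_comm, hc]
      simp only [hR]
      rw [momentTerm, momentTerm, risingFactorial_succ, risingFactorial_succ, e]
      push_cast
      rw [← add_assoc]
      field_simp
    rw [m2, m1]
    simp only [hR]
    have h1'' : 2 * s + k + 1 ≠ 0 := by rwa [add_assoc]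
    field_simp
    ring
  have hR0 : Tendsto R atTop (𝓝 0) := by
    obtain ⟨C, hC, h⟩ := exists_norm_momentTerm_le ν hs
    refine tendsto_zero_of_norm_le_rpow (p := -s.re) (C := ‖-2 * (2 * s + 1)‖ * C) (by linarith)
      fun k => ?_
    have hk : (0 : ℝ) < (k : ℝ) + 1 := by positivity
    have hq : ‖(k : ℂ) / (2 * s + k)‖ ≤ 1 := by
      rw [norm_div, Complex.norm_natCast]
      refine div_le_one_of_le₀ ?_ (norm_nonneg _)
      refine le_trans ?_ (re_le_norm _)
      simp
      linarith
    have e : R k = -2 * (2 * s + 1) * ((k : ℂ) / (2 * s + k)) * (k * momentTerm ν s k) := by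
      simp only [hR]; ring
    rw [e, norm_mul, norm_mul]
    calc _ ≤ ‖-2 * (2 * s + 1)‖ * 1 * (((k : ℝ) + 1) * (C * ((k : ℝ) + 1) ^ (-1 - s.re))) := by
          gcongr
          rw [norm_mul, Complex.norm_natCast]
          gcongr
          · linarith
          · exact h k
      _ = _ := by
          rw [show -s.re = 1 + (-1 - s.re) by ring, Real.rpow_add hk 1, Real.rpow_one]
          ring
  have hsum := ((summable_momentTerm ν hs).mul_left (2 * s * (2 * s + 1))).sub
    ((summable_momentTerm ν hs1).mul_left ((2 * s - ν) * (2 * s + ν + 1)))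
  have := tsum_eq_of_telescoping hsum hstep hR0
  rw [((summable_momentTerm ν hs).mul_left _).tsum_sub ((summable_momentTerm ν hs1).mul_left _),
    tsum_mul_left, tsum_mul_left] at this
  simp only [hR] at this
  simpa [sub_eq_zero] using this

theorem legendreMoment_add_one (ν : ℂ) {s : ℂ} (hs : 0 < s.re) (h1 : 2 * s - ν ≠ 0)
    (h2 : 2 * s + ν + 1 ≠ 0) :
    (2 * s - ν) * (2 * s + ν + 1) * legendreMoment ν (s + 1) = s ^ 2 * legendreMoment ν s := by
  have hs1 : 0 < (s + 1).re := by simp; linarith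
  have h0 : s ≠ 0 := by simpa using add_nat_ne_zero_of_re_pos hs 0
  have h3 := two_mul_add_nat_ne_zero hs 1
  push_cast at h3
  have c := tsum_momentTerm_contiguous ν hs
  have hG := Gamma_ne_zero_of_add_nat (two_mul_add_nat_ne_zero hs)
  rw [legendreMoment_eq_tsum ν hs, legendreMoment_eq_tsum ν hs1, Gamma_add_one s h0,
    show 2 * (s + 1) = 2 * s + 1 + 1 by ring, Gamma_add_one _ h3,
    Gamma_add_one _ (mul_ne_zero two_ne_zero h0)]
  have e : ∑' k, momentTerm ν s k = (2 * s - ν) * (2 * s + ν + 1) *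
      ∑' k, momentTerm ν (s + 1) k / (2 * s * (2 * s + 1)) := by
    rw [tsum_div_const, eq_comm, ← mul_div_assoc, ← c, mul_div_assoc, mul_comm]
    field_simp
  rw [e, tsum_div_const]
  field_simp

/-- For `ν = 2 a - 1` the factor `(ν + 1)_k = (2 a)_k` cancels the denominator of the moment terms,
and a Gauss series remains. -/
theorem legendreMoment_self {a : ℂ} (ha : 0 < a.re) :
    legendreMoment (2 * a - 1) a =
      Gamma a ^ 2 / Gamma (2 * a) * (Gamma a / (Gamma (2 * a) * Gamma (1 - a))) := by
  rw [legendreMoment_eq_tsum _ ha]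
  have e : ∀ k, momentTerm (2 * a - 1) a k = gaussTerm (1 - 2 * a) a 1 k := fun k => by
    have := risingFactorial_ne_zero (two_mul_add_nat_ne_zero ha) k
    rw [momentTerm, legendreCoeff, gaussTerm, gaussTerm, neg_sub, sub_add_cancel]
    field_simp
  simp only [e]
  rw [tsum_gaussTerm one_add_nat_ne_zero (by simp; linarith)]
  rw [show 1 - (1 - 2 * a) - a = a by ring, show 1 - (1 - 2 * a) = 2 * a by ring, Gamma_one,
    one_mul]

/-- At `s = a + i` the recurrence has the factors `2 i + 1` and `2 (2 a + i)`. The central binomial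
from the Bailey polynomials removes the first, leaving a hypergeometric term. -/
theorem choose_mul_legendreMoment {a : ℂ} (ha : 0 < a.re) (i : ℕ) :
    (2 * i).choose i * legendreMoment (2 * a - 1) (a + i) = legendreMoment (2 * a - 1) a *
      (risingFactorial a i ^ 2 / (i.factorial * risingFactorial (2 * a) i)) := by
  induction i with
  | zero => simp [risingFactorial_zero]
  | succ i ih =>
    have hi : 0 < (a + i).re := by simp; positivity
    have e1 : 2 * (a + i) - (2 * a - 1) = 2 * i + 1 := by ring
    have e2 : 2 * (a + i) + (2 * a - 1) + 1 = 2 * (2 * a + i) := by ring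
    have h1 : (2 * i + 1 : ℂ) ≠ 0 := by exact_mod_cast Nat.succ_ne_zero (2 * i)
    have h2 := two_mul_add_nat_ne_zero ha i
    have hf := risingFactorial_ne_zero (two_mul_add_nat_ne_zero ha) i
    have hfac : (i.factorial : ℂ) ≠ 0 := by exact_mod_cast i.factorial_ne_zero
    have hk : (i : ℂ) + 1 ≠ 0 := Nat.cast_add_one_ne_zero i
    have hrec := legendreMoment_add_one (2 * a - 1) hi (by rwa [e1]) (by rw [e2]; simpa using h2)
    rw [e1, e2] at hrec
    have hc : ((i : ℂ) + 1) * (2 * (i + 1)).choose (i + 1) =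
        2 * (2 * i + 1) * (2 * i).choose i := by
      exact_mod_cast Nat.succ_mul_centralBinom_succ i
    push_cast
    rw [← add_assoc, risingFactorial_succ, risingFactorial_succ, Nat.factorial_succ]
    push_cast
    have t : ((i : ℂ) + 1) * (2 * a + i) * ((2 * (i + 1)).choose (i + 1) *
        legendreMoment (2 * a - 1) (a + i + 1)) = (a + i) ^ 2 *
        ((2 * i).choose i * legendreMoment (2 * a - 1) (a + i)) := by
      linear_combination (2 * a + i) * legendreMoment (2 * a - 1) (a + i + 1) * hc +
        (2 * i).choose i * hrec
    rw [ih] at t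
    rw [← mul_right_inj' (mul_ne_zero hk h2), t]
    generalize 2 * a = b at *
    field_simp

theorem continuousOn_ofReal_legendreSeries (ν : ℂ) :
    ContinuousOn (fun y : ℝ => legendreSeries ν y) (Set.Ioo 0 1) :=
  (continuousOn_legendreSeries ν).comp continuous_ofReal.continuousOn fun y hy => by
    rw [mem_ball_zero_iff, norm_real, Real.norm_of_nonneg hy.1.le]; exact hy.2

theorem integrableOn_legendreSeries_mul_betaWeight (ν : ℂ) {s : ℂ} (hs : 0 < s.re) :
    MeasureTheory.IntegrableOn (fun y : ℝ => legendreSeries ν y * betaWeight s s y)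
      (Set.Ioo 0 1) := by
  obtain ⟨C, hC, h⟩ := exists_legendreMajorant_le ν (half_pos hs)
  refine integrableOn_of_norm_le_betaWeight (C := C) (p := s.re) (q := s.re / 2)
    ((continuousOn_ofReal_legendreSeries ν).mul (continuousOn_betaWeight s s)) hs (half_pos hs)
    fun y hy => ?_
  have h1 : (0 : ℝ) < 1 - y := by linarith [hy.2]
  rw [norm_mul, norm_betaWeight _ _ hy]
  calc _ ≤ C * (1 - y) ^ (-(s.re / 2)) * (y ^ (s.re - 1) * (1 - y) ^ (s.re - 1)) := by
        have h0 := Real.rpow_nonneg hy.1.le (s.re - 1)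
        have h0' := Real.rpow_nonneg h1.le (s.re - 1)
        gcongr
        exact (norm_legendreSeries_le_majorant ν hy.1.le le_rfl hy.2).trans (h y hy.1.le hy.2)
    _ = _ := by
        rw [show s.re / 2 - 1 = -(s.re / 2) + (s.re - 1) by ring, Real.rpow_add h1]
        ring

/-! ### Integrals of Bailey polynomials and the double series. -/

theorem baileyPoly_eq_sum (j : ℕ) (y : ℝ) :
    baileyPoly j y = ∑ i ∈ Finset.range (j + 1),
      (-1) ^ i * j.choose i * (2 * i).choose i * ((y : ℂ) ^ i * (1 - y) ^ i) := by
  rw [baileyPoly, centralCoeff_eq_sum_choose]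
  refine Finset.sum_congr rfl fun i _ => ?_
  rw [neg_pow, mul_pow]
  ring

theorem continuous_baileyPoly (j : ℕ) : Continuous (baileyPoly j) := by
  have : baileyPoly j = fun y : ℝ => ∑ i ∈ Finset.range (j + 1),
      (-1) ^ i * j.choose i * (2 * i).choose i * ((y : ℂ) ^ i * (1 - y) ^ i) :=
    funext (baileyPoly_eq_sum j)
  rw [this]
  fun_prop

/-- The integrals of `P_ν` against the weighted Bailey polynomials. -/
noncomputable def baileyMoment (a : ℂ) (j : ℕ) : ℂ :=
  ∫ y in Set.Ioo (0 : ℝ) 1, legendreSeries (2 * a - 1) y * betaWeight a a y * baileyPoly j y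

theorem baileyMoment_eq {a : ℂ} (ha : 0 < a.re) (j : ℕ) :
    baileyMoment a j = legendreMoment (2 * a - 1) a * ∑ i ∈ Finset.range (j + 1),
      (-1) ^ i * j.choose i *
        (risingFactorial a i ^ 2 / (i.factorial * risingFactorial (2 * a) i)) := by
  have hi : ∀ i : ℕ, 0 < (a + i).re := fun i => by simp; positivity
  have e : ∀ y ∈ Set.Ioo (0 : ℝ) 1,
      legendreSeries (2 * a - 1) y * betaWeight a a y * baileyPoly j y =
      ∑ i ∈ Finset.range (j + 1), (-1) ^ i * j.choose i * (2 * i).choose i *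
        (legendreSeries (2 * a - 1) y * betaWeight (a + i) (a + i) y) := fun y hy => by
    rw [baileyPoly_eq_sum, Finset.mul_sum]
    refine Finset.sum_congr rfl fun i _ => ?_
    rw [← mul_betaWeight a a i i hy]
    ring
  rw [baileyMoment, MeasureTheory.setIntegral_congr_fun measurableSet_Ioo e,
    MeasureTheory.integral_finsetSum _ fun i _ =>
      (integrableOn_legendreSeries_mul_betaWeight _ (hi i)).const_mul _, Finset.mul_sum]
  refine Finset.sum_congr rfl fun i _ => ?_
  rw [MeasureTheory.integral_const_mul]
  have := choose_mul_legendreMoment ha i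
  rw [legendreMoment] at this
  linear_combination ((-1) ^ i * (j.choose i : ℂ)) * this

theorem legendreCoeff_mul_baileyMoment {a : ℂ} (ha : 0 < a.re) (j : ℕ) :
    legendreCoeff (2 * a - 1) j * baileyMoment a j = legendreMoment (2 * a - 1) a *
      ∑ p ∈ Finset.HasAntidiagonal.antidiagonal j,
        risingFactorial (1 - 2 * a) (p.1 + p.2) / (p.1 + p.2).factorial *
          (gaussTerm (1 - a) a 1 p.1 * (risingFactorial a p.2 / p.2.factorial)) := by
  have e : ∑ p ∈ Finset.HasAntidiagonal.antidiagonal j,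
        risingFactorial (1 - 2 * a) (p.1 + p.2) / (p.1 + p.2).factorial *
          (gaussTerm (1 - a) a 1 p.1 * (risingFactorial a p.2 / p.2.factorial)) =
      risingFactorial (1 - 2 * a) j / j.factorial *
        ∑ p ∈ Finset.HasAntidiagonal.antidiagonal j,
          gaussTerm (1 - a) a 1 p.1 * (risingFactorial a p.2 / p.2.factorial) := by
    rw [Finset.mul_sum]
    refine Finset.sum_congr rfl fun p hp => ?_
    rw [Finset.HasAntidiagonal.mem_antidiagonal.1 hp]
  rw [e, ← sum_choose_mul_risingFactorial_sq (two_mul_add_nat_ne_zero ha), baileyMoment_eq ha,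
    legendreCoeff, gaussTerm, risingFactorial_one, neg_sub, sub_add_cancel]
  ring

/-- The double series for the triple product. -/
noncomputable def doubleTerm (a : ℂ) (p : ℕ × ℕ) : ℂ :=
  risingFactorial (1 - 2 * a) (p.1 + p.2) / (p.1 + p.2).factorial *
    (gaussTerm (1 - a) a 1 p.1 * (risingFactorial a p.2 / p.2.factorial))

theorem rpow_neg_mul_le_of_le {x y z α β : ℝ} (hx : 0 < x) (hy : 0 < y) (hxz : x ≤ z) (hyz : y ≤ z)
    (hα : 0 ≤ α) (hβ : 0 ≤ β) : z ^ (-(α + β)) ≤ x ^ (-α) * y ^ (-β) := by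
  have hz := hx.trans_le hxz
  rw [neg_add, Real.rpow_add hz]
  exact mul_le_mul (Real.rpow_le_rpow_of_nonpos hx hxz (by linarith))
    (Real.rpow_le_rpow_of_nonpos hy hyz (by linarith)) (by positivity) (by positivity)

/-- The factor in `i + l` decays like `(i + l + 1)^(-2 Re a)`. Giving `Re a / 2` of this exponent to
`i` and `3 Re a / 2` to `l` leaves both indices with exponent `-1 - Re a / 2`. -/
theorem summable_doubleTerm {a : ℂ} (ha : 0 < a.re) : Summable (doubleTerm a) := by
  obtain ⟨C₁, h₁, hb₁⟩ := exists_norm_risingFactorial_div_factorial_le (1 - 2 * a)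
  obtain ⟨C₂, h₂, hb₂⟩ := exists_norm_gaussTerm_le (1 - a) a one_add_nat_ne_zero
  obtain ⟨C₃, h₃, hb₃⟩ := exists_norm_risingFactorial_div_factorial_le a
  have hp : -1 - a.re / 2 < -1 := by linarith
  have hs := summable_rpow_nat_add_one hp
  refine Summable.of_norm_bounded (g := fun p : ℕ × ℕ => C₁ * (C₂ * C₃) *
    (((p.1 : ℝ) + 1) ^ (-1 - a.re / 2) * ((p.2 : ℝ) + 1) ^ (-1 - a.re / 2)))
    ((hs.mul_of_nonneg hs (fun k => by positivity) fun k => by positivity).mul_left _) ?_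
  rintro ⟨i, l⟩
  have hi : (0 : ℝ) < (i : ℝ) + 1 := by positivity
  have hl : (0 : ℝ) < (l : ℝ) + 1 := by positivity
  have b1 := hb₁ (i + l)
  have b2 := hb₂ i
  have b3 := hb₃ l
  have e1 : (1 - 2 * a).re - 1 = -(a.re / 2 + 3 * a.re / 2) := by simp; ring
  have e2 : (1 - a).re + a.re - (1 : ℂ).re - 1 = -1 := by simp
  rw [e1] at b1
  rw [e2] at b2
  have b1' := b1.trans (mul_le_mul_of_nonneg_left (rpow_neg_mul_le_of_le hi hl
    (z := ((i + l : ℕ) : ℝ) + 1) (by push_cast; linarith [(Nat.cast_nonneg l : (0 : ℝ) ≤ l)])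
    (by push_cast; linarith [(Nat.cast_nonneg i : (0 : ℝ) ≤ i)]) (by linarith : 0 ≤ a.re / 2)
    (by linarith : 0 ≤ 3 * a.re / 2)) h₁.le)
  simp only [doubleTerm, norm_mul]
  refine (mul_le_mul b1' (mul_le_mul b2 b3 (norm_nonneg _) (by positivity))
    (by positivity) (by positivity)).trans (le_of_eq ?_)
  rw [show -1 - a.re / 2 = -(a.re / 2) + -1 by ring, Real.rpow_add hi]
  rw [show -(a.re / 2) + -1 = -(3 * a.re / 2) + (a.re - 1) by ring, Real.rpow_add hl]
  ring

/-- Each row is a Gauss series. Its value contains `1 / Γ(1 - a + i)`, which combines with `(1 -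
a)_i` to a constant even when `1 - a` is a pole, so the row sums form a Gauss series with the same
value. -/
theorem tsum_doubleTerm {a : ℂ} (ha : 0 < a.re) :
    ∑' p, doubleTerm a p = (Gamma a / (Gamma (2 * a) * Gamma (1 - a))) ^ 2 := by
  have row : ∀ i : ℕ, ∑' l, doubleTerm a (i, l) =
      Gamma a / (Gamma (2 * a) * Gamma (1 - a)) * gaussTerm (1 - 2 * a) a 1 i := by
    intro i
    have hi : ∀ l : ℕ, 1 + (i : ℂ) + l ≠ 0 := add_nat_add_nat_ne_zero one_add_nat_ne_zero i
    have e : ∀ l, doubleTerm a (i, l) = risingFactorial (1 - 2 * a) i / i.factorial *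
        gaussTerm (1 - a) a 1 i * gaussTerm (1 - 2 * a + i) a (1 + i) l := fun l => by
      have e1 := risingFactorial_add 1 i l
      rw [risingFactorial_one, risingFactorial_one] at e1
      simp only [doubleTerm, gaussTerm]
      rw [e1, risingFactorial_add]
      have := risingFactorial_ne_zero hi l
      have h4 : (l.factorial : ℂ) ≠ 0 := by exact_mod_cast Nat.factorial_ne_zero _
      have h5 : (i.factorial : ℂ) ≠ 0 := by exact_mod_cast Nat.factorial_ne_zero _
      field_simp
    simp only [e]
    rw [tsum_mul_left, tsum_gaussTerm hi (by simp; linarith),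
      show 1 + (i : ℂ) - (1 - 2 * a + i) - a = a by ring,
      show 1 + (i : ℂ) - (1 - 2 * a + i) = 2 * a by ring,
      show 1 + (i : ℂ) - a = 1 - a + i by ring, Gamma_add_nat one_add_nat_ne_zero, Gamma_one]
    have h := risingFactorial_div_Gamma_add_nat (1 - a) i
    simp only [gaussTerm, risingFactorial_one, mul_one]
    have h5 : (i.factorial : ℂ) ≠ 0 := by exact_mod_cast Nat.factorial_ne_zero _
    calc _ = risingFactorial (1 - 2 * a) i / i.factorial * (risingFactorial a i / i.factorial) *
          (Gamma a / Gamma (2 * a)) * (risingFactorial (1 - a) i / Gamma (1 - a + i)) := by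
          field_simp
      _ = _ := by rw [h]; field_simp
  rw [(summable_doubleTerm ha).tsum_prod]
  simp only [row]
  rw [tsum_mul_left, tsum_gaussTerm one_add_nat_ne_zero (by simp; linarith),
    show 1 - (1 - 2 * a) - a = a by ring, show 1 - (1 - 2 * a) = 2 * a by ring, Gamma_one, one_mul]
  ring

theorem hasSum_legendreCoeff_mul_baileyMoment {a : ℂ} (ha : 0 < a.re) :
    HasSum (fun j => legendreCoeff (2 * a - 1) j * baileyMoment a j)
      (legendreMoment (2 * a - 1) a * (Gamma a / (Gamma (2 * a) * Gamma (1 - a))) ^ 2) := by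
  have h := (summable_doubleTerm ha).hasSum
  rw [tsum_doubleTerm ha, ← Finset.HasAntidiagonal.sigmaAntidiagonalEquivProd.hasSum_iff] at h
  refine ((h.sigma fun n => hasSum_fintype _).mul_left (legendreMoment (2 * a - 1) a)).congr_fun
    fun j => ?_
  rw [legendreCoeff_mul_baileyMoment ha, ← Finset.sum_coe_sort]
  rfl

/-! ### The triple product integral. -/

theorem continuousOn_baileyMean (ν : ℂ) {r : ℝ} (hr : r ∈ Set.Ioo 0 1) :
    ContinuousOn (baileyMean ν r) (Set.Ioo 0 1) := by
  refine continuousOn_tsum (u := fun j => ‖legendreCoeff ν j‖ * r ^ j) (fun j => ?_)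
    (summable_norm_legendreCoeff_mul_pow ν hr.1.le hr.2) fun j y hy => ?_
  · have := (continuous_baileyPoly j).continuousOn (s := Set.Ioo (0 : ℝ) 1)
    fun_prop
  · rw [norm_mul, norm_mul, norm_pow, norm_real, Real.norm_of_nonneg hr.1.le]
    have := norm_baileyPoly_le_one j (y := y) ⟨hy.1.le, hy.2.le⟩
    have h0 := pow_nonneg hr.1.le j
    gcongr
    exact mul_le_of_le_one_right (norm_nonneg _) this

/-- For `r < 1` the factors `c_j r^j` are absolutely summable and the Bailey polynomials are at most
one, so sum and integral may be exchanged; at `r = 1` this argument is not available. -/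
theorem integral_mul_baileyMean {a : ℂ} (ha : 0 < a.re) {r : ℝ} (hr : r ∈ Set.Ioo 0 1) :
    ∫ y in Set.Ioo (0 : ℝ) 1, legendreSeries (2 * a - 1) y * betaWeight a a y *
        baileyMean (2 * a - 1) r y =
      ∑' j, legendreCoeff (2 * a - 1) j * baileyMoment a j * (r : ℂ) ^ j := by
  set ν := 2 * a - 1 with hν
  have hI := integrableOn_legendreSeries_mul_betaWeight ν ha
  set f : ℕ → ℝ → ℂ := fun j y => legendreSeries ν y * betaWeight a a y * baileyPoly j y *
    (legendreCoeff ν j * (r : ℂ) ^ j) with hf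
  have hb : ∀ j, ∀ y ∈ Set.Ioo (0 : ℝ) 1,
      ‖f j y‖ ≤ ‖legendreSeries ν y * betaWeight a a y‖ * (‖legendreCoeff ν j‖ * r ^ j) :=
    fun j y hy => by
      have := norm_baileyPoly_le_one j (y := y) ⟨hy.1.le, hy.2.le⟩
      simp only [hf]
      rw [norm_mul, norm_mul _ (baileyPoly j y), norm_mul (legendreCoeff ν j), norm_pow,
        norm_real, Real.norm_of_nonneg hr.1.le]
      have h0 := pow_nonneg hr.1.le j
      gcongr
      exact mul_le_of_le_one_right (norm_nonneg _) this
  have hi : ∀ j, MeasureTheory.Integrable (f j)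
      (MeasureTheory.volume.restrict (Set.Ioo 0 1)) := fun j => by
    refine MeasureTheory.Integrable.mono' (hI.norm.mul_const (‖legendreCoeff ν j‖ * r ^ j)) ?_ ?_
    · refine ContinuousOn.aestronglyMeasurable ?_ measurableSet_Ioo
      exact (((continuousOn_ofReal_legendreSeries ν).mul (continuousOn_betaWeight a a)).mul
        (continuous_baileyPoly j).continuousOn).mul continuousOn_const
    · filter_upwards [MeasureTheory.ae_restrict_mem measurableSet_Ioo] with y hy
      exact hb j y hy
  have hS := MeasureTheory.hasSum_integral_of_summable_integral_norm hi (by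
    refine Summable.of_nonneg_of_le (fun j => MeasureTheory.integral_nonneg fun y => norm_nonneg _)
      (fun j => ?_) ((summable_norm_legendreCoeff_mul_pow ν hr.1.le hr.2).mul_left
        (∫ y in Set.Ioo (0 : ℝ) 1, ‖legendreSeries ν y * betaWeight a a y‖))
    rw [← MeasureTheory.integral_mul_const]
    exact MeasureTheory.setIntegral_mono_on (hi j).norm (hI.norm.mul_const _) measurableSet_Ioo
      (hb j))
  have e : ∀ y, ∑' j, f j y = legendreSeries ν y * betaWeight a a y * baileyMean ν r y :=
    fun y => by
      rw [baileyMean, ← tsum_mul_left]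
      refine tsum_congr fun j => ?_
      simp only [hf]
      ring
  simp only [e] at hS
  rw [← hS.tsum_eq]
  refine tsum_congr fun j => ?_
  simp only [hf]
  rw [MeasureTheory.integral_mul_const, baileyMoment]
  ring

/-- Each Legendre factor costs an exponent `Re a / 4`: two of them at `y = 1`, one at `y = 0`. Both
resulting beta exponents remain positive. -/
theorem exists_norm_mul_legendreMajorant_le (ν : ℂ) {a : ℂ} (ha : 0 < a.re) :
    ∃ C : ℝ, ∀ y ∈ Set.Ioo (0 : ℝ) 1,
      ‖legendreSeries ν y * betaWeight a a y‖ * (legendreMajorant ν y * legendreMajorant ν (1 - y)) ≤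
        C * (y ^ (3 * a.re / 4 - 1) * (1 - y) ^ (a.re / 2 - 1)) := by
  have hε : 0 < a.re / 4 := by linarith
  obtain ⟨C, hC, h⟩ := exists_legendreMajorant_le ν hε
  refine ⟨C ^ 3, fun y hy => ?_⟩
  have h0 := hy.1
  have h1 : (0 : ℝ) < 1 - y := by linarith [hy.2]
  have b1 := h y h0.le hy.2
  have b2 := h (1 - y) h1.le (by linarith)
  rw [sub_sub_cancel] at b2
  have b3 := (norm_legendreSeries_le_majorant ν h0.le le_rfl hy.2).trans b1
  have pos : ∀ z : ℝ, 0 ≤ z → 0 ≤ legendreMajorant ν z := fun z hz =>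
    tsum_nonneg fun j => by positivity
  rw [norm_mul, norm_betaWeight _ _ hy]
  have p1 := pos y h0.le
  have p2 := pos (1 - y) h1.le
  calc _ ≤ C * (1 - y) ^ (-(a.re / 4)) * (y ^ (a.re - 1) * (1 - y) ^ (a.re - 1)) *
        ((C * (1 - y) ^ (-(a.re / 4))) * (C * y ^ (-(a.re / 4)))) := by
        have := Real.rpow_nonneg h0.le (a.re - 1)
        have := Real.rpow_nonneg h1.le (a.re - 1)
        gcongr
    _ = _ := by
        rw [show 3 * a.re / 4 - 1 = -(a.re / 4) + (a.re - 1) by ring, Real.rpow_add h0,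
          show a.re / 2 - 1 = -(a.re / 4) + (-(a.re / 4) + (a.re - 1)) by ring,
          Real.rpow_add h1, Real.rpow_add h1]
        ring

theorem continuousOn_tripleProduct (ν a : ℂ) : ContinuousOn (fun y : ℝ =>
    legendreSeries ν y * betaWeight a a y * (legendreSeries ν y * legendreSeries ν (1 - y : ℝ)))
    (Set.Ioo 0 1) := by
  have h1 : ContinuousOn (fun y : ℝ => legendreSeries ν (1 - y : ℝ)) (Set.Ioo 0 1) :=
    (continuousOn_ofReal_legendreSeries ν).comp (f := fun y : ℝ => 1 - y) (by fun_prop)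
      fun y hy => ⟨by linarith [hy.2], by linarith [hy.1]⟩
  exact ((continuousOn_ofReal_legendreSeries ν).mul (continuousOn_betaWeight a a)).mul
    ((continuousOn_ofReal_legendreSeries ν).mul h1)

theorem integrableOn_tripleProduct (ν : ℂ) {a : ℂ} (ha : 0 < a.re) :
    MeasureTheory.IntegrableOn (fun y : ℝ => legendreSeries ν y * betaWeight a a y *
      (legendreSeries ν y * legendreSeries ν (1 - y : ℝ))) (Set.Ioo 0 1) := by
  obtain ⟨C, h⟩ := exists_norm_mul_legendreMajorant_le ν ha
  refine integrableOn_of_norm_le_betaWeight (continuousOn_tripleProduct ν a) (C := C)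
    (p := 3 * a.re / 4) (q := a.re / 2) (by linarith) (by linarith) fun y hy =>
    le_trans ?_ (h y hy)
  have h1 := norm_legendreSeries_le_majorant ν hy.1.le le_rfl hy.2
  have h2 := norm_legendreSeries_le_majorant ν (x := 1 - y) (by linarith [hy.2]) le_rfl
    (by linarith [hy.1])
  rw [norm_mul, norm_mul (legendreSeries ν y) (legendreSeries ν _)]
  gcongr
  exact (norm_nonneg _).trans h1

/-- Let `r → 1` from below in the formula for Abel means: dominated convergence acts on the
integrals, Abel's limit theorem on the series. -/
theorem integral_tripleProduct {a : ℂ} (ha : 0 < a.re) :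
    ∫ y in Set.Ioo (0 : ℝ) 1, legendreSeries (2 * a - 1) y * betaWeight a a y *
      (legendreSeries (2 * a - 1) y * legendreSeries (2 * a - 1) (1 - y : ℝ)) =
    legendreMoment (2 * a - 1) a * (Gamma a / (Gamma (2 * a) * Gamma (1 - a))) ^ 2 := by
  obtain ⟨C, h⟩ := exists_norm_mul_legendreMajorant_le (2 * a - 1) ha
  have hr : ∀ᶠ r : ℝ in 𝓝[<] 1, r ∈ Set.Ioo (0 : ℝ) 1 := Ioo_mem_nhdsLT one_pos
  have lim := MeasureTheory.tendsto_integral_filter_of_dominated_convergence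
    (μ := MeasureTheory.volume.restrict (Set.Ioo 0 1)) (l := 𝓝[<] (1 : ℝ))
    (F := fun (r y : ℝ) => legendreSeries (2 * a - 1) y * betaWeight a a y *
      baileyMean (2 * a - 1) r y)
    (f := fun y : ℝ => legendreSeries (2 * a - 1) y * betaWeight a a y *
      (legendreSeries (2 * a - 1) y * legendreSeries (2 * a - 1) (1 - y : ℝ)))
    (fun y => C * ‖betaWeight (3 * a.re / 4 : ℝ) (a.re / 2 : ℝ) y‖) ?_ ?_ ?_ ?_
  · have abel := Complex.tendsto_tsum_powerSeries_nhdsWithin_lt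
      (hasSum_legendreCoeff_mul_baileyMoment ha).tendsto_sum_nat
    rw [tendsto_map'_iff] at abel
    refine tendsto_nhds_unique lim (abel.congr' ?_)
    filter_upwards [hr] with r hr
    exact (integral_mul_baileyMean ha hr).symm
  · filter_upwards [hr] with r hr
    exact (((continuousOn_ofReal_legendreSeries _).mul (continuousOn_betaWeight a a)).mul
      (continuousOn_baileyMean _ hr)).aestronglyMeasurable measurableSet_Ioo
  · filter_upwards [hr] with r hr
    filter_upwards [MeasureTheory.ae_restrict_mem measurableSet_Ioo] with y hy
    rw [norm_betaWeight _ _ hy, norm_mul]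
    refine le_trans ?_ (h y hy)
    gcongr
    exact norm_baileyMean_le _ hy hr
  · exact (integrableOn_betaWeight (by simpa using by linarith) (by simpa using ha)).norm.const_mul C
  · filter_upwards [MeasureTheory.ae_restrict_mem measurableSet_Ioo] with y hy
    exact (tendsto_baileyMean _ hy).const_mul _

/-! ### Return to the variable `x` and the closed form. -/

theorem legendreP_eq_legendreSeries (ν : ℂ) (x : ℝ) :
    legendreP ν x = legendreSeries ν ((1 - x) / 2 : ℝ) := by
  rw [legendreP, ordinaryHypergeometric_eq_tsum, legendreSeries]
  refine tsum_congr fun j => ?_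
  rw [legendreCoeff, gaussTerm, smul_eq_mul]
  simp only [risingFactorial]
  ring

theorem tildeTIntegrand_one_sub_two_mul {a : ℂ} {y : ℝ} (hy : y ∈ Set.Ioo 0 1) :
    tildeTIntegrand (2 * a - 1) (1 - 2 * y) = (4 : ℂ) ^ (a - 1) *
      (legendreSeries (2 * a - 1) y * betaWeight a a y *
      (legendreSeries (2 * a - 1) y * legendreSeries (2 * a - 1) (1 - y : ℝ))) := by
  have h1 : 0 < 1 - y := by linarith [hy.2]
  have e : (((1 - (1 - 2 * y) ^ 2 : ℝ) : ℝ) : ℂ) ^ ((2 * a - 1 - 1) / 2) =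
      (4 : ℂ) ^ (a - 1) * betaWeight a a y := by
    rw [show 1 - (1 - 2 * y) ^ 2 = 4 * (y * (1 - y)) by ring,
      show (2 * a - 1 - 1) / 2 = a - 1 by ring, ofReal_mul,
      mul_cpow_ofReal_nonneg (by norm_num) (mul_nonneg hy.1.le h1.le), ofReal_mul,
      mul_cpow_ofReal_nonneg hy.1.le h1.le, betaWeight]
    push_cast
    rfl
  rw [tildeTIntegrand, e, legendreP_eq_legendreSeries, legendreP_eq_legendreSeries,
    show (1 - (1 - 2 * y)) / 2 = y by ring, show (1 - -(1 - 2 * y)) / 2 = 1 - y by ring]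
  ring

theorem intervalIntegrable_tildeTIntegrand {a : ℂ} (ha : 0 < a.re) :
    IntervalIntegrable (tildeTIntegrand (2 * a - 1)) MeasureTheory.volume (-1) 1 := by
  have h : IntervalIntegrable (fun y : ℝ => tildeTIntegrand (2 * a - 1) (1 - 2 * y))
      MeasureTheory.volume 0 1 := by
    rw [intervalIntegrable_iff_integrableOn_Ioo_of_le zero_le_one]
    refine MeasureTheory.IntegrableOn.congr_fun
      ((integrableOn_tripleProduct (2 * a - 1) ha).const_mul ((4 : ℂ) ^ (a - 1)))
      (fun y hy => ?_) measurableSet_Ioo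
    exact (tildeTIntegrand_one_sub_two_mul hy).symm
  have h2 := (h.comp_mul_left (c := 1 / 2)).comp_sub_left 1
  refine IntervalIntegrable.symm ?_
  convert h2 using 1
  · ext x
    congr 1
    ring
  · norm_num
  · norm_num

theorem tildeT_eq_Gamma {a : ℂ} (ha : 0 < a.re) :
    tildeT (2 * a - 1) = 2 * (4 : ℂ) ^ (a - 1) * (Gamma a ^ 2 / Gamma (2 * a) *
      (Gamma a / (Gamma (2 * a) * Gamma (1 - a))) ^ 3) := by
  have h := intervalIntegral.integral_comp_sub_mul (a := 0) (b := 1)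
    (tildeTIntegrand (2 * a - 1)) (two_ne_zero (α := ℝ)) 1
  rw [show (1 : ℝ) - 2 * 1 = -1 by norm_num, mul_zero, sub_zero] at h
  have e : tildeT (2 * a - 1) =
      2 * ∫ y in (0 : ℝ)..1, tildeTIntegrand (2 * a - 1) (1 - 2 * y) := by
    rw [h, tildeT, real_smul]
    push_cast
    ring
  rw [e, intervalIntegral.integral_of_le zero_le_one, MeasureTheory.integral_Ioc_eq_integral_Ioo,
    MeasureTheory.setIntegral_congr_fun measurableSet_Ioo
      (fun y hy => tildeTIntegrand_one_sub_two_mul hy),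
    MeasureTheory.integral_const_mul, integral_tripleProduct ha, legendreMoment_self ha]
  ring

theorem pi_ne_zero' : (Real.pi : ℂ) ≠ 0 := ofReal_ne_zero.2 Real.pi_ne_zero

theorem half_re_pos {ν : ℂ} (hν : -1 < ν.re) : 0 < ((1 + ν) / 2).re := by
  simp; linarith

theorem Gamma_one_add_sq (ν : ℂ) : Gamma (1 + ν) ^ 2 * Real.pi =
    (Gamma ((1 + ν) / 2) * Gamma ((2 + ν) / 2) * (2 : ℂ) ^ ν) ^ 2 := by
  have h := Gamma_mul_Gamma_add_half ((1 + ν) / 2)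
  rw [show (1 + ν) / 2 + 1 / 2 = (2 + ν) / 2 by ring, show 2 * ((1 + ν) / 2) = 1 + ν by ring,
    show 1 - (1 + ν) = -ν by ring, cpow_neg] at h
  have q : ((√Real.pi : ℝ) : ℂ) ^ 2 = Real.pi := by
    rw [← ofReal_pow, Real.sq_sqrt Real.pi_pos.le]
  have t : (2 : ℂ) ^ ν ≠ 0 := by simp
  rw [h, ← q]
  field_simp

theorem inv_Gamma_half {ν : ℂ} (hν : -1 < ν.re) :
    (Gamma ((1 - ν) / 2))⁻¹ = Gamma ((1 + ν) / 2) * cos (ν * Real.pi / 2) / Real.pi := by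
  have h := inv_Gamma_one_sub (add_nat_ne_zero_of_re_pos (half_re_pos hν))
  rw [show 1 - (1 + ν) / 2 = (1 - ν) / 2 by ring,
    show Real.pi * ((1 + ν) / 2) = ν * Real.pi / 2 + Real.pi / 2 by ring, sin_add_pi_div_two] at h
  exact h

theorem Gamma_ne_zero_of_neg_one_lt_re {ν : ℂ} (hν : -1 < ν.re) :
    Gamma ((1 + ν) / 2) ≠ 0 ∧ Gamma ((2 + ν) / 2) ≠ 0 ∧ Gamma (1 + ν) ≠ 0 :=
  ⟨Gamma_ne_zero_of_re_pos (half_re_pos hν), Gamma_ne_zero_of_re_pos (by simp; linarith),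
    Gamma_ne_zero_of_re_pos (by simp; linarith)⟩

/-- The closed form of the triple product integral. -/
noncomputable def tripleValue (ν : ℂ) : ℂ :=
  1 / Real.pi * (cos (ν * Real.pi / 2) / (2 : ℂ) ^ ν) ^ 3 *
    (Gamma ((1 + ν) / 2) / Gamma ((2 + ν) / 2)) ^ 4

/-- Reflection turns `Γ((1 - ν) / 2)⁻¹` into a cosine, cubed as it occurs three times; duplication
removes `Γ(1 + ν)⁴`. -/
theorem tildeT_eq_tripleValue {ν : ℂ} (hν : -1 < ν.re) : tildeT ν = tripleValue ν := by
  have h := tildeT_eq_Gamma (half_re_pos hν)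
  have e4 : 2 * (4 : ℂ) ^ ((1 + ν) / 2 - 1) = (2 : ℂ) ^ ν := by
    rw [show (4 : ℂ) = (2 : ℝ) * (2 : ℝ) by norm_num,
      mul_cpow_ofReal_nonneg (by norm_num) (by norm_num)]
    push_cast
    rw [← cpow_add _ _ two_ne_zero,
      show (1 + ν) / 2 - 1 + ((1 + ν) / 2 - 1) = ν - 1 by ring, cpow_sub _ _ two_ne_zero, cpow_one]
    field_simp
  rw [e4, show 2 * ((1 + ν) / 2) = 1 + ν by ring, show 1 + ν - 1 = ν by ring,
    show 1 - (1 + ν) / 2 = (1 - ν) / 2 by ring] at h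
  have i := inv_Gamma_half hν
  obtain ⟨g1, g2, g3⟩ := Gamma_ne_zero_of_neg_one_lt_re hν
  have d := Gamma_one_add_sq ν
  have t : (2 : ℂ) ^ ν ≠ 0 := by simp
  have hp := pi_ne_zero'
  have hd : Gamma (1 + ν) ^ 2 =
      (Gamma ((1 + ν) / 2) * Gamma ((2 + ν) / 2) * (2 : ℂ) ^ ν) ^ 2 / Real.pi := by
    rw [← d]; field_simp
  have hd4 : Gamma (1 + ν) ^ 4 =
      ((Gamma ((1 + ν) / 2) * Gamma ((2 + ν) / 2) * (2 : ℂ) ^ ν) ^ 2 / Real.pi) ^ 2 := by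
    rw [← hd]; ring
  rw [h, tripleValue]
  calc _ = (2 : ℂ) ^ ν * Gamma ((1 + ν) / 2) ^ 5 * (Gamma ((1 - ν) / 2))⁻¹ ^ 3 /
        Gamma (1 + ν) ^ 4 := by field_simp
    _ = _ := by
      rw [i, hd4]
      field_simp

theorem continuousAt_tripleValue {ν : ℂ} (hν : -1 < ν.re) : ContinuousAt tripleValue ν := by
  have h1 : ContinuousAt (fun μ : ℂ => Gamma ((1 + μ) / 2)) ν :=
    ContinuousAt.comp (f := fun μ : ℂ => (1 + μ) / 2)
      (continuousAt_Gamma_of_add_nat (add_nat_ne_zero_of_re_pos (half_re_pos hν))) (by fun_prop)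
  have h2 : ContinuousAt (fun μ : ℂ => Gamma ((2 + μ) / 2)) ν :=
    ContinuousAt.comp (f := fun μ : ℂ => (2 + μ) / 2)
      (continuousAt_Gamma_of_add_nat (add_nat_ne_zero_of_re_pos (by simp; linarith)))
      (by fun_prop)
  have h3 : ContinuousAt (fun μ : ℂ => (2 : ℂ) ^ μ) ν := continuousAt_const_cpow two_ne_zero
  have g2 := (Gamma_ne_zero_of_neg_one_lt_re hν).2.1
  have h4 : ContinuousAt (fun μ : ℂ => cos (μ * Real.pi / 2)) ν := by fun_prop
  exact (continuousAt_const.mul ((h4.div h3 (by simp)).pow 3)).mul ((h1.div h2 g2).pow 4)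

/-! ### The digamma series and its limits at integer degree. -/

theorem Gamma_neg_mul_sin {ν : ℂ} (h : sin (ν * Real.pi) ≠ 0) :
    Gamma (-ν) * Gamma (1 + ν) * sin (ν * Real.pi) = -Real.pi := by
  have := Gamma_mul_Gamma_one_sub (-ν)
  rw [sub_neg_eq_add, show Real.pi * -ν = -(ν * Real.pi) by ring, sin_neg] at this
  rw [this, div_neg, neg_mul, div_mul_cancel₀ _ h]

/-- The confluent theorem with `α = β = (1 + ν) / 2` and `γ = -ν`. Here `α + β + γ = 1`, which
produces the cube of `k!` and the coefficient `3` of `ψ(k + 1)`; the condition `Re (β + γ) < 1` is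
`Re ν > -1`. -/
theorem hasSum_digammaSeriesTerm {ν : ℂ} (hν : -1 < ν.re) (h : ∀ n : ℕ, ν ≠ n) :
    HasSum (digammaSeriesTerm ν) (-(Gamma ((1 + ν) / 2) ^ 2 * Gamma (-ν) *
      (Gamma ((1 - ν) / 2))⁻¹ ^ 2 / Gamma (1 + ν))) := by
  have ha := add_nat_ne_zero_of_re_pos (half_re_pos hν)
  have hn : ∀ i : ℕ, -ν + i ≠ 0 := fun i e => h i (by linear_combination -e)
  have e1 : (1 + ν) / 2 + (1 + ν) / 2 + -ν = 1 := by ring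
  have hs := hasSum_digamma_saal ha ha hn (by rw [e1]; exact one_add_nat_ne_zero)
    (by simp; linarith)
  rw [e1] at hs
  have g1 := Gamma_ne_zero_of_add_nat ha
  have g2 := Gamma_ne_zero_of_add_nat hn
  have e2 : -(Gamma ((1 + ν) / 2) ^ 2 * Gamma (-ν) *
      (Gamma ((1 - ν) / 2))⁻¹ ^ 2 / Gamma (1 + ν)) = (Gamma ((1 + ν) / 2) ^ 2 * Gamma (-ν))⁻¹ *
      -(Gamma ((1 + ν) / 2) ^ 2 * Gamma ((1 + ν) / 2) ^ 2 * Gamma (-ν) ^ 2 /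
        (Gamma ((1 + ν) / 2 + (1 + ν) / 2) * Gamma ((1 + ν) / 2 + -ν) *
          Gamma ((1 + ν) / 2 + -ν))) := by
    rw [show (1 + ν) / 2 + (1 + ν) / 2 = 1 + ν by ring,
      show (1 + ν) / 2 + -ν = (1 - ν) / 2 by ring]
    field_simp
  rw [e2]
  refine (hs.mul_left (Gamma ((1 + ν) / 2) ^ 2 * Gamma (-ν))⁻¹).congr_fun fun k => ?_
  have h1 : Gamma (1 + (k : ℂ)) = k.factorial := by rw [add_comm, Gamma_nat_eq_factorial]
  have fac : (k.factorial : ℂ) ≠ 0 := by exact_mod_cast k.factorial_ne_zero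
  rw [Gamma_add_nat ha, Gamma_add_nat hn, h1, digammaSeriesTerm,
    show (k : ℂ) + (ν + 1) / 2 = (1 + ν) / 2 + k by ring, show (k : ℂ) - ν = -ν + k by ring,
    add_comm (k : ℂ) 1]
  field_simp
  ring

theorem tripleValue_eq_digammaSeries {ν : ℂ} (hν : -1 < ν.re) (h : ∀ n : ℕ, ν ≠ n) :
    tripleValue ν = digammaSeriesPrefactor ν * ∑' k, digammaSeriesTerm ν k := by
  have hs : sin (ν * Real.pi) ≠ 0 := by
    rw [Complex.sin_ne_zero_iff]
    intro k e
    have e' : ν = k := mul_right_cancel₀ pi_ne_zero' e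
    have hk : -1 < k := by
      rw [e', intCast_re] at hν
      exact_mod_cast hν
    obtain ⟨n, rfl⟩ := Int.eq_ofNat_of_zero_le (by omega : 0 ≤ k)
    exact h n (by simpa using e')
  obtain ⟨g1, g2, g3⟩ := Gamma_ne_zero_of_neg_one_lt_re hν
  have d := Gamma_one_add_sq ν
  have t : (2 : ℂ) ^ ν ≠ 0 := by simp
  have hp := pi_ne_zero'
  have hG : Gamma (-ν) * sin (ν * Real.pi) = -Real.pi / Gamma (1 + ν) := by
    rw [← Gamma_neg_mul_sin hs]; field_simp
  have hd : Gamma (1 + ν) ^ 2 =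
      (Gamma ((1 + ν) / 2) * Gamma ((2 + ν) / 2) * (2 : ℂ) ^ ν) ^ 2 / Real.pi := by
    rw [← d]; field_simp
  rw [(hasSum_digammaSeriesTerm hν h).tsum_eq, inv_Gamma_half hν, digammaSeriesPrefactor,
    tripleValue]
  symm
  calc _ = -(Gamma (-ν) * sin (ν * Real.pi)) * cos (ν * Real.pi / 2) ^ 3 *
        Gamma ((1 + ν) / 2) ^ 6 /
        ((2 : ℂ) ^ ν * Real.pi ^ 3 * Gamma ((2 + ν) / 2) ^ 2 * Gamma (1 + ν)) := by
        field_simp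
    _ = cos (ν * Real.pi / 2) ^ 3 * Gamma ((1 + ν) / 2) ^ 6 /
        ((2 : ℂ) ^ ν * Real.pi ^ 2 * Gamma ((2 + ν) / 2) ^ 2 * Gamma (1 + ν) ^ 2) := by
        rw [hG]; field_simp
    _ = _ := by
        rw [hd]; field_simp

/-- In a punctured neighbourhood of `n` no natural number occurs, so the expression equals the
closed form there, and that is continuous at `n`. -/
theorem tendsto_digammaSeries {ν : ℂ} (hν : -1 < ν.re) {n : ℕ} (h : ν = n) :
    Tendsto (fun μ : ℂ => digammaSeriesPrefactor μ * ∑' k : ℕ, digammaSeriesTerm μ k)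
      (𝓝[≠] ν) (𝓝 (tripleValue ν)) := by
  refine ((continuousAt_tripleValue hν).tendsto.mono_left nhdsWithin_le_nhds).congr' ?_
  have h1 : ∀ᶠ μ : ℂ in 𝓝[≠] ν, -1 < μ.re :=
    nhdsWithin_le_nhds ((isOpen_lt continuous_const continuous_re).mem_nhds hν)
  filter_upwards [h1, nhdsWithin_le_nhds (Metric.ball_mem_nhds ν one_pos), self_mem_nhdsWithin]
    with μ hμ hb hne
  refine tripleValue_eq_digammaSeries hμ fun m e => hne ?_
  have hd : dist m n < 1 := by
    rw [Metric.mem_ball, e, h, dist_eq_norm] at hb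
    rw [← Nat.dist_cast_real, Real.dist_eq]
    have : ((m : ℂ) - n) = (((m : ℝ) - n : ℝ) : ℂ) := by push_cast; rfl
    rwa [this, norm_real, Real.norm_eq_abs] at hb
  have : m = n := by
    by_contra hmn
    exact absurd (Nat.pairwise_one_le_dist hmn) (not_le.2 hd)
  rw [Set.mem_singleton_iff, e, h, this]

/-- Obtained by differentiating `Γ(z) Γ(1 - z) sin(πz) = π`. The multiplied form isolates the finite
part at a pole of `ψ`. -/
theorem sin_mul_digamma_reflection {z : ℂ} (h1 : ∀ i : ℕ, z + i ≠ 0) (h2 : ∀ i : ℕ, 1 - z + i ≠ 0)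
    (hs : sin (Real.pi * z) ≠ 0) :
    sin (Real.pi * z) * digamma z =
      sin (Real.pi * z) * digamma (1 - z) - Real.pi * cos (Real.pi * z) := by
  have d1 := hasDerivAt_Gamma_digamma h1
  have d2 := HasDerivAt.comp z (h₂ := Gamma) (h := fun w => 1 - w)
    (hasDerivAt_Gamma_digamma h2) ((hasDerivAt_id z).const_sub 1)
  have d3 : HasDerivAt (fun w : ℂ => sin (Real.pi * w)) (cos (Real.pi * z) * (Real.pi * 1)) z :=
    ((hasDerivAt_id z).const_mul (Real.pi : ℂ)).csin
  have d4 := (d1.mul d2).mul d3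
  have hc : (Gamma * (Gamma ∘ fun w => 1 - w)) * (fun w : ℂ => sin (Real.pi * w)) =ᶠ[𝓝 z]
      fun _ => (Real.pi : ℂ) := by
    have : ∀ᶠ w in 𝓝 z, sin (Real.pi * w) ≠ 0 :=
      (by fun_prop : ContinuousAt (fun w : ℂ => sin (Real.pi * w)) z).eventually_ne hs
    filter_upwards [this] with w hw
    simp only [Pi.mul_apply, Function.comp_apply]
    rw [Gamma_mul_Gamma_one_sub, div_mul_cancel₀ _ hw]
  have e := d4.unique ((hasDerivAt_const z (Real.pi : ℂ)).congr_of_eventuallyEq hc)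
  have g1 := Gamma_ne_zero_of_add_nat h1
  have g2 := Gamma_ne_zero_of_add_nat h2
  simp only [Pi.mul_apply, Function.comp_apply] at e
  rw [← mul_right_inj' (mul_ne_zero g1 g2)]
  linear_combination e

theorem continuousAt_digamma {z : ℂ} (hz : 0 < z.re) : ContinuousAt digamma z := by
  have ho : IsOpen {w : ℂ | 0 < w.re} := isOpen_lt continuous_const continuous_re
  have hd : DifferentiableOn ℂ Gamma {w : ℂ | 0 < w.re} := fun w hw =>
    (hasDerivAt_Gamma_digamma (add_nat_ne_zero_of_re_pos hw)).differentiableAt.differentiableWithinAt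
  have h1 : ContinuousAt (deriv Gamma) z :=
    ((hd.deriv ho).differentiableAt (ho.mem_nhds hz)).continuousAt
  rw [digamma_def]
  exact h1.div (continuousAt_Gamma_of_add_nat (add_nat_ne_zero_of_re_pos hz))
    (Gamma_ne_zero_of_re_pos hz)

theorem continuous_risingFactorial (k : ℕ) : Continuous fun a => risingFactorial a k :=
  (ascPochhammer ℂ k).continuous

/-- For `k ≤ n` the zero of the sine meets the pole of `ψ`. Reflection replaces `ψ(k - μ)` by `ψ(1 -
k + μ)`, regular at `μ = n`, so only the cosine term survives. -/
theorem tendsto_sin_mul_digamma_sub {n k : ℕ} (h : k ≤ n) :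
    Tendsto (fun μ : ℂ => sin (μ * Real.pi) * digamma (k - μ)) (𝓝[≠] (n : ℂ))
      (𝓝 (Real.pi * cos (n * Real.pi))) := by
  have hn0 : sin ((n : ℂ) * Real.pi) = 0 := Complex.sin_nat_mul_pi n
  have hre : 0 < (1 - (k - (n : ℂ))).re := by
    have : (k : ℝ) ≤ n := by exact_mod_cast h
    simp
    linarith
  have hd : ContinuousAt (fun μ : ℂ => digamma (1 - (k - μ))) n :=
    ContinuousAt.comp (f := fun μ : ℂ => 1 - (k - μ)) (continuousAt_digamma hre) (by fun_prop)
  have hs : ContinuousAt (fun μ : ℂ => sin (μ * Real.pi)) n := by fun_prop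
  have hc : ContinuousAt (fun μ : ℂ => Real.pi * cos (μ * Real.pi)) n := by fun_prop
  have hlim : Tendsto (fun μ : ℂ => sin (μ * Real.pi) * digamma (1 - (k - μ)) +
      Real.pi * cos (μ * Real.pi)) (𝓝 (n : ℂ)) (𝓝 (sin ((n : ℂ) * Real.pi) *
        digamma (1 - (k - n)) + Real.pi * cos (n * Real.pi))) := ((hs.mul hd).add hc).tendsto
  rw [hn0, zero_mul, zero_add] at hlim
  refine (hlim.mono_left nhdsWithin_le_nhds).congr' ?_
  have h2 : ∀ᶠ μ : ℂ in 𝓝[≠] (n : ℂ), sin (μ * Real.pi) ≠ 0 := by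
    filter_upwards [nhdsWithin_le_nhds (Metric.ball_mem_nhds (n : ℂ) one_pos),
      self_mem_nhdsWithin] with μ hb hne
    rw [Complex.sin_ne_zero_iff]
    intro m e
    have e' : μ = m := mul_right_cancel₀ pi_ne_zero' e
    refine hne ?_
    rw [Metric.mem_ball, e', dist_eq_norm, show ((m : ℂ) - n) = ((m - n : ℤ) : ℂ) by push_cast; rfl,
      norm_intCast] at hb
    have : |m - n| < 1 := by exact_mod_cast hb
    rw [Set.mem_singleton_iff, e', sub_eq_zero.1 (Int.abs_lt_one_iff.1 this), Int.cast_natCast]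
  have h3 : ∀ᶠ μ : ℂ in 𝓝[≠] (n : ℂ), ∀ i : ℕ, 1 - (k - μ) + i ≠ 0 := by
    have : ∀ᶠ μ : ℂ in 𝓝 (n : ℂ), 0 < (1 - (k - μ)).re :=
      (isOpen_lt continuous_const (by fun_prop)).mem_nhds hre
    exact nhdsWithin_le_nhds (this.mono fun μ hμ => add_nat_ne_zero_of_re_pos hμ)
  filter_upwards [h2, h3] with μ h2 h3
  have cosk : cos ((k : ℂ) * Real.pi) = (-1) ^ k := by
    exact_mod_cast congrArg (fun x : ℝ => (x : ℂ)) (Real.cos_nat_mul_pi k)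
  have es : sin (Real.pi * ((k : ℂ) - μ)) = -((-1) ^ k * sin (μ * Real.pi)) := by
    rw [show Real.pi * ((k : ℂ) - μ) = k * Real.pi - μ * Real.pi by ring, sin_sub,
      Complex.sin_nat_mul_pi, cosk]
    ring
  have ec : cos (Real.pi * ((k : ℂ) - μ)) = (-1) ^ k * cos (μ * Real.pi) := by
    rw [show Real.pi * ((k : ℂ) - μ) = k * Real.pi - μ * Real.pi by ring, cos_sub,
      Complex.sin_nat_mul_pi, cosk]
    ring
  have h1 : ∀ i : ℕ, (k : ℂ) - μ + i ≠ 0 := fun i e => h2 (by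
    rw [show μ = ((k + i : ℕ) : ℂ) by push_cast; linear_combination -e, Complex.sin_nat_mul_pi])
  have key := sin_mul_digamma_reflection h1 h3 (by rw [es]; simpa using h2)
  rw [es, ec] at key
  have hk : ((-1 : ℂ) ^ k) ≠ 0 := by simp
  refine mul_left_cancel₀ hk ?_
  linear_combination key

/-- The part of the prefactor that does not vanish at integers. -/
noncomputable def reducedPrefactor (ν : ℂ) : ℂ :=
  cos (ν * Real.pi / 2) / ((2 : ℂ) ^ ν * Real.pi) * (Gamma ((1 + ν) / 2) / Gamma ((2 + ν) / 2)) ^ 2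

theorem continuousAt_reducedPrefactor {ν : ℂ} (hν : -1 < ν.re) :
    ContinuousAt reducedPrefactor ν := by
  have h1 : ContinuousAt (fun μ : ℂ => Gamma ((1 + μ) / 2)) ν :=
    ContinuousAt.comp (f := fun μ : ℂ => (1 + μ) / 2)
      (continuousAt_Gamma_of_add_nat (add_nat_ne_zero_of_re_pos (half_re_pos hν))) (by fun_prop)
  have h2 : ContinuousAt (fun μ : ℂ => Gamma ((2 + μ) / 2)) ν :=
    ContinuousAt.comp (f := fun μ : ℂ => (2 + μ) / 2)
      (continuousAt_Gamma_of_add_nat (add_nat_ne_zero_of_re_pos (by simp; linarith)))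
      (by fun_prop)
  have h3 : ContinuousAt (fun μ : ℂ => (2 : ℂ) ^ μ) ν := continuousAt_const_cpow two_ne_zero
  have g2 := (Gamma_ne_zero_of_neg_one_lt_re hν).2.1
  have h4 : ContinuousAt (fun μ : ℂ => cos (μ * Real.pi / 2)) ν := by fun_prop
  exact (h4.div (h3.mul continuousAt_const) (mul_ne_zero (by simp) pi_ne_zero')).mul
    ((h1.div h2 g2).pow 2)

/-- The limit of a term of the digamma series at a nonnegative integer degree. -/
theorem tendsto_digammaSeriesTerm (n k : ℕ) :
    Tendsto (fun μ : ℂ => digammaSeriesPrefactor μ * digammaSeriesTerm μ k) (𝓝[≠] (n : ℂ))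
      (𝓝 (reducedPrefactor n * (Real.pi * cos (n * Real.pi)) *
        saalTerm ((1 + n) / 2) ((1 + n) / 2) (-n) 0 k)) := by
  have hn0 : sin ((n : ℂ) * Real.pi) = 0 := Complex.sin_nat_mul_pi n
  have hν : -1 < (n : ℂ).re := by
    rw [natCast_re]; linarith [(Nat.cast_nonneg n : (0 : ℝ) ≤ n)]
  set A : ℂ → ℂ := fun μ => reducedPrefactor μ *
    (risingFactorial ((1 + μ) / 2) k ^ 2 * risingFactorial (-μ) k / (k.factorial : ℂ) ^ 3) with hA
  have cA : ContinuousAt A n := by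
    have r1 : ContinuousAt (fun μ : ℂ => risingFactorial ((1 + μ) / 2) k) n :=
      ((continuous_risingFactorial k).comp (by fun_prop :
        Continuous fun μ : ℂ => (1 + μ) / 2)).continuousAt
    have r2 : ContinuousAt (fun μ : ℂ => risingFactorial (-μ) k) n :=
      ((continuous_risingFactorial k).comp (by fun_prop : Continuous fun μ : ℂ => -μ)).continuousAt
    exact (continuousAt_reducedPrefactor hν).mul (((r1.pow 2).mul r2).div_const _)
  have cs : ContinuousAt (fun μ : ℂ => sin (μ * Real.pi)) n := by fun_prop
  have cd : ContinuousAt (fun μ : ℂ => sin (μ * Real.pi) *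
      (2 * digamma (k + (μ + 1) / 2) - 3 * digamma (k + 1))) n := by
    have hre : 0 < ((k : ℂ) + ((n : ℂ) + 1) / 2).re := by simp; positivity
    have : ContinuousAt (fun μ : ℂ => digamma (k + (μ + 1) / 2)) n :=
      ContinuousAt.comp (f := fun μ : ℂ => (k : ℂ) + (μ + 1) / 2) (continuousAt_digamma hre)
        (by fun_prop)
    exact cs.mul ((this.const_mul 2).sub continuousAt_const)
  have split : ∀ μ : ℂ, digammaSeriesPrefactor μ * digammaSeriesTerm μ k =
      A μ * (sin (μ * Real.pi) * (2 * digamma (k + (μ + 1) / 2) - 3 * digamma (k + 1)) +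
        sin (μ * Real.pi) * digamma (k - μ)) := fun μ => by
    simp only [hA, digammaSeriesPrefactor, digammaSeriesTerm, reducedPrefactor]
    ring
  have hAn : A n * (Real.pi * cos (n * Real.pi)) =
      reducedPrefactor n * (Real.pi * cos (n * Real.pi)) *
        saalTerm ((1 + n) / 2) ((1 + n) / 2) (-n) 0 k := by
    have h1 : ((1 : ℂ) + n) / 2 + (1 + n) / 2 + -n + 0 = 1 := by ring
    rw [saalTerm, h1, gaussTerm, sub_zero, risingFactorial_one]
    simp only [hA]
    ring
  have l1 := cd.tendsto.mono_left (nhdsWithin_le_nhds (s := {(n : ℂ)}ᶜ))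
  have l2 := cA.tendsto.mono_left (nhdsWithin_le_nhds (s := {(n : ℂ)}ᶜ))
  simp only [hn0, zero_mul] at l1
  simp only [split]
  rcases le_or_gt k n with h | h
  · have := l2.mul (l1.add (tendsto_sin_mul_digamma_sub h))
    rwa [zero_add, hAn] at this
  · have hre : 0 < ((k : ℂ) - n).re := by
      have : (n : ℝ) < k := by exact_mod_cast h
      simpa using this
    have c3 : ContinuousAt (fun μ : ℂ => sin (μ * Real.pi) * digamma (k - μ)) n :=
      cs.mul (ContinuousAt.comp (f := fun μ : ℂ => (k : ℂ) - μ) (continuousAt_digamma hre)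
        (by fun_prop))
    have l3 := c3.tendsto.mono_left (nhdsWithin_le_nhds (s := {(n : ℂ)}ᶜ))
    simp only [hn0, zero_mul] at l3
    have := l2.mul (l1.add l3)
    -- For `k > n` the factor `(-n)_k` is zero and `ψ(k - μ)` is regular at `n`, so limit and
    -- claimed value both vanish.
    have z : A n = 0 := by simp only [hA]; rw [risingFactorial_neg_nat_eq_zero h]; simp
    rw [← hAn, z, zero_mul]
    rwa [z, zero_mul] at this

/-- The limits form a terminating balanced `₃F₂` with `d = 0`, summed by Pfaff–Saalschütz. -/
theorem hasSum_limit_digammaSeriesTerm (n : ℕ) :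
    HasSum (fun k => reducedPrefactor n * (Real.pi * cos (n * Real.pi)) *
      saalTerm ((1 + n) / 2) ((1 + n) / 2) (-n) 0 k) (tripleValue n) := by
  have hν : -1 < (n : ℂ).re := by
    rw [natCast_re]; linarith [(Nat.cast_nonneg n : (0 : ℝ) ≤ n)]
  have ha := add_nat_ne_zero_of_re_pos (half_re_pos hν)
  have h1 : ((1 : ℂ) + n) / 2 + (1 + n) / 2 - n = 1 := by ring
  have s := (summable_saalTerm (α := (1 + n) / 2) (β := (1 + n) / 2) (γ := -n) (d := 0)
    (by simpa using one_add_nat_ne_zero) (by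
      rw [show ((1 : ℂ) + n) / 2 + (1 + n) / 2 + -n + 0 = 1 by ring]
      exact one_add_nat_ne_zero)).hasSum
  rw [tsum_saalTerm_neg_nat n ha (by rw [h1]; exact one_add_nat_ne_zero) (by
    rw [show ((1 : ℂ) + n) / 2 - n = (1 - n) / 2 by ring]
    simp
    linarith [(Nat.cast_nonneg n : (0 : ℝ) ≤ n)]), h1,
    show ((1 : ℂ) + n) / 2 + (1 + n) / 2 = 1 + n by ring,
    show ((1 : ℂ) + n) / 2 - n = (1 - n) / 2 by ring,
    show 1 - ((1 : ℂ) + n) / 2 = (1 - n) / 2 by ring,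
    show (1 - (n : ℂ)) / 2 + n = (1 + n) / 2 by ring, ← Gamma_nat_eq_factorial,
    add_comm (n : ℂ) 1, Gamma_one, one_mul] at s
  have s' := s.mul_left (reducedPrefactor n * (Real.pi * cos (n * Real.pi)))
  obtain ⟨g1, g2, g3⟩ := Gamma_ne_zero_of_neg_one_lt_re hν
  have d := Gamma_one_add_sq n
  have t : (2 : ℂ) ^ (n : ℂ) ≠ 0 := by simp
  have hp := pi_ne_zero'
  have hd : Gamma (1 + (n : ℂ)) ^ 2 =
      (Gamma ((1 + n) / 2) * Gamma ((2 + n) / 2) * (2 : ℂ) ^ (n : ℂ)) ^ 2 / Real.pi := by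
    rw [← d]; field_simp
  -- For odd `n` both sides are zero; for even `n` the extra factor is one.
  have hcos : cos ((n : ℂ) * Real.pi / 2) * cos (n * Real.pi) = cos ((n : ℂ) * Real.pi / 2) := by
    have h0 : sin ((n : ℂ) * Real.pi) = 0 := Complex.sin_nat_mul_pi n
    have e : (n : ℂ) * Real.pi = 2 * (n * Real.pi / 2) := by ring
    rw [e, sin_two_mul] at h0
    rw [show cos ((n : ℂ) * Real.pi) = cos (2 * (n * Real.pi / 2)) by rw [← e], cos_two_mul]
    linear_combination (-sin ((n : ℂ) * Real.pi / 2)) * h0 +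
      2 * cos ((n : ℂ) * Real.pi / 2) * sin_sq_add_cos_sq ((n : ℂ) * Real.pi / 2)
  refine Eq.mp (congrArg (fun x => HasSum _ x) ?_) s'
  calc _ = cos ((n : ℂ) * Real.pi / 2) * cos (n * Real.pi) * Gamma ((1 + n) / 2) ^ 4 *
        (Gamma ((1 - (n : ℂ)) / 2))⁻¹ ^ 2 /
        ((2 : ℂ) ^ (n : ℂ) * Gamma ((2 + n) / 2) ^ 2 * Gamma (1 + (n : ℂ)) ^ 2) := by
        rw [reducedPrefactor]
        field_simp
    _ = _ := by
        rw [hcos, inv_Gamma_half hν, hd, tripleValue]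
        field_simp

/-! ### The well-poised series. -/

/-- With `a = (1 - ν) / 2`, the pair `(5 - ν) / 4` over `(1 - ν) / 4` is `1 + a / 2` over `a / 2`,
whose quotient of rising factorials is `(a + 2 k) / a`. Taking `b = a` makes `1 + a - b` equal to
the lower parameter `1`. -/
theorem pFqTerm_wellPoised {ν : ℂ} (h : ∀ m : ℤ, ν ≠ m) (k : ℕ) :
    pFqTerm (wellPoisedUpper ν) (wellPoisedLower ν) 1 k =
      ((1 - ν) / 2 + 2 * k) * wellPoisedTerm ((1 - ν) / 2) ((1 - ν) / 2) (-ν) ((1 + ν) / 2) k := by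
  have h0 : (1 - ν) / 2 ≠ 0 := fun e => h 1 (by push_cast; linear_combination -2 * e)
  have hq : ∀ i : ℕ, (1 - ν) / 4 + i ≠ 0 := fun i e =>
    h (1 + 4 * i) (by push_cast; linear_combination -4 * e)
  have hf := risingFactorial_ne_zero hq k
  have e : risingFactorial ((5 - ν) / 4) k / risingFactorial ((1 - ν) / 4) k =
      ((1 - ν) / 2 + 2 * k) / ((1 - ν) / 2) := by
    have hs : (1 - ν) / 4 * risingFactorial ((5 - ν) / 4) k =
        risingFactorial ((1 - ν) / 4) k * ((1 - ν) / 4 + k) := by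
      rw [← risingFactorial_succ, risingFactorial_succ_left]
      congr 2
      ring
    rw [div_eq_div_iff hf h0]
    linear_combination 2 * hs
  rw [wellPoisedTerm, show 1 + (1 - ν) / 2 - (1 - ν) / 2 = 1 by ring,
    show 1 + (1 - ν) / 2 - -ν = (3 + ν) / 2 by ring,
    show 1 + (1 - ν) / 2 - (1 + ν) / 2 = 1 - ν by ring]
  simp only [pFqTerm, wellPoisedUpper, wellPoisedLower, List.map_cons, List.map_nil,
    List.prod_cons, List.prod_nil, one_pow, mul_one]
  calc _ = risingFactorial ((1 - ν) / 2) k / risingFactorial 1 k *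
      (risingFactorial ((1 - ν) / 2) k / risingFactorial ((3 + ν) / 2) k) *
      (risingFactorial (-ν) k / risingFactorial (1 - ν) k) *
      (risingFactorial ((1 + ν) / 2) k / k.factorial) *
      (risingFactorial ((5 - ν) / 4) k / risingFactorial ((1 - ν) / 4) k) := by
        field_simp
    _ = _ := by rw [e]; ring

/-- Dougall's theorem at `a = b = (1 - ν) / 2`, `c = -ν`, `d = (1 + ν) / 2`. The convergence
quantity `1 + a - b - c - d` is `(1 + ν) / 2`, so `Re ν > -1` is exactly its condition. -/
theorem hasSum_wellPoised {ν : ℂ} (hν : -1 < ν.re) (h : ∀ m : ℤ, ν ≠ m) :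
    HasSum (pFqTerm (wellPoisedUpper ν) (wellPoisedLower ν) 1)
      ((1 + ν) / 2 * Gamma ((1 + ν) / 2) ^ 2 * (-ν * Gamma (-ν)) * (Gamma ((1 - ν) / 2))⁻¹ ^ 2 /
        ((1 - ν) / 2 * Gamma (1 + ν))) := by
  have ha : ∀ i : ℕ, (1 - ν) / 2 + i ≠ 0 := fun i e =>
    h (1 + 2 * i) (by push_cast; linear_combination -2 * e)
  have h1 : 1 + (1 - ν) / 2 - (1 - ν) / 2 = 1 := by ring
  have h2 : 1 + (1 - ν) / 2 - -ν = (1 + ν) / 2 + 1 := by ring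
  have h3 : 1 + (1 - ν) / 2 - (1 + ν) / 2 = -ν + 1 := by ring
  have h4 : 1 + (1 - ν) / 2 - (1 - ν) / 2 - -ν = 1 + ν := by ring
  have h5 : 1 + (1 - ν) / 2 - (1 - ν) / 2 - (1 + ν) / 2 = (1 - ν) / 2 := by ring
  have h6 : 1 + (1 - ν) / 2 - -ν - (1 + ν) / 2 = 1 := by ring
  have h7 : 1 + (1 - ν) / 2 - (1 - ν) / 2 - -ν - (1 + ν) / 2 = (1 + ν) / 2 := by ring
  have hb : ∀ i : ℕ, 1 + (1 - ν) / 2 - (1 - ν) / 2 + i ≠ 0 := by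
    rw [h1]; exact one_add_nat_ne_zero
  have hc : ∀ i : ℕ, 1 + (1 - ν) / 2 - -ν + i ≠ 0 := by
    rw [h2]; exact add_nat_ne_zero_of_re_pos (by simp; linarith)
  have hd : ∀ i : ℕ, 1 + (1 - ν) / 2 - (1 + ν) / 2 + i ≠ 0 := by
    rw [h3]
    exact fun i e => h (1 + i) (by push_cast; linear_combination -e)
  have hs : 0 < (1 + (1 - ν) / 2 - (1 - ν) / 2 - -ν - (1 + ν) / 2).re := by
    rw [h7]; exact half_re_pos hν
  have key := (summable_wellPoisedTerm hb hc hd hs).hasSum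
  rw [tsum_wellPoisedTerm ha hb hc hd hs, h7, h6, h5, h4, h3, h2, h1] at key
  have n1 : (1 + ν) / 2 ≠ 0 := fun e => h (-1) (by push_cast; linear_combination 2 * e)
  have n2 : (1 - ν) / 2 ≠ 0 := by simpa using ha 0
  have n3 : -ν ≠ 0 := fun e => h 0 (by push_cast; linear_combination -e)
  rw [Gamma_add_one _ n1, Gamma_add_one _ n3, add_comm 1 ((1 - ν) / 2), Gamma_add_one _ n2,
    Gamma_one] at key
  refine Eq.mp (congrArg (fun x => HasSum _ x) ?_)
    (key.congr_fun fun k => pFqTerm_wellPoised h k)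
  have g := Gamma_ne_zero_of_add_nat ha
  field_simp

theorem tripleValue_eq_wellPoised {ν : ℂ} (hν : -1 < ν.re) (h : ∀ m : ℤ, ν ≠ m) :
    tripleValue ν = 1 / Real.pi * (cos (ν * Real.pi / 2) / (2 : ℂ) ^ ν) ^ 3 *
      (Gamma ((1 + ν) / 2) / Gamma ((2 + ν) / 2)) ^ 2 *
      ((2 : ℂ) ^ (2 * ν + 1) * (1 - ν) / (ν * (ν + 1) * cot (ν * Real.pi / 2))) *
      pFq (wellPoisedUpper ν) (wellPoisedLower ν) 1 := by
  have hs : sin (ν * Real.pi) ≠ 0 := by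
    rw [Complex.sin_ne_zero_iff]
    exact fun k e => h k (mul_right_cancel₀ pi_ne_zero' e)
  have hG : Gamma (-ν) * sin (ν * Real.pi) = -Real.pi / Gamma (1 + ν) := by
    have := (Gamma_ne_zero_of_neg_one_lt_re hν).2.2
    rw [← Gamma_neg_mul_sin hs]; field_simp
  have h2 : sin (ν * Real.pi) = 2 * sin (ν * Real.pi / 2) * cos (ν * Real.pi / 2) := by
    rw [← sin_two_mul]; congr 1; ring
  rw [h2] at hs hG
  obtain ⟨hs', hc⟩ := mul_ne_zero_iff.1 hs
  have hs2 := (mul_ne_zero_iff.1 hs').2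
  obtain ⟨g1, g2, g3⟩ := Gamma_ne_zero_of_neg_one_lt_re hν
  have d := Gamma_one_add_sq ν
  have t : (2 : ℂ) ^ ν ≠ 0 := by simp
  have hp := pi_ne_zero'
  have hd : Gamma (1 + ν) ^ 2 =
      (Gamma ((1 + ν) / 2) * Gamma ((2 + ν) / 2) * (2 : ℂ) ^ ν) ^ 2 / Real.pi := by
    rw [← d]; field_simp
  have hGn : Gamma (-ν) = -Real.pi /
      (Gamma (1 + ν) * (2 * sin (ν * Real.pi / 2) * cos (ν * Real.pi / 2))) := by
    rw [eq_div_iff (by simp [g3, hs2, hc])]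
    rw [eq_div_iff g3] at hG
    linear_combination hG
  have n1 : ν + 1 ≠ 0 := fun e => h (-1) (by push_cast; linear_combination e)
  have n2 : 1 - ν ≠ 0 := fun e => h 1 (by push_cast; linear_combination -e)
  have n3 : ν ≠ 0 := fun e => h 0 (by push_cast; exact e)
  have ht : (2 : ℂ) ^ (2 * ν + 1) = 2 * ((2 : ℂ) ^ ν) ^ 2 := by
    rw [cpow_add _ _ two_ne_zero, cpow_one, two_mul ν, cpow_add _ _ two_ne_zero]
    ring
  rw [pFq, (hasSum_wellPoised hν h).tsum_eq, tripleValue, cot_eq_cos_div_sin, ht, inv_Gamma_half hν,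
    hGn]
  symm
  calc _ = cos (ν * Real.pi / 2) ^ 3 * Gamma ((1 + ν) / 2) ^ 6 /
        ((2 : ℂ) ^ ν * Real.pi ^ 2 * Gamma ((2 + ν) / 2) ^ 2 * Gamma (1 + ν) ^ 2) := by
        rw [add_comm 1 ν] at *
        generalize ν * (Real.pi : ℂ) / 2 = θ at *
        field_simp
    _ = _ := by
        rw [hd]; field_simp

/-! ### The main theorem. -/

theorem mainTheorem12 (ν : ℂ) (hν : -1 < ν.re) :
    -- the integral converges absolutely and has a closed form
    (IntervalIntegrable (tildeTIntegrand ν) MeasureTheory.volume (-1) 1 ∧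
      tildeT ν = 1 / Real.pi * (cos (ν * Real.pi / 2) / (2 : ℂ) ^ ν) ^ 3 *
        (Gamma ((1 + ν) / 2) / Gamma ((2 + ν) / 2)) ^ 4) ∧
    -- the digamma series, where all its terms are finite
    ((∀ n : ℕ, ν ≠ n) →
      Summable (digammaSeriesTerm ν) ∧
        tildeT ν = digammaSeriesPrefactor ν * ∑' k : ℕ, digammaSeriesTerm ν k) ∧
    -- the digamma series at a nonnegative integer degree, its indeterminate terms
    -- (respectively its value) being understood as limits
    (∀ n : ℕ, ν = n →
      (∃ c : ℕ → ℂ,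
        (∀ k : ℕ, Tendsto (fun μ : ℂ => digammaSeriesPrefactor μ * digammaSeriesTerm μ k)
          (𝓝[≠] ν) (𝓝 (c k))) ∧
        HasSum c (tildeT ν)) ∧
      Tendsto (fun μ : ℂ => digammaSeriesPrefactor μ * ∑' k : ℕ, digammaSeriesTerm μ k)
        (𝓝[≠] ν) (𝓝 (tildeT ν))) ∧
    -- the well-poised hypergeometric series
    ((∀ m : ℤ, ν ≠ m) →
      Summable (pFqTerm (wellPoisedUpper ν) (wellPoisedLower ν) 1) ∧
        tildeT ν = 1 / Real.pi * (cos (ν * Real.pi / 2) / (2 : ℂ) ^ ν) ^ 3 *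
          (Gamma ((1 + ν) / 2) / Gamma ((2 + ν) / 2)) ^ 2 *
          ((2 : ℂ) ^ (2 * ν + 1) * (1 - ν) / (ν * (ν + 1) * cot (ν * Real.pi / 2))) *
          pFq (wellPoisedUpper ν) (wellPoisedLower ν) 1) := by
  have e : tildeT ν = tripleValue ν := tildeT_eq_tripleValue hν
  refine ⟨⟨?_, e⟩, fun h => ?_, fun n h => ?_, fun h => ?_⟩
  · have := intervalIntegrable_tildeTIntegrand (half_re_pos hν)
    rwa [show 2 * ((1 + ν) / 2) - 1 = ν by ring] at this
  · exact ⟨(hasSum_digammaSeriesTerm hν h).summable, e.trans (tripleValue_eq_digammaSeries hν h)⟩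
  · rw [e]
    refine ⟨⟨fun k => reducedPrefactor n * (Real.pi * cos (n * Real.pi)) *
      saalTerm ((1 + n) / 2) ((1 + n) / 2) (-n) 0 k, fun k => ?_, ?_⟩, tendsto_digammaSeries hν h⟩
    · rw [h]
      exact tendsto_digammaSeriesTerm n k
    · rw [h]
      exact hasSum_limit_digammaSeriesTerm n
  · exact ⟨(hasSum_wellPoised hν h).summable, e.trans (tripleValue_eq_wellPoised hν h)⟩
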